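/- **Setting.** Let $\Psi^\ell$, $\ell\in\{0,1,2,\dots\}\cup\{\infty\}$, be random maps $\mathbb R^d\to\mathbb R^d$ driven by a common noise ($\Psi:=\Psi^\infty$ is the exact solution operator over a unit time interval, for instance of an autonomous SDE, and $\Psi^\ell$ a numerical solver with uniform time step $1/N_\ell$, where $N_\ell\in\mathbb N$, $N_0\ge 1$ and $N_{\ell+1}\ge \widehat N N_\ell$ for some $\widehat N>1$). Different time steps use independent copies of the noise, and in expressions such as $\Psi^\ell(u)$ the random variable $u$ is independent of the noise driving $\Psi^\ell$. Let $H\in\mathbb R^{m\times d}$, let $\Gamma\in\mathbb R^{m\times m}$ be symmetric positive definite, let $y_1,y_2,\dots\in\mathbb R^m$ be fixed observed values, and let $u_0\in\bigcap_{p}L^p$ be the random initial state. Write $\|u\|_p=\mathbb E[|u|^p]^{1/p}$. *Mean-field EnKF.* $\mu_0$ is the law of $u_0$. If $\hat v_n\sim\mu_n$, put $v_{n+1}=\Psi(\hat v_n)$, $C_{n+1}=\operatorname{Cov}[v_{n+1}]$, $K_{n+1}=C_{n+1}H^T(HC_{n+1}H^T+\Gamma)^{-1}$; then $\mu_{n+1}$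 is the law of $(I-K_{n+1}H)v_{n+1}+K_{n+1}(y_{n+1}+\eta)$ with independent $\eta\sim N(0,\Gamma)$. *MLEnKF.* Fix $L$ and $M_0,\dots,M_L\ge1$. For $0\le\ell\le L$ and $1\le i\le M_\ell$ there is a pair $(\hat v^{\ell}_{n,(\ell,i)},\hat v^{\ell-1}_{n,(\ell,i)})$, with $\hat v^{-1}:=0$. Both components start from the same copy of $u_0$ and are predicted by $\Psi^\ell$ and $\Psi^{\ell-1}$, respectively, with the same noise, giving $v^\ell_{n+1,(\ell,i)}$ and $v^{\ell-1}_{n+1,(\ell,i)}$ (with $v^{-1}:=0$). With the multilevel sample covariance $C^{ML}_{n+1}=\sum_{\ell=0}^L(\operatorname{cov}_{M_\ell}[v^\ell_{n+1}]-\operatorname{cov}_{M_\ell}[v^{\ell-1}_{n+1}])$, where $\operatorname{cov}_M[u]=E_M[uu^T]-E_M[u]E_M[u]^T$ and $E_M$ is the sample mean, and with $\tilde C^{ML}_{n+1}$ obtained from $C^{ML}_{n+1}$ by dropping its negative eigenvalues, put $K^{ML}_{n+1}=C^{ML}_{n+1}H^T(H\tilde C^{ML}_{n+1}H^T+\Gamma)^{-1}$.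 Each component $v$ (except those of level $-1$, which stay $0$) is updated to $(I-K^{ML}_{n+1}H)v+K^{ML}_{n+1}(y_{n+1}+\eta)$, where $\eta\sim N(0,\Gamma)$ is the same for both components of a pair. All initial states, driving noises and perturbations $\eta$ are independent over the pairs and times. Put $$\mu^{ML}_n(\varphi)=\frac1{M_0}\sum_{i=1}^{M_0}\varphi(\hat v^0_{n,(0,i)})+\sum_{\ell=1}^L\frac1{M_\ell}\sum_{i=1}^{M_\ell}\bigl(\varphi(\hat v^\ell_{n,(\ell,i)})-\varphi(\hat v^{\ell-1}_{n,(\ell,i)})\bigr).$$ **Assumption 1.** For every $p\ge2$ there is $c_\Psi<\infty$ such that for all $\ell\in\{0,1,\dots\}\cup\{\infty\}$ and all random $u,v$: $\|\Psi^\ell(u)-\Psi^\ell(v)\|_p\le c_\Psi\|u-v\|_p$ and $\|\Psi^\ell(u)\|_p^p\le c_\Psi(1+\|u\|_p^p)$. **Assumption 2.** Let $\alpha,\beta,\gamma>0$ with $\alpha\ge\min(\beta,\gamma)/2$, and let $\mathcal F$ be a class of functions $\mathbb R^d\to\mathbb R$ containing all monomials of degree at most $2$. For a sequence $(u_\ell)$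 bounded in every $L^p$ and $v\in\bigcap_pL^p$, say that $u_\ell\to v$ *weakly with rate $\alpha$* if for every $\varphi\in\mathcal F$ there is a constant $c$ with $|\mathbb E[\varphi(u_\ell)-\varphi(v)]|\le cN_\ell^{-\alpha}$ for all $\ell$. Assume: (i) if $u_\ell\to v$ weakly with rate $\alpha$, then $\Psi^\ell(u_\ell)\to\Psi(v)$ weakly with rate $\alpha$ and, for all $K\in\mathbb R^{d\times m}$, $y\in\mathbb R^m$ and independent $\eta\sim N(0,\Gamma)$, $(I-KH)u_\ell+K(y+\eta)\to(I-KH)v+K(y+\eta)$ weakly with rate $\alpha$; (ii) for all $\varphi\in\mathcal F$, $v\in\bigcap_pL^p$ and $p\ge2$, there is a constant $c$ with $\|\varphi(\Psi^{\ell}(v))-\varphi(\Psi^{\ell-1}(v))\|_p\le cN_\ell^{-\beta/2}$ for all $\ell\ge1$; (iii) the cost of one evaluation of $\Psi^\ell$ is at most a constant times $N_\ell^\gamma$. **Theorem.** Under these assumptions, let $\varepsilon\in(0,\varepsilon_0]$ with $\varepsilon_0<1$ fixed, and let $L$ and $M_\ell$ satisfy $L\eqsim\log(\varepsilon^{-1})$,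 $N_L\eqsim\varepsilon^{-1/\alpha}$ and, for $0\le\ell\le L$, $$M_\ell\eqsim\left\lceil N_\ell^{-\frac{\beta+2\gamma}3}\cdot\begin{cases}N_L^{2\alpha},&\beta>\gamma,\\L^2N_L^{2\alpha},&\beta=\gamma,\\N_L^{2\alpha+\frac23(\gamma-\beta)},&\beta<\gamma\end{cases}\right\rceil,$$ where $f\eqsim g$ means $c_1g\le f\le c_2g$ with fixed constants $c_1,c_2>0$. Then for every $n$, every $p\ge2$ and every $\varphi\in\mathcal F$ for which there are $\nu,C_\varphi>0$ with $|\varphi(x)-\varphi(y)|\le C_\varphi|x-y|(1+|x|^\nu+|y|^\nu)$ for all $x,y$, $$\|\mu^{ML}_n(\varphi)-\mu_n(\varphi)\|_p\lesssim|\log\varepsilon|^n\,\varepsilon .$$ The cost of $n$ steps of the MLEnKF (the evaluations of $\Psi^\ell$ and $\Psi^{\ell-1}$ for each pair, a fixed cost per pair for its update, and a fixed cost per step for the gain) satisfies $$\operatorname{Cost}(\mathrm{MLEnKF})\lesssim\begin{cases}\varepsilon^{-2},&\beta>\gamma,\\\varepsilon^{-2}|\log\varepsilon|^3,&\beta=\gamma,\\\varepsilon^{-(2+\frac{\gamma-\beta}\alpha)},&\beta<\gamma.\end{cases}$$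 The constants in $\lesssim$ do not depend on $\varepsilon$, $L$ and $(M_\ell)$. Moreover, in the linear Gaussian case ($\Psi(x)\sim N(Ax,\Sigma)$ for every $x$, with $\Sigma$ symmetric positive definite, and $u_0$ Gaussian), $\mu_n$ is the filtering distribution, i.e. the conditional law, given the observed values $y_1,\dots,y_n$ of $H u_k+\eta_k$ ($1\le k\le n$; $\eta_k\sim N(0,\Gamma)$ independent), of the state $u_n$ of the signal $u_{k+1}=\Psi(u_k)$, and it equals $N(\hat m_n,\hat C_n)$ with mean and covariance given by the Kalman filter. -/

import Mathlib

open MeasureTheory ProbabilityTheory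
open scoped NNReal ENNReal

namespace MLEnKF

noncomputable section

/-- The Euclidean space `ℝ^k`. -/
abbrev E (k : ℕ) : Type := EuclideanSpace ℝ (Fin k)

/-- A probability law on `ℝ^k` belonging to `L^p` for every finite `p`. -/
def HasAllMoments {k : ℕ} (ρ : Measure (E k)) : Prop :=
  ∀ p : ℝ≥0, MemLp (fun x : E k => x) (p : ℝ≥0∞) ρ

/-- A sequence of laws whose `L^p` norms are bounded uniformly along the sequence, for every
finite `p`. -/
def UniformMoments {k : ℕ} (ρ : ℕ → Measure (E k)) : Prop :=
  ∀ p : ℝ≥0, ∃ R : ℝ≥0, ∀ l, eLpNorm (fun x : E k => x) (p : ℝ≥0∞) (ρ l) ≤ R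

/-- The data of the filtering problem.

The solution operators `Psi l`, `l : ℕ`, approximate the exact one, `Psi ⊤`. They are random maps
driven by one and the same noise: `Psi l x ξ` is the value at time one of the level `l` solver
started from `x` and driven by the noise realization `ξ` (for a stochastic differential equation,
`ξ` is the path of increments of the Wiener process over a unit time interval).
The state is observed through `y_n = H u_n + η_n` with `η_n ∼ N(0, Γ)`, and `obs n` is the fixed
observed value of `y_n` for `n ≥ 1`. -/
structure Model (d m : ℕ) (Ξ : Type*) [MeasurableSpace Ξ] where
  /-- the solution operators -/
  Psi : ℕ∞ → E d → Ξ → E d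
  /-- the law of the driving noise over one unit of time -/
  noise : Measure Ξ
  /-- the law of the initial state `u_0` -/
  init : Measure (E d)
  /-- the observation operator -/
  H : Matrix (Fin m) (Fin d) ℝ
  /-- the covariance of the observation noise -/
  Γ : Matrix (Fin m) (Fin m) ℝ
  /-- the observed data -/
  obs : ℕ → E m
  measurable_Psi : ∀ l, Measurable (fun z : E d × Ξ => Psi l z.1 z.2)
  isProbabilityMeasure_noise : IsProbabilityMeasure noise
  isProbabilityMeasure_init : IsProbabilityMeasure init
  init_moments : HasAllMoments init
  posDef_Γ : Γ.PosDef

attribute [instance] Model.isProbabilityMeasure_noise Model.isProbabilityMeasure_init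

/-- The action of a matrix on a Euclidean vector. -/
def act {j k : ℕ} (A : Matrix (Fin j) (Fin k) ℝ) (x : E k) : E j :=
  WithLp.toLp 2 (A.mulVec x.ofLp)

variable {d m : ℕ} {Ξ : Type*} [MeasurableSpace Ξ]

/-! ### The mean-field ensemble Kalman filter -/

/-- The gain `C Hᵀ (H C' Hᵀ + Γ)⁻¹`. The two covariances `C` and `C'` agree for the Kalman filter
and for the mean-field filter; the multilevel filter uses a modified `C'`. -/
def Model.gain (S : Model d m Ξ) (C C' : Matrix (Fin d) (Fin d) ℝ) : Matrix (Fin d) (Fin m) ℝ :=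
  C * S.H.transpose * (S.H * C' * S.H.transpose + S.Γ)⁻¹

/-- The update `(I - K H) x + K (y + η)` of a state `x` with gain `K`, observed value `y` and
perturbation `η` of the observation. -/
def Model.update (S : Model d m Ξ) (K : Matrix (Fin d) (Fin m) ℝ) (y : E m) (x : E d) (η : E m) :
    E d :=
  act (1 - K * S.H) x + act K (y + η)

/-- The law of `Ψ^l(u)` when `u` has law `ρ` and is independent of the driving noise. -/
def Model.predictLaw (S : Model d m Ξ) (l : ℕ∞) (ρ : Measure (E d)) : Measure (E d) :=
  (ρ.prod S.noise).map (fun z => S.Psi l z.1 z.2)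

/-- The law of `(I - K H) u + K (y + η)` when `u` has law `ρ` and `η ∼ N(0, Γ)` is independent
of `u`. -/
def Model.updateLaw (S : Model d m Ξ) (K : Matrix (Fin d) (Fin m) ℝ) (y : E m)
    (ρ : Measure (E d)) : Measure (E d) :=
  (ρ.prod (multivariateGaussian 0 S.Γ)).map (fun z => S.update K y z.1 z.2)

/-- The covariance matrix of a law on `ℝ^d`. -/
def covMatrix (ρ : Measure (E d)) : Matrix (Fin d) (Fin d) ℝ :=
  Matrix.of fun j k => covariance (fun x : E d => x j) (fun x : E d => x k) ρ

/-- The law `μ_n` of the (updated) mean-field ensemble Kalman filter at time `n`. -/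
def Model.meanFieldLaw (S : Model d m Ξ) : ℕ → Measure (E d)
  | 0 => S.init
  | n + 1 =>
    let π := S.predictLaw ⊤ (S.meanFieldLaw n)
    S.updateLaw (S.gain (covMatrix π) (covMatrix π)) (S.obs (n + 1)) π

/-! ### The filtering distribution and the Kalman filter -/

/-- The filtering distribution, i.e. the conditional law of `u_n` given the observed values
`y_1, …, y_n`: the predicted law is reweighted by the likelihood, which is proportional to
`exp (- (y - H x)ᵀ Γ⁻¹ (y - H x) / 2)`, and normalized. -/
def Model.filteringLaw (S : Model d m Ξ) : ℕ → Measure (E d)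
  | 0 => S.init
  | n + 1 =>
    (S.predictLaw ⊤ (S.filteringLaw n)).tilted fun x =>
      -(1 / 2) * inner ℝ (S.obs (n + 1) - act S.H x)
        (act S.Γ⁻¹ (S.obs (n + 1) - act S.H x))

/-- The mean and covariance produced by the Kalman filter for `Ψ(u) = A u + ξ`, `ξ ∼ N(0, Q)`,
started from the mean `m₀` and the covariance `C₀`. -/
def Model.kalman (S : Model d m Ξ) (A Q : Matrix (Fin d) (Fin d) ℝ) (m₀ : E d)
    (C₀ : Matrix (Fin d) (Fin d) ℝ) : ℕ → E d × Matrix (Fin d) (Fin d) ℝ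
  | 0 => (m₀, C₀)
  | n + 1 =>
    let prev := S.kalman A Q m₀ C₀ n
    let mPred := act A prev.1
    let CPred := A * prev.2 * A.transpose + Q
    let K := S.gain CPred CPred
    (act (1 - K * S.H) mPred + act K (S.obs (n + 1)), (1 - K * S.H) * CPred)

/-! ### The multilevel ensemble Kalman filter -/

/-- All the randomness used by one particle: its initial state, the driving noises of the solver
on the successive time intervals, and the perturbations of the observations. -/
abbrev Draw (d m : ℕ) (Ξ : Type*) : Type _ := E d × (ℕ → Ξ) × (ℕ → E m)

/-- The law of the randomness of one particle. -/
def Model.drawLaw (S : Model d m Ξ) : Measure (Draw d m Ξ) :=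
  S.init.prod ((Measure.infinitePi fun _ : ℕ => S.noise).prod
    (Measure.infinitePi fun _ : ℕ => multivariateGaussian 0 S.Γ))

/-- A multilevel ensemble: the `i`-th particle of level `l` is a pair, whose first component lives
on level `l` and whose second component lives on level `l - 1` (it is `0` if `l = 0`). -/
abbrev Ensemble (d : ℕ) : Type := ℕ → ℕ → E d × E d

/-- The sample mean of `u 0, …, u (M - 1)`. -/
def sampleMean (M : ℕ) (u : ℕ → E d) : E d := (M : ℝ)⁻¹ • ∑ i ∈ Finset.range M, u i

/-- The sample covariance `E_M[u uᵀ] - E_M[u] E_M[u]ᵀ`. -/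
def sampleCov (M : ℕ) (u : ℕ → E d) : Matrix (Fin d) (Fin d) ℝ :=
  Matrix.of fun j k =>
    (M : ℝ)⁻¹ * ∑ i ∈ Finset.range M, u i j * u i k - sampleMean M u j * sampleMean M u k

/-- The multilevel sample covariance of an ensemble with `M l` particles on level `l ≤ L`. -/
def multilevelCov (L : ℕ) (M : ℕ → ℕ) (u : Ensemble d) : Matrix (Fin d) (Fin d) ℝ :=
  ∑ l ∈ Finset.range (L + 1),
    (sampleCov (M l) (fun i => (u l i).1) - sampleCov (M l) (fun i => (u l i).2))

open scoped Classical in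
/-- For a symmetric matrix `∑ λ_k q_k q_kᵀ`, its truncation `∑_{λ_k > 0} λ_k q_k q_kᵀ`. -/
def truncate (C : Matrix (Fin d) (Fin d) ℝ) : Matrix (Fin d) (Fin d) ℝ :=
  if hC : C.IsHermitian then
    ∑ k with 0 < hC.eigenvalues k,
      hC.eigenvalues k •
        Matrix.vecMulVec (hC.eigenvectorBasis k).ofLp (hC.eigenvectorBasis k).ofLp
  else 0

/-- The multilevel sample covariance is symmetric, so that `truncate` is always applied to a
symmetric matrix. -/
theorem multilevelCov_isHermitian (L : ℕ) (M : ℕ → ℕ) (u : Ensemble d) :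
    (multilevelCov L M u).IsHermitian := by
  ext j k
  simp [multilevelCov, sampleCov, Matrix.sum_apply, mul_comm]

/-- The prediction step of the multilevel filter over the time interval from `n` to `n + 1`; both
components of a pair are driven by the same noise. -/
def Model.predictEnsemble (S : Model d m Ξ) (ω : ℕ → ℕ → Draw d m Ξ) (n : ℕ) (u : Ensemble d) :
    Ensemble d := fun l i =>
  (S.Psi l (u l i).1 ((ω l i).2.1 n),
    match l with
    | 0 => 0
    | k + 1 => S.Psi k (u (k + 1) i).2 ((ω (k + 1) i).2.1 n))

/-- The gain of the multilevel filter computed from a predicted ensemble. -/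
def Model.multilevelGain (S : Model d m Ξ) (L : ℕ) (M : ℕ → ℕ) (v : Ensemble d) :
    Matrix (Fin d) (Fin m) ℝ :=
  S.gain (multilevelCov L M v) (truncate (multilevelCov L M v))

/-- The updated multilevel ensemble at time `n`, as a function of the randomness of the particles;
`ω l i` belongs to the `i`-th particle of level `l`. Both components of a pair start from the same
initial state and are updated with the same perturbed observation. -/
def Model.ensemble (S : Model d m Ξ) (L : ℕ) (M : ℕ → ℕ) (ω : ℕ → ℕ → Draw d m Ξ) :
    ℕ → Ensemble d
  | 0 => fun l i => ((ω l i).1, if l = 0 then 0 else (ω l i).1)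
  | n + 1 =>
    let v := S.predictEnsemble ω n (S.ensemble L M ω n)
    let K := S.multilevelGain L M v
    fun l i =>
      (S.update K (S.obs (n + 1)) (v l i).1 ((ω l i).2.2 (n + 1)),
        if l = 0 then 0 else S.update K (S.obs (n + 1)) (v l i).2 ((ω l i).2.2 (n + 1)))

/-- The integral `μ(φ)` of `φ` against the (signed) empirical measure of a multilevel ensemble,
`(1 / M_0) ∑_i δ_{v^0_i} + ∑_{l = 1}^L (1 / M_l) ∑_i (δ_{v^l_i} - δ_{v^{l-1}_i})`. -/
def empiricalIntegral (L : ℕ) (M : ℕ → ℕ) (u : Ensemble d) (φ : E d → ℝ) : ℝ :=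
  ∑ l ∈ Finset.range (L + 1), (M l : ℝ)⁻¹ *
    ∑ i ∈ Finset.range (M l), (φ (u l i).1 - if l = 0 then 0 else φ (u l i).2)

/-- The computational cost of `n` steps of the multilevel filter. In each step, every particle pair
of level `l` requires one evaluation of `Ψ^l`, one of `Ψ^{l-1}` (if `l ≥ 1`), and an amount
`pairCost` of work for its contribution to the sample covariance and for its update; `gainCost` is
the cost per step of computing the gain from the sample covariance. -/
def totalCost (cost : ℕ → ℝ≥0) (pairCost gainCost : ℝ≥0) (n L : ℕ) (M : ℕ → ℕ) : ℝ≥0 :=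
  ∑ _k ∈ Finset.range n,
    (∑ l ∈ Finset.range (L + 1),
      (M l : ℝ≥0) * (cost l + (if l = 0 then 0 else cost (l - 1)) + pairCost) + gainCost)

/-! ### Assumptions -/

/-- The Lipschitz and moment conditions on the solution operators, uniformly over the levels
(including the exact operator). Here `π` is the joint law of a pair of random variables `(u, v)`
and `ρ` is the law of `u`; they are independent of the driving noise. -/
structure LipschitzMoment (S : Model d m Ξ) : Prop where
  lipschitz : ∀ p : ℝ≥0, 2 ≤ p → ∃ c : ℝ≥0, 0 < c ∧ ∀ l : ℕ∞,
    ∀ π : Measure (E d × E d), IsProbabilityMeasure π →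
      eLpNorm (fun z : (E d × E d) × Ξ => S.Psi l z.1.1 z.2 - S.Psi l z.1.2 z.2) p (π.prod S.noise)
        ≤ c * eLpNorm (fun w : E d × E d => w.1 - w.2) p π
  moment : ∀ p : ℝ≥0, 2 ≤ p → ∃ c : ℝ≥0, 0 < c ∧ ∀ l : ℕ∞,
    ∀ ρ : Measure (E d), IsProbabilityMeasure ρ →
      eLpNorm (fun z : E d × Ξ => S.Psi l z.1 z.2) p (ρ.prod S.noise) ^ (p : ℝ)
        ≤ c * (1 + eLpNorm (fun x : E d => x) p ρ ^ (p : ℝ))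

/-- The laws `ρ l` converge to `ρ'` weakly with rate `r l`, when tested against the class `F`. -/
def WeakRate (F : Set (E d → ℝ)) (r : ℕ → ℝ) (ρ : ℕ → Measure (E d)) (ρ' : Measure (E d)) : Prop :=
  ∀ φ ∈ F, ∃ c : ℝ, ∀ l, |∫ x, φ x ∂(ρ l) - ∫ x, φ x ∂ρ'| ≤ c * r l

/-- The multilevel rate conditions with exponents `α, β, γ` for a class `F` of observables. The
level `l` solver uses the uniform time step `1 / N l`, and one evaluation of it costs `cost l`. -/
structure MultilevelRates (S : Model d m Ξ) (F : Set (E d → ℝ)) (N : ℕ → ℕ) (cost : ℕ → ℝ≥0)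
    (α β γ : ℝ) : Prop where
  α_pos : 0 < α
  β_pos : 0 < β
  γ_pos : 0 < γ
  min_le : min β γ / 2 ≤ α
  N_pos : ∀ l, 0 < N l
  N_growth : ∃ b : ℝ, 1 < b ∧ ∀ l, b * N l ≤ N (l + 1)
  /-- The prediction step preserves weak convergence with rate `N_l^{-α}`. -/
  weak_predict : ∀ (ρ : ℕ → Measure (E d)) (ρ' : Measure (E d)),
    (∀ l, IsProbabilityMeasure (ρ l)) → IsProbabilityMeasure ρ' →
    UniformMoments ρ → HasAllMoments ρ' →
    WeakRate F (fun l => (N l : ℝ) ^ (-α)) ρ ρ' →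
    WeakRate F (fun l => (N l : ℝ) ^ (-α)) (fun l => S.predictLaw l (ρ l)) (S.predictLaw ⊤ ρ')
  /-- The update step with a fixed gain preserves weak convergence with rate `N_l^{-α}`. -/
  weak_update : ∀ (ρ : ℕ → Measure (E d)) (ρ' : Measure (E d)),
    (∀ l, IsProbabilityMeasure (ρ l)) → IsProbabilityMeasure ρ' →
    UniformMoments ρ → HasAllMoments ρ' →
    WeakRate F (fun l => (N l : ℝ) ^ (-α)) ρ ρ' →
    ∀ (K : Matrix (Fin d) (Fin m) ℝ) (y : E m),
      WeakRate F (fun l => (N l : ℝ) ^ (-α)) (fun l => S.updateLaw K y (ρ l)) (S.updateLaw K y ρ')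
  /-- Consecutive levels are close with rate `N_l^{-β/2}` in every `L^p`. -/
  strong : ∀ φ ∈ F, ∀ ρ : Measure (E d), IsProbabilityMeasure ρ → HasAllMoments ρ →
    ∀ p : ℝ≥0, 2 ≤ p → ∃ c : ℝ, ∀ l : ℕ,
      eLpNorm (fun z : E d × Ξ =>
          φ (S.Psi ((l + 1 : ℕ) : ℕ∞) z.1 z.2) - φ (S.Psi (l : ℕ∞) z.1 z.2)) p (ρ.prod S.noise)
        ≤ ENNReal.ofReal (c * (N (l + 1) : ℝ) ^ (-β / 2))
  cost_le : ∃ c : ℝ, ∀ l, (cost l : ℝ) ≤ c * (N l : ℝ) ^ γ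
  /-- `F` contains the monomials of degree at most two. -/
  one_mem : (fun _ : E d => (1 : ℝ)) ∈ F
  coord_mem : ∀ j, (fun x : E d => x j) ∈ F
  coord_mul_mem : ∀ j k, (fun x : E d => x j * x k) ∈ F

/-- Local Lipschitz continuity with at most polynomial growth at infinity. -/
def LocallyLipschitzPoly (φ : E d → ℝ) : Prop :=
  ∃ ν c : ℝ, 0 < ν ∧ 0 < c ∧
    ∀ x y : E d, |φ x - φ y| ≤ c * ‖x - y‖ * (1 + ‖x‖ ^ ν + ‖y‖ ^ ν)

/-! ### The choice of the parameters and the cost bound -/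

open scoped Classical in
/-- The sample size prescribed on level `l`. -/
def sampleSize (N : ℕ → ℕ) (α β γ : ℝ) (L l : ℕ) : ℕ :=
  ⌈(N l : ℝ) ^ (-(β + 2 * γ) / 3) *
    (if γ < β then (N L : ℝ) ^ (2 * α)
      else if β = γ then (L : ℝ) ^ 2 * (N L : ℝ) ^ (2 * α)
      else (N L : ℝ) ^ (2 * α + 2 / 3 * (γ - β)))⌉₊

/-- The constraints on the number of levels and on the sample sizes for the accuracy `ε`, where
`c₁` and `c₂` are the constants hidden in the three relations
`L ≂ log (1 / ε)`, `N_L ≂ ε^{-1/α}` and `M_l ≂ sampleSize`. -/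
structure Admissible (N : ℕ → ℕ) (α β γ c₁ c₂ ε : ℝ) (L : ℕ) (M : ℕ → ℕ) : Prop where
  le_L : c₁ * Real.log ε⁻¹ ≤ L
  L_le : (L : ℝ) ≤ c₂ * Real.log ε⁻¹
  le_N : c₁ * ε ^ (-1 / α) ≤ N L
  N_le : (N L : ℝ) ≤ c₂ * ε ^ (-1 / α)
  le_M : ∀ l ≤ L, c₁ * sampleSize N α β γ L l ≤ M l
  M_le : ∀ l ≤ L, (M l : ℝ) ≤ c₂ * sampleSize N α β γ L l

open scoped Classical in
/-- The bound on the cost as a function of the accuracy `ε`. -/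
def costRate (α β γ ε : ℝ) : ℝ :=
  if γ < β then ε ^ (-2 : ℝ)
  else if β = γ then ε ^ (-2 : ℝ) * |Real.log ε| ^ 3
  else ε ^ (-(2 + (γ - β) / α))

end

end MLEnKF

open MLEnKF

namespace MLEnKF

/-! ### Families of random variables that are small in every `L^p` -/

/-! The particles of the multilevel ensemble interact through the random gain. They are compared
with mean-field particles `path l n`, driven by the same draws but updated, on every level, with the
deterministic gain `meanGain` of the exact mean-field filter. Mean-field pairs with different
indices are independent; their laws inherit the weak rate N_l^{-α} by induction over the time steps,
and consecutive levels differ by O(N_l^{-β/2}) in every L^p (`Model.weakRate_path`,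
`Model.lpO_path_sub`).

All bounds are written with `LpO`. It asks for every p at once because products (covariances, gain
times state) are treated by Hölder, which doubles p, and it carries an index set because the
constants must be uniform: in the end the index runs over all admissible parameters.

One time step is `CloseTo.step`. Let r be the distance between the ensemble and the mean-field
particles. Prediction keeps r up to a constant, by the Lipschitz assumption. The multilevel sample
covariance has error (L+1) r from the particles, ε from sampling the independent pairs
(Marcinkiewicz–Zygmund, `LpO.iidAverage`, `LpO.sampleCov_pair`) and ε from the bias. The gain is a
Lipschitz function of the covariance at the fixed positive semidefinite mean-field covariance
(`Model.exists_gain_sub_le`): dropping negative eigenvalues is nonexpansive in the Frobenius norm,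
and the inverse is uniformly bounded because Γ is positive definite. Hence r becomes O((L+1) r + ε).
Starting from r = 0, the distance after n ≥ 1 steps is O((L+1)^{n-1} ε); summation over the levels
in the estimator gives (L+1)^n ε, and L is of order |log ε|. Since (L+1)^k ε is bounded for every k,
the ensembles stay bounded in every L^p, which the product estimates need.

The sample sizes minimize the cost ∑ M_l N_l^γ for a given value of ∑ N_l^{-β/2} M_l^{-1/2}, the
bound that the triangle inequality gives for the sampling error. With this choice both sums are
governed by g ~ ∑ N_l^{(γ-β)/3}: the error is O(ε) and the cost is O(g³ ε^{-2}). Rounding M_l up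
adds O(N_L^γ), which α ≥ min(β,γ)/2 absorbs.

In the linear Gaussian case characteristic functions show that the mean-field law stays Gaussian
with the Kalman moments, and completing the square in the densities gives the same for the filtering
law. -/

/-- The family `f` is `O(δ)` in `L^p` for every finite `p ≥ 2`, uniformly in the index. -/
structure LpO {T Ω V : Type*} [MeasurableSpace Ω] [NormedAddCommGroup V] (μ : Measure Ω)
    (f : T → Ω → V) (δ : T → ℝ≥0) : Prop where
  aesm : ∀ t, AEStronglyMeasurable (f t) μ
  bound : ∀ p : ℝ≥0, 2 ≤ p → ∃ C : ℝ≥0, ∀ t, eLpNorm (f t) p μ ≤ C * δ t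

namespace LpO

variable {T T' Ω Ω' V V' : Type*} [MeasurableSpace Ω] [MeasurableSpace Ω'] [NormedAddCommGroup V]
  [NormedAddCommGroup V'] {μ : Measure Ω} {ν : Measure Ω'} {f g : T → Ω → V} {δ δ' : T → ℝ≥0}

theorem one_le_of_two_le {p : ℝ≥0} (hp : 2 ≤ p) : (1 : ℝ≥0∞) ≤ p := by
  exact_mod_cast le_trans (by norm_num) hp

theorem mono_rate (h : LpO μ f δ) {C : ℝ≥0} (hC : ∀ t, δ t ≤ C * δ' t) : LpO μ f δ' := by
  refine ⟨h.aesm, fun p hp => ?_⟩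
  obtain ⟨K, hK⟩ := h.bound p hp
  refine ⟨K * C, fun t => (hK t).trans ?_⟩
  rw [← ENNReal.coe_mul, ← ENNReal.coe_mul, ENNReal.coe_le_coe, mul_assoc]
  exact mul_le_mul_right (hC t) K

theorem reindex (h : LpO μ f δ) (e : T' → T) :
    LpO μ (fun t => f (e t)) (fun t => δ (e t)) :=
  ⟨fun _ => h.aesm _, fun p hp => (h.bound p hp).imp fun _ hC _ => hC _⟩

theorem congr {f' : T → Ω → V} (h : LpO μ f δ) (hf : ∀ t x, f' t x = f t x) : LpO μ f' δ := by
  have : f' = f := by ext t x; exact hf t x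
  rwa [this]

theorem add (hf : LpO μ f δ) (hg : LpO μ g δ') :
    LpO μ (fun t x => f t x + g t x) (fun t => δ t + δ' t) := by
  refine ⟨fun t => (hf.aesm t).add (hg.aesm t), fun p hp => ?_⟩
  obtain ⟨K, hK⟩ := hf.bound p hp
  obtain ⟨K', hK'⟩ := hg.bound p hp
  refine ⟨K + K', fun t => (eLpNorm_add_le (hf.aesm t) (hg.aesm t) (one_le_of_two_le hp)).trans ?_⟩
  refine (add_le_add (hK t) (hK' t)).trans ?_
  norm_cast
  calc K * δ t + K' * δ' t ≤ (K * δ t + K' * δ' t) + (K * δ' t + K' * δ t) := le_self_add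
    _ = _ := by ring

theorem add_same (hf : LpO μ f δ) (hg : LpO μ g δ) : LpO μ (fun t x => f t x + g t x) δ :=
  (hf.add hg).mono_rate (C := 2) fun t => by rw [two_mul]

theorem neg (hf : LpO μ f δ) : LpO μ (fun t x => - f t x) δ :=
  ⟨fun t => (hf.aesm t).neg, fun p hp => (hf.bound p hp).imp fun C hC t => by
    simpa only [← Pi.neg_def, eLpNorm_neg] using hC t⟩

theorem sub_same (hf : LpO μ f δ) (hg : LpO μ g δ) : LpO μ (fun t x => f t x - g t x) δ := by
  simpa only [sub_eq_add_neg] using hf.add_same hg.neg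

theorem of_const [IsProbabilityMeasure μ] {a : T → V} {C : ℝ} (h : ∀ t, ‖a t‖ ≤ C * δ t) :
    LpO μ (fun t _ => a t) δ := by
  refine ⟨fun t => aestronglyMeasurable_const, fun p hp => ⟨C.toNNReal, fun t => ?_⟩⟩
  have hp0 : (p : ℝ≥0∞) ≠ 0 := (zero_lt_one.trans_le (one_le_of_two_le hp)).ne'
  rw [eLpNorm_const _ hp0 (IsProbabilityMeasure.ne_zero μ)]
  simp only [measure_univ, ENNReal.one_rpow, mul_one]
  rw [← ENNReal.coe_mul, ← ofReal_norm, ENNReal.ofReal, ENNReal.coe_le_coe,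
    Real.toNNReal_le_iff_le_coe]
  push_cast
  exact (h t).trans (mul_le_mul_of_nonneg_right (Real.le_coe_toNNReal C) (δ t).2)

theorem const [IsProbabilityMeasure μ] (a : V) :
    LpO μ (fun (_ : T) _ => a) (fun _ => 1) :=
  of_const (C := ‖a‖) fun t => by simp

theorem of_norm_le {f' : T → Ω → V'} (hf : LpO μ f δ) (hf' : ∀ t, AEStronglyMeasurable (f' t) μ)
    (C : ℝ≥0) (h : ∀ t x, ‖f' t x‖ ≤ C * ‖f t x‖) : LpO μ f' δ := by
  refine ⟨hf', fun p hp => ?_⟩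
  obtain ⟨K, hK⟩ := hf.bound p hp
  refine ⟨C * K, fun t => ?_⟩
  have h1 : eLpNorm (f' t) p μ ≤ C * eLpNorm (f t) p μ :=
    eLpNorm_le_mul_eLpNorm_of_ae_le_mul' (Filter.Eventually.of_forall fun x => by
      rw [← ofReal_norm, ← ofReal_norm, ← ENNReal.ofReal_coe_nnreal,
        ← ENNReal.ofReal_mul (NNReal.coe_nonneg C)]
      exact ENNReal.ofReal_le_ofReal (h t x)) _
  refine h1.trans ?_
  rw [ENNReal.coe_mul, mul_assoc]
  gcongr
  exact hK t

theorem norm (hf : LpO μ f δ) : LpO μ (fun t x => ‖f t x‖) δ :=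
  hf.of_norm_le (fun t => (hf.aesm t).norm) 1 fun t x => by simp

/-- Hölder's inequality with 1/p = 1/(2p) + 1/(2p); the loss in the exponent is harmless because the
hypotheses hold for all exponents. -/
theorem mul {f g : T → Ω → ℝ} (hf : LpO μ f δ) (hg : LpO μ g δ') :
    LpO μ (fun t x => f t x * g t x) (fun t => δ t * δ' t) := by
  refine ⟨fun t => (hf.aesm t).mul (hg.aesm t), fun p hp => ?_⟩
  have h2p : 2 ≤ 2 * p := hp.trans (by rw [two_mul]; exact le_self_add)
  obtain ⟨K, hK⟩ := hf.bound (2 * p) h2p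
  obtain ⟨K', hK'⟩ := hg.bound (2 * p) h2p
  refine ⟨K * K', fun t => ?_⟩
  have hp0 : (p : ℝ≥0∞) ≠ 0 := (zero_lt_one.trans_le (one_le_of_two_le hp)).ne'
  have : ENNReal.HolderTriple ((2 * p : ℝ≥0) : ℝ≥0∞) ((2 * p : ℝ≥0) : ℝ≥0∞) (p : ℝ≥0∞) := by
    constructor
    rw [ENNReal.coe_mul, ENNReal.mul_inv (Or.inl (by simp)) (Or.inl (by simp)), ← add_mul]
    simp [ENNReal.inv_two_add_inv_two]
  have h := eLpNorm_smul_le_mul_eLpNorm (p := ((2 * p : ℝ≥0) : ℝ≥0∞))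
    (q := ((2 * p : ℝ≥0) : ℝ≥0∞)) (r := (p : ℝ≥0∞)) (hg.aesm t) (hf.aesm t)
  refine (le_of_eq ?_).trans (h.trans ((mul_le_mul' (hK t) (hK' t)).trans (le_of_eq ?_)))
  · rfl
  · push_cast; ring

theorem of_memLp {f : Ω → V} (h : ∀ p : ℝ≥0, MemLp f p μ) :
    LpO μ (fun (_ : T) => f) fun _ => 1 :=
  ⟨fun _ => (h 1).1, fun p _ => ⟨(eLpNorm f p μ).toNNReal, fun _ => by
    rw [ENNReal.coe_one, mul_one, ENNReal.coe_toNNReal (h p).2.ne]⟩⟩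

theorem zero : LpO μ (fun (_ : T) _ => (0 : V)) δ :=
  ⟨fun _ => aestronglyMeasurable_const, fun p _ => ⟨0, fun t => by simp⟩⟩

theorem finsetSum {ι : Type*} (s : Finset ι) {f : ι → T → Ω → V} (h : ∀ i ∈ s, LpO μ (f i) δ) :
    LpO μ (fun t x => ∑ i ∈ s, f i t x) δ := by
  classical
  induction s using Finset.induction_on with
  | empty => simpa using zero
  | insert i s hi ih =>
    simp only [Finset.sum_insert hi]
    exact (h i (Finset.mem_insert_self i s)).add_same
      (ih fun j hj => h j (Finset.mem_insert_of_mem hj))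

/-- An average is not larger than its terms. -/
theorem average {f : T → ℕ → Ω → ℝ}
    (h : LpO μ (fun a : T × ℕ => f a.1 a.2) (fun a => δ a.1)) (M : T → ℕ) :
    LpO μ (fun t x => (M t : ℝ)⁻¹ * ∑ i ∈ Finset.range (M t), f t i x) δ := by
  have hs : ∀ t, AEStronglyMeasurable (fun x => ∑ i ∈ Finset.range (M t), f t i x) μ := fun t =>
    Finset.aestronglyMeasurable_fun_sum _ fun i _ => h.aesm (t, i)
  refine ⟨fun t => (hs t).const_mul _, fun p hp => ?_⟩
  obtain ⟨K, hK⟩ := h.bound p hp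
  refine ⟨K, fun t => ?_⟩
  -- For `M t = 0` the average is 0, by the convention for the inverse of zero.
  rcases Nat.eq_zero_or_pos (M t) with h0 | h0
  · simp [h0]
  have h1 : eLpNorm (fun x => ∑ i ∈ Finset.range (M t), f t i x) p μ ≤ M t * (K * δ t) := by
    have := eLpNorm_sum_le (f := fun i => f t i) (s := Finset.range (M t)) (p := p) (μ := μ)
      (fun i _ => h.aesm (t, i)) (one_le_of_two_le hp)
    refine (le_of_eq ?_).trans (this.trans ((Finset.sum_le_sum fun i _ => hK (t, i)).trans ?_))
    · congr 1; ext x; simp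
    · simp
  have h2 : eLpNorm (fun x => (M t : ℝ)⁻¹ * ∑ i ∈ Finset.range (M t), f t i x) p μ
      = (M t : ℝ≥0∞)⁻¹ * eLpNorm (fun x => ∑ i ∈ Finset.range (M t), f t i x) p μ := by
    have := eLpNorm_const_smul (c := (M t : ℝ)⁻¹)
      (f := fun x => ∑ i ∈ Finset.range (M t), f t i x) (p := (p : ℝ≥0∞)) (μ := μ)
    rw [enorm_inv (by exact_mod_cast h0.ne'), Real.enorm_natCast] at this
    exact this
  rw [h2]
  calc _ ≤ (M t : ℝ≥0∞)⁻¹ * (M t * (K * δ t)) := by gcongr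
    _ = _ := by
      rw [← mul_assoc, ENNReal.inv_mul_cancel (by exact_mod_cast h0.ne') (by simp), one_mul]

/-- Summation over the levels `l ≤ L t`. -/
theorem levelSum {f : T → ℕ → Ω → V} {L : T → ℕ} {δ : T → ℕ → ℝ≥0}
    (h : LpO μ (fun a : {a : T × ℕ // a.2 ≤ L a.1} => f a.1.1 a.1.2) (fun a => δ a.1.1 a.1.2)) :
    LpO μ (fun t x => ∑ l ∈ Finset.range (L t + 1), f t l x)
      (fun t => ∑ l ∈ Finset.range (L t + 1), δ t l) := by
  have hm : ∀ t, ∀ l ∈ Finset.range (L t + 1), AEStronglyMeasurable (f t l) μ := fun t l hl =>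
    h.aesm ⟨(t, l), Nat.lt_succ_iff.1 (Finset.mem_range.1 hl)⟩
  refine ⟨fun t => Finset.aestronglyMeasurable_fun_sum _ (hm t), fun p hp => ?_⟩
  obtain ⟨K, hK⟩ := h.bound p hp
  refine ⟨K, fun t => ?_⟩
  have := eLpNorm_sum_le (hm t) (one_le_of_two_le hp)
  refine (le_of_eq ?_).trans (this.trans ((Finset.sum_le_sum (g := fun l => (K : ℝ≥0∞) * δ t l)
    fun l hl => hK ⟨(t, l), Nat.lt_succ_iff.1 (Finset.mem_range.1 hl)⟩).trans ?_))
  · congr 1; ext x; simp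
  · rw [← Finset.mul_sum]; norm_cast

theorem comp (h : LpO μ f δ) {e : T → Ω' → Ω} (he : ∀ t, MeasurePreserving (e t) ν μ) :
    LpO ν (fun t x => f t (e t x)) δ := by
  refine ⟨fun t => (h.aesm t).comp_measurePreserving (he t), fun p hp =>
    (h.bound p hp).imp fun C hC t => ?_⟩
  have := hC t
  rwa [← eLpNorm_comp_measurePreserving (h.aesm t) (he t)] at this

theorem memLp (h : LpO μ f δ) {p : ℝ≥0} (hp : 2 ≤ p) (t : T) : MemLp (f t) p μ := by
  obtain ⟨C, hC⟩ := h.bound p hp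
  exact ⟨h.aesm t, (hC t).trans_lt (by finiteness)⟩

theorem memLp' [IsProbabilityMeasure μ] (h : LpO μ f δ) (p : ℝ≥0) (t : T) :
    MemLp (f t) p μ :=
  (h.memLp (le_max_right p 2) t).mono_exponent (by exact_mod_cast le_max_left p 2)

theorem integrable [IsProbabilityMeasure μ] (h : LpO μ f δ) (t : T) : Integrable (f t) μ := by
  have := h.memLp' 1 t
  rw [ENNReal.coe_one] at this
  exact memLp_one_iff_integrable.1 this

/-- Expectations are of the same order. -/
theorem integral_le [IsProbabilityMeasure μ] {f : T → Ω → ℝ} (h : LpO μ f δ) :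
    ∃ C : ℝ≥0, ∀ t, |∫ x, f t x ∂μ| ≤ C * δ t := by
  obtain ⟨C, hC⟩ := h.bound 2 le_rfl
  refine ⟨C, fun t => ?_⟩
  have h1 : ‖∫ x, f t x ∂μ‖ₑ ≤ eLpNorm (f t) 1 μ := by
    rw [eLpNorm_one_eq_lintegral_enorm]
    exact enorm_integral_le_lintegral_enorm _
  have h2 := eLpNorm_le_eLpNorm_of_exponent_le (μ := μ) (p := 1) (q := (2 : ℝ≥0))
    (by norm_num) (h.aesm t)
  have h3 := h1.trans (h2.trans (hC t))
  rw [← ofReal_norm, ← ENNReal.coe_mul, ENNReal.ofReal, ENNReal.coe_le_coe,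
    Real.toNNReal_le_iff_le_coe] at h3
  simpa using h3

theorem integral [IsProbabilityMeasure μ] [IsProbabilityMeasure ν] {f : T → Ω → ℝ}
    (h : LpO μ f δ) : LpO ν (fun t _ => ∫ x, f t x ∂μ) δ := by
  obtain ⟨C, hC⟩ := h.integral_le
  exact of_const (C := C) hC

/-- Powers of a bounded family are bounded. -/
theorem norm_pow [IsProbabilityMeasure μ] (h : LpO μ f (fun _ => 1)) (k : ℕ) :
    LpO μ (fun t x => ‖f t x‖ ^ k) (fun _ => 1) := by
  induction k with
  | zero => simpa using const (μ := μ) (T := T) (1 : ℝ)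
  | succ k ih => simpa [pow_succ] using ih.mul h.norm

/-- Real powers are dominated by natural ones: a^r ≤ 1 + a^⌈r⌉ for a ≥ 0. -/
theorem norm_rpow [IsProbabilityMeasure μ] (h : LpO μ f (fun _ => 1)) {r : ℝ} (hr : 0 ≤ r) :
    LpO μ (fun t x => ‖f t x‖ ^ r) (fun _ => 1) := by
  refine ((const (μ := μ) (T := T) (1 : ℝ)).add_same (h.norm_pow ⌈r⌉₊)).of_norm_le
    (fun t => ((h.aesm t).norm.aemeasurable.pow_const r).aestronglyMeasurable) 1 fun t x => ?_
  rw [Real.norm_of_nonneg (by positivity), Real.norm_of_nonneg (by positivity), NNReal.coe_one,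
    one_mul]
  rcases le_total ‖f t x‖ 1 with h1 | h1
  · exact (Real.rpow_le_one (norm_nonneg _) h1 hr).trans (by simp)
  · refine le_trans ?_ (le_add_of_nonneg_left zero_le_one)
    rw [← Real.rpow_natCast]
    exact Real.rpow_le_rpow_of_exponent_le h1 (Nat.le_ceil r)

theorem coord {k : ℕ} {f : T → Ω → E k} (h : LpO μ f δ) (j : Fin k) :
    LpO μ (fun t x => f t x j) δ :=
  h.of_norm_le (fun t => (EuclideanSpace.proj j).continuous.comp_aestronglyMeasurable (h.aesm t)) 1
    fun t x => by simpa using PiLp.norm_apply_le (f t x) j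

theorem norm_le_sum_abs {k : ℕ} (x : E k) : ‖x‖ ≤ ∑ j, |x j| := by
  have h : x = ∑ j, x j • EuclideanSpace.basisFun (Fin k) ℝ j :=
    ((EuclideanSpace.basisFun (Fin k) ℝ).sum_repr x).symm
  conv_lhs => rw [h]
  refine (norm_sum_le _ _).trans (Finset.sum_le_sum fun j _ => ?_)
  rw [norm_smul, OrthonormalBasis.norm_eq_one, mul_one, Real.norm_eq_abs]

theorem of_coord {k : ℕ} {f : T → Ω → E k} (hf : ∀ t, AEStronglyMeasurable (f t) μ)
    (h : ∀ j, LpO μ (fun t x => f t x j) δ) : LpO μ f δ := by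
  refine (finsetSum Finset.univ fun j _ => (h j).norm).of_norm_le hf 1 fun t x => ?_
  rw [Real.norm_of_nonneg (Finset.sum_nonneg fun j _ => norm_nonneg _), NNReal.coe_one, one_mul]
  exact norm_le_sum_abs _

/-- A family with values in a product of particles, split according to the level `0` or `k + 1`. -/
theorem of_level {f : T → ℕ → Ω → V} {δ : T → ℕ → ℝ≥0}
    (h0 : LpO μ (fun t => f t 0) (fun t => δ t 0))
    (h1 : LpO μ (fun a : T × ℕ => f a.1 (a.2 + 1)) (fun a => δ a.1 (a.2 + 1))) :
    LpO μ (fun a : T × ℕ => f a.1 a.2) (fun a => δ a.1 a.2) := by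
  refine ⟨?_, fun p hp => ?_⟩
  · rintro ⟨t, _ | l⟩
    exacts [h0.aesm t, h1.aesm (t, l)]
  · obtain ⟨C, hC⟩ := h0.bound p hp
    obtain ⟨C', hC'⟩ := h1.bound p hp
    refine ⟨C + C', ?_⟩
    rintro ⟨t, _ | l⟩
    · refine (hC t).trans ?_
      gcongr
      exact le_self_add
    · refine (hC' (t, l)).trans ?_
      simp only
      gcongr
      exact le_add_self

end LpO

/-- Increments of a locally Lipschitz function of polynomial growth. -/
theorem LocallyLipschitzPoly.continuous {d : ℕ} {φ : E d → ℝ} (hφ : LocallyLipschitzPoly φ) :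
    Continuous φ := by
  obtain ⟨ν, c, hν, hc, h⟩ := hφ
  refine continuous_iff_continuousAt.2 fun x => ?_
  have h2 : Filter.Tendsto (fun y => c * ‖y - x‖ * (1 + ‖y‖ ^ ν + ‖x‖ ^ ν)) (nhds x) (nhds 0) := by
    have hcont : Continuous fun y : E d => c * ‖y - x‖ * (1 + ‖y‖ ^ ν + ‖x‖ ^ ν) := by
      have := Continuous.rpow_const (f := fun y : E d => ‖y‖) continuous_norm
        (fun _ => Or.inr hν.le)
      fun_prop
    simpa using hcont.tendsto x
  exact tendsto_iff_dist_tendsto_zero.2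
    (squeeze_zero (fun _ => dist_nonneg) (fun y => by rw [Real.dist_eq]; exact h y x) h2)

/-- The factor 1 + |u|^ν + |v|^ν is bounded in every L^p, so by Hölder its product with |u - v|
keeps the rate of u - v. -/
theorem LocallyLipschitzPoly.lpO_sub {T Ω : Type*} [MeasurableSpace Ω] {μ : Measure Ω}
    [IsProbabilityMeasure μ] {d : ℕ} {φ : E d → ℝ} (hφ : LocallyLipschitzPoly φ)
    {u v : T → Ω → E d} {δ : T → ℝ≥0} (hu : LpO μ u fun _ => 1) (hv : LpO μ v fun _ => 1)
    (huv : LpO μ (fun t x => u t x - v t x) δ) :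
    LpO μ (fun t x => φ (u t x) - φ (v t x)) δ := by
  have hcont := hφ.continuous
  obtain ⟨ν, c, hν, hc, h⟩ := hφ
  have h1 := (((LpO.const (μ := μ) (T := T) (1 : ℝ)).add_same (hu.norm_rpow hν.le)).add_same
    (hv.norm_rpow hν.le))
  have h2 := (huv.norm.mul h1).mono_rate (δ' := δ) (C := 1) (fun t => by simp)
  refine h2.of_norm_le (fun t => (hcont.comp_aestronglyMeasurable (hu.aesm t)).sub
    (hcont.comp_aestronglyMeasurable (hv.aesm t))) c.toNNReal fun t x => ?_
  rw [Real.norm_eq_abs, Real.norm_of_nonneg (by positivity), Real.coe_toNNReal c hc.le,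
    ← mul_assoc]
  exact h (u t x) (v t x)

theorem LocallyLipschitzPoly.lpO {T Ω : Type*} [MeasurableSpace Ω] {μ : Measure Ω}
    [IsProbabilityMeasure μ] {d : ℕ} {φ : E d → ℝ} (hφ : LocallyLipschitzPoly φ)
    {u : T → Ω → E d} (hu : LpO μ u fun _ => 1) :
    LpO μ (fun t x => φ (u t x)) (fun _ => 1) := by
  have h0 := LpO.const (μ := μ) (T := T) (0 : E d)
  refine ((hφ.lpO_sub hu h0 (by simpa using hu)).add_same (LpO.const (φ 0))).congr ?_
  intro t x; ring

end MLEnKF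

namespace MLEnKF

/-! ### A Marcinkiewicz–Zygmund inequality -/

/-- Binomial expansion. The term linear in `y` is kept exactly, since it will have expectation zero;
every term of degree at least two in `y` lies below the sum of the two extreme ones, and the
binomial coefficients add up to at most 2^{2(k+1)} = 4^{k+1}. -/
theorem add_pow_even_le (k : ℕ) (s y : ℝ) :
    (s + y) ^ (2 * (k + 1)) ≤ s ^ (2 * (k + 1)) + (2 * (k + 1)) * (s ^ (2 * k + 1) * y)
      + 4 ^ (k + 1) * (s ^ (2 * k) * y ^ 2 + y ^ (2 * (k + 1))) := by
  set B := s ^ (2 * k) * y ^ 2 + y ^ (2 * (k + 1)) with hB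
  have hterm : ∀ m ∈ Finset.range (2 * k + 1),
      y ^ (m + 1 + 1) * s ^ (2 * (k + 1) - (m + 1 + 1)) ≤ B := by
    intro m hm
    have hm' : m ≤ 2 * k := Nat.lt_succ_iff.1 (Finset.mem_range.1 hm)
    obtain ⟨r, hr⟩ := Nat.exists_eq_add_of_le hm'
    have he : 2 * (k + 1) - (m + 1 + 1) = r := by omega
    rw [he]
    refine (le_abs_self _).trans ?_
    rw [abs_mul, abs_pow, abs_pow]
    have hB' : B = |s| ^ (2 * k) * |y| ^ 2 + |y| ^ (2 * (k + 1)) := by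
      rw [hB]
      congr 1
      · rw [sq_abs, pow_mul, pow_mul, sq_abs]
      · rw [pow_mul, pow_mul, sq_abs]
    rw [hB', hr]
    -- Exchange the surplus powers of the smaller of |s|, |y| for powers of the larger, ending at
    -- one of the two extreme monomials.
    rcases le_total |s| |y| with h | h
    · calc |y| ^ (m + 1 + 1) * |s| ^ r ≤ |y| ^ (m + 1 + 1) * |y| ^ r := by gcongr
        _ = |y| ^ (2 * (k + 1)) := by rw [← pow_add]; congr 1; omega
        _ ≤ _ := le_add_of_nonneg_left (by positivity)
    · calc |y| ^ (m + 1 + 1) * |s| ^ r = |y| ^ m * |y| ^ 2 * |s| ^ r := by ring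
        _ ≤ |s| ^ m * |y| ^ 2 * |s| ^ r := by gcongr
        _ = |s| ^ (m + r) * |y| ^ 2 := by ring
        _ ≤ _ := le_add_of_nonneg_right (by positivity)
  have hB0 : 0 ≤ B := by
    rw [hB, pow_mul, pow_mul]; positivity
  rw [add_comm s y, add_pow, show 2 * (k + 1) + 1 = 2 * k + 1 + 1 + 1 by ring,
    Finset.sum_range_succ', Finset.sum_range_succ']
  have h1 : ∑ m ∈ Finset.range (2 * k + 1), y ^ (m + 1 + 1) * s ^ (2 * (k + 1) - (m + 1 + 1)) *
      ((2 * (k + 1)).choose (m + 1 + 1) : ℝ) ≤ 4 ^ (k + 1) * B := by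
    calc _ ≤ ∑ m ∈ Finset.range (2 * k + 1), B * ((2 * (k + 1)).choose (m + 1 + 1) : ℝ) :=
          Finset.sum_le_sum fun m hm =>
            mul_le_mul_of_nonneg_right (hterm m hm) (Nat.cast_nonneg _)
      _ = (∑ m ∈ Finset.range (2 * k + 1), ((2 * (k + 1)).choose (m + 1 + 1) : ℝ)) * B := by
          rw [← Finset.mul_sum, mul_comm]
      _ ≤ _ := by
          refine mul_le_mul_of_nonneg_right ?_ hB0
          have h2 := Nat.sum_range_choose (2 * (k + 1))
          rw [show 2 * (k + 1) + 1 = 2 * k + 1 + 1 + 1 by ring, Finset.sum_range_succ',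
            Finset.sum_range_succ', pow_mul] at h2
          have h3 : (∑ m ∈ Finset.range (2 * k + 1), (2 * (k + 1)).choose (m + 1 + 1))
            ≤ 4 ^ (k + 1) := by norm_num at h2 ⊢; omega
          exact_mod_cast h3
  have h4 : 2 * (k + 1) - (0 + 1) = 2 * k + 1 := by omega
  rw [h4]
  have h5 : (((2 * (k + 1)).choose (0 + 1) : ℕ) : ℝ) = 2 * (k + 1) := by
    simp
  rw [h5]
  simp only [pow_zero, Nat.sub_zero, Nat.choose_zero_right, Nat.cast_one, zero_add, pow_one,
    one_mul, mul_one]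
  linarith [h1, mul_comm y (s ^ (2 * k + 1)), mul_comm (y * s ^ (2 * k + 1)) (2 * ((k : ℝ) + 1)),
    congrArg (fun z => 2 * ((k : ℝ) + 1) * z) (mul_comm y (s ^ (2 * k + 1)))]

/-- The constant in the Marcinkiewicz–Zygmund inequality for the exponent `2 k`. -/
def evenMomentConst : ℕ → ℝ
  | 0 => 1
  | k + 1 => 4 ^ (k + 1) * (evenMomentConst k + 1)

theorem evenMomentConst_pos (k : ℕ) : 0 < evenMomentConst k := by
  induction k with
  | zero => simp [evenMomentConst]
  | succ k ih => simp only [evenMomentConst]; positivity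

section

variable {Ω : Type*} [MeasurableSpace Ω] {μ : Measure Ω} [IsProbabilityMeasure μ]

theorem memLp_pow {f : Ω → ℝ} (hf : ∀ p : ℝ≥0, MemLp f p μ) (k : ℕ) (p : ℝ≥0) :
    MemLp (fun x => f x ^ k) p μ := by
  have := ((LpO.of_memLp (T := Unit) hf).norm_pow k).memLp' p ()
  refine this.congr_norm ((hf 1).1.pow k) (Filter.Eventually.of_forall fun x => by simp)

theorem integrable_pow_mul_pow {f g : Ω → ℝ} (hf : ∀ p : ℝ≥0, MemLp f p μ)
    (hg : ∀ p : ℝ≥0, MemLp g p μ) (k j : ℕ) : Integrable (fun x => f x ^ k * g x ^ j) μ :=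
  MemLp.integrable_mul (p := 2) (q := 2) (by simpa using memLp_pow hf k 2)
    (by simpa using memLp_pow hg j 2)

/-- Induction on the exponent and, inside it, on the number of summands. Adding one summand to the
partial sum s creates a linear term with mean zero, by independence and centring, and a remainder
controlled by E[s^{2k}] a², which the outer induction bounds by a multiple of n^k a^{2k+2}. Summed
over n this gives n^{k+1}. -/
theorem integral_sum_pow_le {Z : ℕ → Ω → ℝ} (hZ : ∀ i, Measurable (Z i)) (hindep : iIndepFun Z μ)
    (hmem : ∀ i, ∀ p : ℝ≥0, MemLp (Z i) p μ) (hcent : ∀ i, ∫ x, Z i x ∂μ = 0) {a : ℝ} (ha : 0 ≤ a)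
    (K : ℕ) (hmom : ∀ i, ∀ j ≤ K, ∫ x, Z i x ^ (2 * j) ∂μ ≤ a ^ (2 * j)) (k : ℕ) (hk : k ≤ K)
    (n : ℕ) :
    ∫ x, (∑ i ∈ Finset.range n, Z i x) ^ (2 * k) ∂μ ≤ evenMomentConst k * n ^ k * a ^ (2 * k) := by
  induction k generalizing n with
  | zero => simp [evenMomentConst]
  | succ k ihk =>
    have hC := evenMomentConst_pos k
    have hC' := evenMomentConst_pos (k + 1)
    induction n with
    | zero => simp
    | succ n ihn =>
      set s : Ω → ℝ := fun x => ∑ i ∈ Finset.range n, Z i x with hs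
      have hsm : ∀ p : ℝ≥0, MemLp s p μ := fun p => memLp_finsetSum _ fun i _ => hmem i p
      have hind : IndepFun s (Z n) μ := by
        have := hindep.indepFun_finsetSum_of_notMem hZ
          (s := Finset.range n) (i := n) (by simp)
        convert this using 1
        ext x; simp [hs]
      have hprod : ∀ i j : ℕ, ∫ x, s x ^ i * Z n x ^ j ∂μ
          = (∫ x, s x ^ i ∂μ) * ∫ x, Z n x ^ j ∂μ := fun i j =>
        (hind.comp (measurable_id.pow_const i)
          (measurable_id.pow_const j)).integral_fun_mul_eq_mul_integral
          (memLp_pow hsm i 1).1 (memLp_pow (hmem n) j 1).1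
      have hint := fun i j => integrable_pow_mul_pow hsm (hmem n) i j
      have i1 : Integrable (fun x => s x ^ (2 * (k + 1))) μ := by simpa using hint (2 * (k + 1)) 0
      have i2 : Integrable (fun x => s x ^ (2 * k + 1) * Z n x) μ := by
        simpa using hint (2 * k + 1) 1
      have i3 : Integrable (fun x => Z n x ^ (2 * (k + 1))) μ := by
        simpa using hint 0 (2 * (k + 1))
      have i4 := hint (2 * k) 2
      have i5 : Integrable (fun x => (s x + Z n x) ^ (2 * (k + 1))) μ := by
        have := memLp_pow (fun p => (hsm p).add (hmem n p)) (2 * (k + 1)) 1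
        simpa using memLp_one_iff_integrable.1 (by simpa using this)
      have e2 : ∫ x, s x ^ (2 * k + 1) * Z n x ∂μ = 0 := by
        have := hprod (2 * k + 1) 1
        simp only [pow_one, hcent n, mul_zero] at this
        exact this
      have hmono := integral_mono i5 (((i1.add (i2.const_mul (2 * (k + 1)))).add
        ((i4.add i3).const_mul (4 ^ (k + 1)))))
        (fun x => add_pow_even_le k (s x) (Z n x))
      rw [integral_add' (i1.add (i2.const_mul _)) ((i4.add i3).const_mul _),
        integral_add' i1 (i2.const_mul _), integral_const_mul, integral_const_mul,
        integral_add' i4 i3, e2, mul_zero, add_zero, hprod] at hmono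
      have b1 := ihk (by omega) n
      have b2 : ∫ x, Z n x ^ 2 ∂μ ≤ a ^ 2 := by simpa using hmom n 1 (by omega)
      have b3 := hmom n (k + 1) hk
      have b20 : 0 ≤ ∫ x, Z n x ^ 2 ∂μ := integral_nonneg fun x => sq_nonneg _
      have hn : (1 : ℝ) ≤ (n + 1 : ℕ) ^ k := one_le_pow₀ (by simp)
      have hnn : (n : ℝ) ^ k ≤ (n + 1 : ℕ) ^ k := by gcongr; simp
      simp only [Finset.sum_range_succ]
      -- The recursion of `evenMomentConst` is made for this step: the remainder is at most one
      -- further copy of `evenMomentConst (k + 1) * (n + 1) ^ k`, which turns the factor n into n +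
      -- 1.
      calc _ ≤ _ := hmono
        _ ≤ evenMomentConst (k + 1) * n ^ (k + 1) * a ^ (2 * (k + 1))
            + 4 ^ (k + 1) * (evenMomentConst k * n ^ k * a ^ (2 * k) * a ^ 2
              + a ^ (2 * (k + 1))) := by
            gcongr
        _ = a ^ (2 * (k + 1)) * (evenMomentConst (k + 1) * (n * n ^ k)
            + 4 ^ (k + 1) * (evenMomentConst k * n ^ k + 1)) := by ring
        _ ≤ a ^ (2 * (k + 1)) * (evenMomentConst (k + 1) * (n * (n + 1 : ℕ) ^ k)
            + 4 ^ (k + 1) * (evenMomentConst k * (n + 1 : ℕ) ^ k + (n + 1 : ℕ) ^ k)) := by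
            gcongr
        _ = _ := by simp only [evenMomentConst]; push_cast; ring

theorem eLpNorm_even_pow {f : Ω → ℝ} (hf : ∀ p : ℝ≥0, MemLp f p μ) (k : ℕ) (hk : 0 < k) :
    eLpNorm f (2 * k : ℕ) μ ^ (2 * k) = ENNReal.ofReal (∫ x, f x ^ (2 * k) ∂μ) := by
  have h2k : ((2 * k : ℕ) : ℝ≥0) ≠ 0 := by exact_mod_cast (by omega : 2 * k ≠ 0)
  have h := eLpNorm_nnreal_pow_eq_lintegral (f := f) (μ := μ) h2k
  have hi : Integrable (fun x => f x ^ (2 * k)) μ := by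
    simpa using integrable_pow_mul_pow hf hf (2 * k) 0
  rw [ofReal_integral_eq_lintegral_ofReal hi (Filter.Eventually.of_forall fun x => by
    simp only [Pi.zero_apply, pow_mul]; positivity)]
  simp only [NNReal.coe_natCast, ENNReal.rpow_natCast, ENNReal.coe_natCast] at h
  rw [h]
  congr 1 with x
  rw [← ofReal_norm, ← ENNReal.ofReal_pow (norm_nonneg _), Real.norm_eq_abs, pow_mul, sq_abs,
    ← pow_mul]

end

/-- The sample mean of independent copies converges with the rate `M^{-1/2}`. -/
theorem LpO.iidAverage {T D ι : Type*} [MeasurableSpace D] {ρ : Measure D} [IsProbabilityMeasure ρ]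
    {Y : T → D → ℝ} {δ : T → ℝ≥0} (h : LpO ρ Y δ) (hY : ∀ t, Measurable (Y t)) (M : T → ℕ)
    (hM : ∀ t, 0 < M t) (e : T → ℕ → ι) (he : ∀ t, Function.Injective (e t)) :
    LpO (Measure.infinitePi fun _ : ι => ρ)
      (fun t w => (M t : ℝ)⁻¹ * ∑ i ∈ Finset.range (M t), Y t (w (e t i)) - ∫ x, Y t x ∂ρ)
      (fun t => δ t * (M t : ℝ≥0) ^ (-(1 / 2) : ℝ)) := by
  have hmY : ∀ t i, Measurable fun w : ι → D => Y t (w (e t i)) := fun t i =>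
    (hY t).comp (measurable_pi_apply _)
  refine ⟨fun t => (((Finset.measurable_sum _ fun i _ => hmY t i).const_mul _).sub_const
    _).aestronglyMeasurable, fun p hp => ?_⟩
  -- On a probability space the L^p norm is at most the L^{2k} norm for 2k ≥ p, and for an even
  -- exponent the moment is that of a polynomial.
  set k : ℕ := ⌈p⌉₊ with hkdef
  have hk0 : 0 < k := Nat.ceil_pos.2 (zero_lt_two.trans_le hp)
  have hpk : p ≤ (2 * k : ℕ) := (Nat.le_ceil p).trans (by exact_mod_cast (by omega : k ≤ 2 * k))
  have h2k : 2 ≤ ((2 * k : ℕ) : ℝ≥0) := by exact_mod_cast (by omega : 2 ≤ 2 * k)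
  have hcent : LpO ρ (fun t x => Y t x - ∫ x, Y t x ∂ρ) δ := h.sub_same h.integral
  obtain ⟨K, hK⟩ := hcent.bound _ h2k
  refine ⟨(Real.toNNReal (evenMomentConst k) ^ ((2 * k : ℕ) : ℝ)⁻¹) * K, fun t => ?_⟩
  set Z : ℕ → (ι → D) → ℝ := fun i w => Y t (w (e t i)) - ∫ x, Y t x ∂ρ with hZdef
  set Pm := Measure.infinitePi fun _ : ι => ρ with hPm
  have hmp : ∀ i, MeasurePreserving (fun w : ι → D => w (e t i)) Pm ρ := fun i =>
    measurePreserving_eval_infinitePi (fun _ => ρ) (e t i)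
  have hZm : ∀ i, Measurable (Z i) := fun i => (hmY t i).sub_const _
  have hY' : Measurable (fun x => Y t x - ∫ x, Y t x ∂ρ) := (hY t).sub_const _
  have hZmem : ∀ i, ∀ p : ℝ≥0, MemLp (Z i) p Pm := fun i p =>
    (hcent.memLp' p t).comp_measurePreserving (hmp i)
  have hind : iIndepFun Z Pm :=
    (iIndepFun_infinitePi (P := fun _ : ι => ρ) (X := fun (_ : ι) x => Y t x - ∫ x, Y t x ∂ρ)
      (fun _ => hY')).precomp (he t)
  have hZ0 : ∀ i, ∫ w, Z i w ∂Pm = 0 := fun i => by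
    have := integral_map (μ := Pm) (hmp i).measurable.aemeasurable
      (f := fun x => Y t x - ∫ x, Y t x ∂ρ) hY'.aestronglyMeasurable
    rw [(hmp i).map_eq] at this
    rw [← this, integral_sub (h.integrable t) (integrable_const _)]
    simp
  set a : ℝ≥0 := K * δ t with ha
  -- One bound `a`, taken in L^{2k}, serves all lower even moments, again by monotonicity of the
  -- norms.
  have hmom : ∀ i, ∀ j ≤ k, ∫ x, Z i x ^ (2 * j) ∂Pm ≤ (a : ℝ) ^ (2 * j) := by
    intro i j hj
    rcases Nat.eq_zero_or_pos j with rfl | hj0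
    · simp
    have h1 := eLpNorm_even_pow (hZmem i) j hj0
    have h2 : eLpNorm (Z i) (2 * j : ℕ) Pm ≤ a := by
      refine (eLpNorm_le_eLpNorm_of_exponent_le (q := ((2 * k : ℕ) : ℝ≥0))
        (by exact_mod_cast (by omega : 2 * j ≤ 2 * k)) (hZmem i 1).1).trans ?_
      have := hK t
      rw [← eLpNorm_comp_measurePreserving (hcent.aesm t) (hmp i)] at this
      rw [ha, ENNReal.coe_mul]
      exact this
    have h3 : ENNReal.ofReal (∫ x, Z i x ^ (2 * j) ∂Pm) ≤ ENNReal.ofReal ((a : ℝ) ^ (2 * j)) := by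
      rw [← h1, ENNReal.ofReal_pow (NNReal.coe_nonneg a), ENNReal.ofReal_coe_nnreal]
      gcongr
    exact (ENNReal.ofReal_le_ofReal_iff (by positivity)).1 h3
  have hmain := integral_sum_pow_le hZm hind hZmem hZ0 a.2 k hmom k le_rfl (M t)
  set s : (ι → D) → ℝ := fun w => ∑ i ∈ Finset.range (M t), Z i w with hs
  have hsm : ∀ p : ℝ≥0, MemLp s p Pm := fun p => memLp_finsetSum _ fun i _ => hZmem i p
  have hM0 : (M t : ℝ) ≠ 0 := by exact_mod_cast (hM t).ne'
  have hfun : (fun w : ι → D => (M t : ℝ)⁻¹ * ∑ i ∈ Finset.range (M t), Y t (w (e t i))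
      - ∫ x, Y t x ∂ρ) = fun w => (M t : ℝ)⁻¹ • s w := by
    ext w
    simp only [hs, hZdef, Finset.sum_sub_distrib, smul_eq_mul, Finset.sum_const,
      Finset.card_range, nsmul_eq_mul]
    field_simp
  have hE := eLpNorm_even_pow hsm k hk0
  have hS : eLpNorm s (2 * k : ℕ) Pm ≤ ((Real.toNNReal (evenMomentConst k) ^ ((2 * k : ℕ) : ℝ)⁻¹
      * (M t : ℝ≥0) ^ (1 / 2 : ℝ) * a : ℝ≥0) : ℝ≥0∞) := by
    have hE' : eLpNorm s (2 * k : ℕ) Pm ^ (2 * k) ≤ ((Real.toNNReal (evenMomentConst k) ^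
        ((2 * k : ℕ) : ℝ)⁻¹ * (M t : ℝ≥0) ^ (1 / 2 : ℝ) * a : ℝ≥0) : ℝ≥0∞) ^ (2 * k) := by
      rw [hE, ← ENNReal.coe_pow, mul_pow, mul_pow, NNReal.rpow_inv_natCast_pow _ (by omega),
        ← NNReal.rpow_natCast ((M t : ℝ≥0) ^ (1 / 2 : ℝ)), ← NNReal.rpow_mul,
        show (1 / 2 : ℝ) * (2 * k : ℕ) = (k : ℕ) by push_cast; ring, NNReal.rpow_natCast,
        ENNReal.ofReal, ENNReal.coe_le_coe, Real.toNNReal_le_iff_le_coe]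
      push_cast
      rw [Real.coe_toNNReal _ (evenMomentConst_pos k).le]
      exact hmain
    exact (ENNReal.pow_le_pow_left_iff (by omega)).1 hE'
  rw [hfun]
  have h1 : eLpNorm (fun w => (M t : ℝ)⁻¹ • s w) p Pm = (((M t : ℝ≥0)⁻¹ : ℝ≥0) : ℝ≥0∞)
      * eLpNorm s p Pm := by
    have := eLpNorm_const_smul (c := (M t : ℝ)⁻¹) (f := s) (p := (p : ℝ≥0∞)) (μ := Pm)
    rw [enorm_inv hM0, Real.enorm_natCast] at this
    rw [ENNReal.coe_inv (by exact_mod_cast (hM t).ne')]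
    exact_mod_cast this
  rw [h1]
  refine (mul_le_mul_right ((eLpNorm_le_eLpNorm_of_exponent_le (by exact_mod_cast hpk)
    (hsm 1).1).trans hS) _).trans ?_
  rw [← ENNReal.coe_mul, ← ENNReal.coe_mul, ENNReal.coe_le_coe]
  have h2 : (M t : ℝ≥0)⁻¹ * (M t : ℝ≥0) ^ (1 / 2 : ℝ) = (M t : ℝ≥0) ^ (-(1 / 2) : ℝ) := by
    rw [← NNReal.rpow_neg_one, ← NNReal.rpow_add (by exact_mod_cast (hM t).ne')]
    norm_num
  rw [← h2, ha]
  exact le_of_eq (by ring)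

end MLEnKF

namespace MLEnKF

/-! ### Entrywise estimates for matrices -/

section Matrices

variable {i j k d m : ℕ}

/-- The sum of the absolute values of the entries of a matrix. -/
def absSum (A : Matrix (Fin i) (Fin j) ℝ) : ℝ := ∑ a, ∑ b, |A a b|

theorem absSum_nonneg (A : Matrix (Fin i) (Fin j) ℝ) : 0 ≤ absSum A :=
  Finset.sum_nonneg fun _ _ => Finset.sum_nonneg fun _ _ => abs_nonneg _

theorem abs_le_absSum (A : Matrix (Fin i) (Fin j) ℝ) (a : Fin i) (b : Fin j) :
    |A a b| ≤ absSum A :=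
  (Finset.single_le_sum (f := fun b => |A a b|) (fun _ _ => abs_nonneg _) (Finset.mem_univ b)).trans
    (Finset.single_le_sum (f := fun a => ∑ b, |A a b|)
      (fun _ _ => Finset.sum_nonneg fun _ _ => abs_nonneg _) (Finset.mem_univ a))

theorem absSum_add_le (A B : Matrix (Fin i) (Fin j) ℝ) : absSum (A + B) ≤ absSum A + absSum B := by
  simp only [absSum, ← Finset.sum_add_distrib, Matrix.add_apply]
  exact Finset.sum_le_sum fun a _ => Finset.sum_le_sum fun b _ => abs_add_le _ _

theorem absSum_mul_le (A : Matrix (Fin i) (Fin j) ℝ) (B : Matrix (Fin j) (Fin k) ℝ) :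
    absSum (A * B) ≤ absSum A * absSum B := by
  have h1 : absSum (A * B) ≤ ∑ a, ∑ c, |A a c| * ∑ b, |B c b| := by
    refine Finset.sum_le_sum fun a _ => ?_
    calc ∑ b, |(A * B) a b| ≤ ∑ b, ∑ c, |A a c| * |B c b| :=
          Finset.sum_le_sum fun b _ => by
            rw [Matrix.mul_apply]
            refine (Finset.abs_sum_le_sum_abs _ _).trans (le_of_eq ?_)
            simp only [abs_mul]
      _ = _ := by rw [Finset.sum_comm]; simp only [Finset.mul_sum]
  refine h1.trans ?_
  rw [absSum, Finset.sum_mul]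
  refine Finset.sum_le_sum fun a _ => ?_
  rw [Finset.sum_mul]
  refine Finset.sum_le_sum fun c _ => mul_le_mul_of_nonneg_left ?_ (abs_nonneg _)
  exact Finset.single_le_sum (f := fun c => ∑ b, |B c b|)
      (fun _ _ => Finset.sum_nonneg fun _ _ => abs_nonneg _) (Finset.mem_univ c)

/-! ### Frobenius inner product, truncation of eigenvalues and bounds for inverses. -/

/-- The Frobenius inner product. -/
def entryInner (A B : Matrix (Fin i) (Fin j) ℝ) : ℝ := ∑ a, ∑ b, A a b * B a b

theorem entryInner_comm (A B : Matrix (Fin i) (Fin j) ℝ) : entryInner A B = entryInner B A := by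
  simp only [entryInner, mul_comm]

theorem entryInner_sub_left (A A' B : Matrix (Fin i) (Fin j) ℝ) :
    entryInner (A - A') B = entryInner A B - entryInner A' B := by
  simp only [entryInner, Matrix.sub_apply, sub_mul, Finset.sum_sub_distrib]

theorem entryInner_sub_right (A B B' : Matrix (Fin i) (Fin j) ℝ) :
    entryInner A (B - B') = entryInner A B - entryInner A B' := by
  simp only [entryInner, Matrix.sub_apply, mul_sub, Finset.sum_sub_distrib]

theorem entryInner_self_nonneg (A : Matrix (Fin i) (Fin j) ℝ) : 0 ≤ entryInner A A :=
  Finset.sum_nonneg fun _ _ => Finset.sum_nonneg fun _ _ => mul_self_nonneg _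

theorem sq_le_entryInner_self (A : Matrix (Fin i) (Fin j) ℝ) (a : Fin i) (b : Fin j) :
    A a b ^ 2 ≤ entryInner A A := by
  rw [sq]
  exact (Finset.single_le_sum (f := fun b => A a b * A a b) (fun _ _ => mul_self_nonneg _)
    (Finset.mem_univ b)).trans (Finset.single_le_sum (f := fun a => ∑ b, A a b * A a b)
      (fun _ _ => Finset.sum_nonneg fun _ _ => mul_self_nonneg _) (Finset.mem_univ a))

theorem entryInner_self_le (A : Matrix (Fin i) (Fin j) ℝ) :
    entryInner A A ≤ absSum A ^ 2 := by
  rw [sq, absSum, Finset.sum_mul]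
  refine Finset.sum_le_sum fun a _ => ?_
  rw [Finset.sum_mul]
  refine Finset.sum_le_sum fun b _ => ?_
  calc A a b * A a b = |A a b| * |A a b| := (abs_mul_abs_self _).symm
    _ ≤ _ := mul_le_mul_of_nonneg_left (abs_le_absSum A a b) (abs_nonneg _)

theorem entryInner_sum_smul_vecMulVec {ι : Type*} (s : Finset ι) (c : ι → ℝ) (q : ι → Fin i → ℝ)
    (B : Matrix (Fin i) (Fin i) ℝ) :
    entryInner (∑ k ∈ s, c k • Matrix.vecMulVec (q k) (q k)) B
      = ∑ k ∈ s, c k * (q k ⬝ᵥ B.mulVec (q k)) := by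
  simp only [entryInner, Matrix.sum_apply, Matrix.smul_apply, Matrix.vecMulVec_apply, smul_eq_mul,
    dotProduct, Matrix.mulVec, Finset.mul_sum, Finset.sum_mul]
  calc _ = ∑ a, ∑ k ∈ s, ∑ b, c k * (q k a * q k b) * B a b :=
        Finset.sum_congr rfl fun a _ => Finset.sum_comm
    _ = ∑ k ∈ s, ∑ a, ∑ b, c k * (q k a * q k b) * B a b := Finset.sum_comm
    _ = _ := Finset.sum_congr rfl fun k _ => Finset.sum_congr rfl fun a _ =>
        Finset.sum_congr rfl fun b _ => by ring

theorem isHermitian_spectral {C : Matrix (Fin d) (Fin d) ℝ} (hC : C.IsHermitian) :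
    C = ∑ k, hC.eigenvalues k •
      Matrix.vecMulVec (hC.eigenvectorBasis k).ofLp (hC.eigenvectorBasis k).ofLp := by
  conv_lhs => rw [hC.spectral_theorem]
  ext a b
  rw [Unitary.conjStarAlgAut_apply, Matrix.mul_apply]
  simp only [Matrix.mul_diagonal, Matrix.sum_apply, Matrix.smul_apply, Matrix.vecMulVec_apply,
    smul_eq_mul, Matrix.star_apply, Matrix.IsHermitian.eigenvectorUnitary_apply]
  refine Finset.sum_congr rfl fun k _ => ?_
  simp
  ring

/-- The negative part of a symmetric matrix. -/
noncomputable def negPart {C : Matrix (Fin d) (Fin d) ℝ} (hC : C.IsHermitian) :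
    Matrix (Fin d) (Fin d) ℝ :=
  ∑ k with ¬ 0 < hC.eigenvalues k, (-hC.eigenvalues k) •
    Matrix.vecMulVec (hC.eigenvectorBasis k).ofLp (hC.eigenvectorBasis k).ofLp

theorem truncate_sub_negPart {C : Matrix (Fin d) (Fin d) ℝ} (hC : C.IsHermitian) :
    truncate C - negPart hC = C := by
  conv_rhs => rw [isHermitian_spectral hC]
  rw [truncate, dif_pos hC, negPart, ← Finset.sum_filter_add_sum_filter_not Finset.univ
    (fun k => 0 < hC.eigenvalues k)]
  simp only [neg_smul, Finset.sum_neg_distrib, sub_neg_eq_add]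

theorem posSemidef_sum_smul_vecMulVec {ι : Type*} (s : Finset ι) (c : ι → ℝ) (q : ι → Fin i → ℝ)
    (hc : ∀ k ∈ s, 0 ≤ c k) : (∑ k ∈ s, c k • Matrix.vecMulVec (q k) (q k)).PosSemidef := by
  refine Matrix.posSemidef_sum s fun k hk => Matrix.PosSemidef.smul ?_ (hc k hk)
  simpa using Matrix.posSemidef_vecMulVec_self_star (q k)

theorem truncate_posSemidef (C : Matrix (Fin d) (Fin d) ℝ) : (truncate C).PosSemidef := by
  rw [truncate]
  split_ifs with hC
  · exact posSemidef_sum_smul_vecMulVec _ _ _ fun k hk => (Finset.mem_filter.1 hk).2.le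
  · exact Matrix.PosSemidef.zero

theorem negPart_posSemidef {C : Matrix (Fin d) (Fin d) ℝ} (hC : C.IsHermitian) :
    (negPart hC).PosSemidef :=
  posSemidef_sum_smul_vecMulVec _ _ _ fun _ hk => by
    have := (Finset.mem_filter.1 hk).2
    linarith

theorem truncate_of_posSemidef {C : Matrix (Fin d) (Fin d) ℝ} (hC : C.PosSemidef) :
    truncate C = C := by
  have h := truncate_sub_negPart hC.1
  have h0 : negPart hC.1 = 0 := by
    refine Finset.sum_eq_zero fun k hk => ?_
    have h1 := (Finset.mem_filter.1 hk).2
    have h2 := hC.eigenvalues_nonneg k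
    rw [show hC.1.eigenvalues k = 0 by linarith]
    simp
  rwa [h0, sub_zero] at h

/-- Expanding `P` in its eigenvectors q_k turns the inner product into ∑ λ_k q_kᵀ Q q_k, a sum of
nonnegative terms. -/
theorem entryInner_nonneg {P Q : Matrix (Fin d) (Fin d) ℝ} (hP : P.PosSemidef)
    (hQ : Q.PosSemidef) : 0 ≤ entryInner P Q := by
  rw [isHermitian_spectral hP.1, entryInner_sum_smul_vecMulVec]
  refine Finset.sum_nonneg fun k _ => mul_nonneg (hP.eigenvalues_nonneg k) ?_
  simpa using hQ.dotProduct_mulVec_nonneg (hP.1.eigenvectorBasis k).ofLp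

theorem entryInner_truncate_negPart {C : Matrix (Fin d) (Fin d) ℝ} (hC : C.IsHermitian) :
    entryInner (truncate C) (negPart hC) = 0 := by
  rw [truncate, dif_pos hC, entryInner_sum_smul_vecMulVec]
  refine Finset.sum_eq_zero fun k hk => ?_
  have hz : (negPart hC).mulVec (hC.eigenvectorBasis k).ofLp = 0 := by
    rw [negPart, Matrix.sum_mulVec]
    refine Finset.sum_eq_zero fun l hl => ?_
    have hkl : l ≠ k := by
      rintro rfl
      exact (Finset.mem_filter.1 hl).2 (Finset.mem_filter.1 hk).2
    have ho : (hC.eigenvectorBasis l).ofLp ⬝ᵥ (hC.eigenvectorBasis k).ofLp = 0 := by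
      have := hC.eigenvectorBasis.orthonormal.2 hkl.symm
      simpa [EuclideanSpace.inner_eq_star_dotProduct] using this
    rw [Matrix.smul_mulVec, Matrix.vecMulVec_mulVec, ho]
    simp
  rw [hz]
  simp

/-- Truncation does not increase the Frobenius distance. -/
theorem truncate_lipschitz {A B : Matrix (Fin d) (Fin d) ℝ} (hA : A.IsHermitian)
    (hB : B.IsHermitian) (a b : Fin d) : |truncate A a b - truncate B a b| ≤ absSum (A - B) := by
  have h1 : entryInner (truncate A - truncate B) (truncate A - truncate B)
      ≤ entryInner (A - B) (A - B) := by
    -- Write A - B = D - N with D and N the differences of the positive and of the negative parts.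
    -- Positive and negative part of one matrix are orthogonal, and the mixed products of A with B
    -- enter ⟨D, N⟩ with a minus sign, so ⟨D, N⟩ ≤ 0 and |D|² ≤ |D - N|².
    have e : A - B = (truncate A - truncate B) - (negPart hA - negPart hB) := by
      conv_lhs => rw [← truncate_sub_negPart hA, ← truncate_sub_negPart hB]
      abel
    have hx : entryInner (truncate A - truncate B) (negPart hA - negPart hB) ≤ 0 := by
      rw [entryInner_sub_left, entryInner_sub_right, entryInner_sub_right,
        entryInner_truncate_negPart, entryInner_truncate_negPart]
      have h3 := entryInner_nonneg (truncate_posSemidef A) (negPart_posSemidef hB)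
      have h4 := entryInner_nonneg (truncate_posSemidef B) (negPart_posSemidef hA)
      linarith
    rw [e]
    generalize truncate A - truncate B = D at *
    generalize negPart hA - negPart hB = N at *
    rw [entryInner_sub_left, entryInner_sub_right, entryInner_sub_right, entryInner_comm N D]
    have := entryInner_self_nonneg N
    linarith
  have h2 := (sq_le_entryInner_self (truncate A - truncate B) a b).trans
    (h1.trans (entryInner_self_le (A - B)))
  exact abs_le_of_sq_le_sq h2 (absSum_nonneg _)

/-- A positive definite matrix is bounded below. -/
theorem exists_pos_mul_dotProduct_le {G : Matrix (Fin m) (Fin m) ℝ} (hG : G.PosDef) :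
    ∃ c : ℝ, 0 < c ∧ ∀ x : Fin m → ℝ, c * (x ⬝ᵥ x) ≤ x ⬝ᵥ G.mulVec x := by
  set ev := hG.1.eigenvalues with hev
  have hpos : ∀ k, 0 < ev k := hG.eigenvalues_pos
  have hs : 0 < 1 + ∑ k, (ev k)⁻¹ :=
    add_pos_of_pos_of_nonneg one_pos (Finset.sum_nonneg fun k _ => (inv_pos.2 (hpos k)).le)
  -- This constant lies below every eigenvalue; the summand 1 keeps it positive also when the index
  -- set is empty.
  refine ⟨(1 + ∑ k, (ev k)⁻¹)⁻¹, inv_pos.2 hs, fun x => ?_⟩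
  have hle : ∀ k, (1 + ∑ k, (ev k)⁻¹)⁻¹ ≤ ev k := fun k => by
    rw [inv_le_comm₀ hs (hpos k)]
    have := Finset.single_le_sum (f := fun k => (ev k)⁻¹) (fun k _ => (inv_pos.2 (hpos k)).le)
      (Finset.mem_univ k)
    linarith
  have h1 : x ⬝ᵥ x = ∑ k, ((hG.1.eigenvectorBasis k).ofLp ⬝ᵥ x) ^ 2 := by
    have h2 := hG.1.eigenvectorBasis.sum_sq_inner_right (WithLp.toLp 2 x)
    rw [EuclideanSpace.real_norm_sq_eq] at h2
    simp only [EuclideanSpace.inner_eq_star_dotProduct, star_trivial] at h2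
    rw [dotProduct]
    simp only [← sq]
    rw [← h2]
    exact Finset.sum_congr rfl fun k _ => by rw [dotProduct_comm]
  have h3 : x ⬝ᵥ G.mulVec x = ∑ k, ev k * ((hG.1.eigenvectorBasis k).ofLp ⬝ᵥ x) ^ 2 := by
    conv_lhs => rw [isHermitian_spectral hG.1]
    rw [Matrix.sum_mulVec, dotProduct_sum]
    refine Finset.sum_congr rfl fun k _ => ?_
    rw [Matrix.smul_mulVec, Matrix.vecMulVec_mulVec, dotProduct_smul]
    simp only [smul_eq_mul, op_smul_eq_smul, dotProduct_smul]
    rw [dotProduct_comm x]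
    ring
  rw [h1, h3, Finset.mul_sum]
  exact Finset.sum_le_sum fun k _ => mul_le_mul_of_nonneg_right (hle k) (sq_nonneg _)

/-- The inverse of `Q + G` is bounded uniformly over the positive semidefinite matrices `Q`. -/
theorem exists_absSum_inv_le {G : Matrix (Fin m) (Fin m) ℝ} (hG : G.PosDef) :
    ∃ c : ℝ, 0 ≤ c ∧ ∀ Q : Matrix (Fin m) (Fin m) ℝ, Q.PosSemidef → absSum (Q + G)⁻¹ ≤ c := by
  obtain ⟨c, hc, h⟩ := exists_pos_mul_dotProduct_le hG
  refine ⟨m * (m * c⁻¹), by positivity, fun Q hQ => ?_⟩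
  have hS : (Q + G).PosDef := Matrix.PosDef.posSemidef_add hQ hG
  have hdet : IsUnit (Q + G).det := (Matrix.isUnit_iff_isUnit_det _).1 hS.isUnit
  have hentry : ∀ a b, |(Q + G)⁻¹ a b| ≤ c⁻¹ := by
    intro a b
    -- Test the quadratic form on the column z of the inverse with index b: zᵀ(Q + G)z = z_b, so c
    -- z_a² ≤ z_b for every a. The case a = b gives z_b ≤ 1/c, and then |z_a| ≤ 1/c for all a.
    set z : Fin m → ℝ := (Q + G)⁻¹.mulVec (Pi.single b 1) with hz
    have hza : ∀ a, z a = (Q + G)⁻¹ a b := fun a => by simp [hz]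
    have h1 : z ⬝ᵥ (Q + G).mulVec z = z b := by
      rw [hz, Matrix.mulVec_mulVec, Matrix.mul_nonsing_inv _ hdet, Matrix.one_mulVec]
      simp
    have h2 : 0 ≤ z ⬝ᵥ Q.mulVec z := by simpa using hQ.dotProduct_mulVec_nonneg z
    rw [Matrix.add_mulVec, dotProduct_add] at h1
    have h3 := h z
    have h4 : ∀ a, c * z a ^ 2 ≤ z b := fun a => by
      have : z a ^ 2 ≤ z ⬝ᵥ z := by
        rw [sq]
        exact Finset.single_le_sum (f := fun a => z a * z a) (fun _ _ => mul_self_nonneg _)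
          (Finset.mem_univ a)
      nlinarith
    have h5 : z b ≤ c⁻¹ := by
      by_contra! hlt
      have hzb : 0 < z b := (inv_pos.2 hc).trans hlt
      have h6 : 1 < c * z b := by
        have := mul_lt_mul_of_pos_left hlt hc
        rwa [mul_inv_cancel₀ hc.ne'] at this
      nlinarith [h4 b]
    rw [← hza a]
    refine abs_le_of_sq_le_sq (b := c⁻¹) ?_ (inv_pos.2 hc).le
    have h7 := (h4 a).trans h5
    rw [sq c⁻¹, ← div_eq_mul_inv, le_div_iff₀ hc]
    linarith
  calc absSum (Q + G)⁻¹ ≤ ∑ _a : Fin m, ∑ _b : Fin m, c⁻¹ :=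
        Finset.sum_le_sum fun a _ => Finset.sum_le_sum fun b _ => hentry a b
    _ = _ := by simp

end Matrices

variable {d m : ℕ} {Ξ : Type*} [MeasurableSpace Ξ]

/-! ### Lipschitz dependence of the gain on the covariance. -/

theorem Model.innovation_posDef (S : Model d m Ξ) {C : Matrix (Fin d) (Fin d) ℝ}
    (hC : C.PosSemidef) : (S.H * C * S.H.transpose + S.Γ).PosDef := by
  refine Matrix.PosDef.posSemidef_add ?_ S.posDef_Γ
  simpa using hC.mul_mul_conjTranspose_same S.H

/-- The gain is a Lipschitz function of the covariance, at a positive semidefinite matrix. -/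
theorem Model.exists_gain_sub_le (S : Model d m Ξ) {B : Matrix (Fin d) (Fin d) ℝ}
    (hB : B.PosSemidef) : ∃ c : ℝ≥0, ∀ C : Matrix (Fin d) (Fin d) ℝ, C.IsHermitian →
      absSum (S.gain C (truncate C) - S.gain B B) ≤ c * absSum (C - B) := by
  obtain ⟨c, hc, hinv⟩ := exists_absSum_inv_le S.posDef_Γ
  set h := absSum S.H.transpose
  set h' := absSum S.H
  have hh : 0 ≤ h := absSum_nonneg _
  have hh' : 0 ≤ h' := absSum_nonneg _
  have hb : 0 ≤ absSum B := absSum_nonneg _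
  refine ⟨(h * c + absSum B * h * (c * (h' * (d * d) * h) * c)).toNNReal, fun C hC => ?_⟩
  set W := S.H * truncate C * S.H.transpose + S.Γ with hW
  set V := S.H * B * S.H.transpose + S.Γ with hV
  have hWp : W.PosDef := S.innovation_posDef (truncate_posSemidef C)
  have hVp : V.PosDef := S.innovation_posDef hB
  have hWd : IsUnit W.det := (Matrix.isUnit_iff_isUnit_det _).1 hWp.isUnit
  have hVd : IsUnit V.det := (Matrix.isUnit_iff_isUnit_det _).1 hVp.isUnit
  have hWi : absSum W⁻¹ ≤ c := hinv _ (by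
    simpa using (truncate_posSemidef C).mul_mul_conjTranspose_same S.H)
  have hVi : absSum V⁻¹ ≤ c := hinv _ (by simpa using hB.mul_mul_conjTranspose_same S.H)
  -- Resolvent identity: since both inverses are bounded by the same `c`, the difference of the
  -- inverses is linear in the difference of the covariances.
  have hdiff : W⁻¹ - V⁻¹ = W⁻¹ * (S.H * (B - truncate C) * S.H.transpose) * V⁻¹ := by
    have h1 : S.H * (B - truncate C) * S.H.transpose = V - W := by
      rw [hV, hW, Matrix.mul_sub, Matrix.sub_mul]; abel
    rw [h1, Matrix.mul_sub, Matrix.sub_mul, Matrix.nonsing_inv_mul _ hWd, Matrix.one_mul,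
      Matrix.mul_assoc, Matrix.mul_nonsing_inv _ hVd, Matrix.mul_one]
  -- As `B` is its own truncation, nonexpansiveness applies to `C` and `B`; the factor d² comes from
  -- summing an entrywise bound.
  have htr : absSum (B - truncate C) ≤ d * d * absSum (C - B) := by
    calc absSum (B - truncate C) ≤ ∑ _a : Fin d, ∑ _b : Fin d, absSum (C - B) :=
          Finset.sum_le_sum fun a _ => Finset.sum_le_sum fun b _ => by
            have := truncate_lipschitz hC hB.1 a b
            rwa [truncate_of_posSemidef hB, abs_sub_comm, ← Matrix.sub_apply] at this
      _ = _ := by simp [mul_assoc]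
  have hsplit : S.gain C (truncate C) - S.gain B B
      = (C - B) * S.H.transpose * W⁻¹ + B * S.H.transpose * (W⁻¹ - V⁻¹) := by
    simp only [Model.gain, ← hW, ← hV, Matrix.mul_sub, Matrix.sub_mul]; abel
  have hx := absSum_nonneg (C - B)
  rw [hsplit, hdiff]
  refine (absSum_add_le _ _).trans ?_
  have h1 : absSum ((C - B) * S.H.transpose * W⁻¹) ≤ absSum (C - B) * h * c :=
    (absSum_mul_le _ _).trans (mul_le_mul (absSum_mul_le _ _) hWi (absSum_nonneg _)
      (by positivity))
  have h2 : absSum (S.H * (B - truncate C) * S.H.transpose)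
      ≤ h' * (d * d * absSum (C - B)) * h :=
    (absSum_mul_le _ _).trans (mul_le_mul_of_nonneg_right ((absSum_mul_le _ _).trans
      (mul_le_mul_of_nonneg_left htr hh')) hh)
  have h3 : absSum (W⁻¹ * (S.H * (B - truncate C) * S.H.transpose) * V⁻¹)
      ≤ c * (h' * (d * d * absSum (C - B)) * h) * c :=
    (absSum_mul_le _ _).trans (mul_le_mul ((absSum_mul_le _ _).trans
      (mul_le_mul hWi h2 (absSum_nonneg _) hc)) hVi (absSum_nonneg _) (by positivity))
  have h4 : absSum (B * S.H.transpose * (W⁻¹ * (S.H * (B - truncate C) * S.H.transpose) * V⁻¹))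
      ≤ absSum B * h * (c * (h' * (d * d * absSum (C - B)) * h) * c) :=
    (absSum_mul_le _ _).trans (mul_le_mul (absSum_mul_le _ _) h3 (absSum_nonneg _)
      (by positivity))
  refine (add_le_add h1 h4).trans (le_of_eq ?_)
  rw [Real.coe_toNNReal _ (by positivity)]
  ring

/-! ### Measurability of the gain -/

/-- Continuity follows from the Lipschitz bound. It is stated on the subtype of symmetric matrices
because `truncate` takes the default value 0 elsewhere. -/
theorem continuous_truncate (a b : Fin d) :
    Continuous fun A : {A : Matrix (Fin d) (Fin d) ℝ // A.IsHermitian} => truncate A.1 a b := by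
  refine continuous_iff_continuousAt.2 fun A => ?_
  refine tendsto_iff_dist_tendsto_zero.2 (squeeze_zero (g := fun B => absSum (B.1 - A.1))
    (fun _ => dist_nonneg) (fun B => truncate_lipschitz B.2 A.2 a b) ?_)
  have hc : Continuous fun B : {A : Matrix (Fin d) (Fin d) ℝ // A.IsHermitian} =>
      absSum (B.1 - A.1) := by
    unfold absSum
    refine continuous_finsetSum _ fun a _ => continuous_finsetSum _ fun b _ => ?_
    exact ((continuous_subtype_val.sub continuous_const).matrix_elem a b).abs
  simpa [absSum] using hc.tendsto A

section

variable {Ω : Type*} [MeasurableSpace Ω]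

theorem measurable_truncate {C : Ω → Matrix (Fin d) (Fin d) ℝ} (hC : ∀ x, (C x).IsHermitian)
    (hm : ∀ a b, Measurable fun x => C x a b) (a b : Fin d) :
    Measurable fun x => truncate (C x) a b := by
  let _ : MeasurableSpace (Matrix (Fin d) (Fin d) ℝ) :=
    inferInstanceAs (MeasurableSpace (Fin d → Fin d → ℝ))
  have _ : BorelSpace (Matrix (Fin d) (Fin d) ℝ) :=
    inferInstanceAs (BorelSpace (Fin d → Fin d → ℝ))
  have h1 : Measurable fun x => (⟨C x, hC x⟩ : {A : Matrix (Fin d) (Fin d) ℝ // A.IsHermitian}) :=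
    Measurable.subtype_mk (measurable_pi_iff.2 fun a => measurable_pi_iff.2 fun b => hm a b)
  exact (continuous_truncate a b).measurable.comp h1

theorem measurable_matrix_mul {i j k : ℕ} {A : Ω → Matrix (Fin i) (Fin j) ℝ}
    {B : Ω → Matrix (Fin j) (Fin k) ℝ} (hA : ∀ a b, Measurable fun x => A x a b)
    (hB : ∀ a b, Measurable fun x => B x a b) (a : Fin i) (b : Fin k) :
    Measurable fun x => (A x * B x) a b := by
  simp only [Matrix.mul_apply]
  exact Finset.measurable_sum _ fun c _ => (hA a c).mul (hB c b)

/-- By the adjugate formula: the reciprocal of the determinant is measurable everywhere, including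
at singular matrices, where it is 0 by convention. -/
theorem measurable_matrix_inv {A : Ω → Matrix (Fin m) (Fin m) ℝ}
    (hA : ∀ a b, Measurable fun x => A x a b) (a b : Fin m) :
    Measurable fun x => (A x)⁻¹ a b := by
  let _ : MeasurableSpace (Matrix (Fin m) (Fin m) ℝ) :=
    inferInstanceAs (MeasurableSpace (Fin m → Fin m → ℝ))
  have _ : BorelSpace (Matrix (Fin m) (Fin m) ℝ) :=
    inferInstanceAs (BorelSpace (Fin m → Fin m → ℝ))
  have h1 : Measurable A := measurable_pi_iff.2 fun a => measurable_pi_iff.2 fun b => hA a b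
  have h2 : Measurable fun A : Matrix (Fin m) (Fin m) ℝ => A⁻¹ a b := by
    simp only [Matrix.inv_def, Matrix.smul_apply, Ring.inverse_eq_inv', smul_eq_mul]
    exact (Continuous.matrix_det continuous_id).measurable.inv.mul
      ((Continuous.matrix_adjugate continuous_id).matrix_elem a b).measurable
  exact h2.comp h1

theorem Model.measurable_gain (S : Model d m Ξ) {C C' : Ω → Matrix (Fin d) (Fin d) ℝ}
    (hC : ∀ a b, Measurable fun x => C x a b) (hC' : ∀ a b, Measurable fun x => C' x a b)
    (a : Fin d) (b : Fin m) : Measurable fun x => S.gain (C x) (C' x) a b := by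
  have h1 : ∀ a b, Measurable fun x => (S.H * C' x * S.H.transpose + S.Γ) a b := fun a b => by
    have h2 := measurable_matrix_mul (A := fun x => S.H * C' x) (B := fun _ => S.H.transpose)
      (measurable_matrix_mul (A := fun _ => S.H) (fun _ _ => measurable_const) hC')
      (fun _ _ => measurable_const) a b
    exact h2.add_const (S.Γ a b)
  have h3 := measurable_matrix_mul (A := fun x => C x) (B := fun _ => S.H.transpose) hC
    fun _ _ => measurable_const
  exact measurable_matrix_mul (A := fun x => C x * S.H.transpose) h3 (measurable_matrix_inv h1) a b

end

end MLEnKF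

namespace MLEnKF

/-! ### Resampling one coordinate -/

section Resampling

variable {D D' Y : Type*} [MeasurableSpace D] [MeasurableSpace D'] [MeasurableSpace Y]

/-- `s` is a component of a random element of law `ρ` that is distributed according to `ν` and can
be replaced by an independent copy: `R (z, y)` is `z` with that component replaced by `y`. -/
structure IsSlot (ρ : Measure D) (ν : Measure Y) (s : D → Y) (R : D × Y → D) : Prop where
  measurable : Measurable s
  preserving : MeasurePreserving R (ρ.prod ν) ρ
  slot : ∀ x, s (R x) = x.2

/-- A component is independent of everything that does not depend on it. -/
theorem IsSlot.map_prodMk {V : Type*} [MeasurableSpace V] {ρ : Measure D} {ν : Measure Y}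
    [IsProbabilityMeasure ρ] [IsProbabilityMeasure ν] {s : D → Y} {R : D × Y → D}
    (h : IsSlot ρ ν s R) {f : D → V} (hf : Measurable f) (hR : ∀ x, f (R x) = f x.1) :
    ρ.map (fun z => (f z, s z)) = (ρ.map f).prod ν := by
  conv_lhs => rw [← h.preserving.map_eq]
  rw [Measure.map_map (hf.prodMk h.measurable) h.preserving.measurable]
  have : (fun z => (f z, s z)) ∘ R = Prod.map f id := by
    ext1 x
    exact Prod.ext (hR x) (h.slot x)
  rw [this, ← Measure.map_prod_map _ _ hf measurable_id, Measure.map_id]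

theorem IsSlot.snd (ρ : Measure D) (ν : Measure Y) [IsProbabilityMeasure ρ]
    [IsProbabilityMeasure ν] :
    IsSlot (ρ.prod ν) ν Prod.snd (fun x : (D × Y) × Y => (x.1.1, x.2)) where
  measurable := measurable_snd
  preserving := MeasurePreserving.prod (f := fun x : D × Y => x.1) measurePreserving_fst
    (MeasurePreserving.id ν)
  slot _ := rfl

theorem IsSlot.prodLeft {ρ : Measure D} {ν : Measure Y} {ρ' : Measure D'}
    [IsProbabilityMeasure ρ] [IsProbabilityMeasure ν] [IsProbabilityMeasure ρ'] {s : D → Y}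
    {R : D × Y → D} (h : IsSlot ρ ν s R) :
    IsSlot (ρ.prod ρ') ν (fun z => s z.1) (fun x => (R (x.1.1, x.2), x.1.2)) where
  measurable := h.measurable.comp measurable_fst
  preserving := by
    have h1 := measurePreserving_prodAssoc ρ ρ' ν
    have h2 := (MeasurePreserving.id ρ).prod (Measure.measurePreserving_swap (μ := ρ') (ν := ν))
    have h3 := (measurePreserving_prodAssoc ρ ν ρ').symm
    have h4 := h.preserving.prod (MeasurePreserving.id ρ')
    exact h4.comp (h3.comp (h2.comp h1))
  slot _ := h.slot _

theorem IsSlot.prodRight {ρ : Measure D} {ν : Measure Y} {ρ' : Measure D'}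
    [IsProbabilityMeasure ρ] [IsProbabilityMeasure ν] [IsProbabilityMeasure ρ'] {s : D → Y}
    {R : D × Y → D} (h : IsSlot ρ ν s R) :
    IsSlot (ρ'.prod ρ) ν (fun z => s z.2) (fun x => (x.1.1, R (x.1.2, x.2))) where
  measurable := h.measurable.comp measurable_snd
  preserving := by
    have h1 := measurePreserving_prodAssoc ρ' ρ ν
    have h2 := (MeasurePreserving.id ρ').prod h.preserving
    exact h2.comp h1
  slot _ := h.slot _

theorem measurable_update_coord {ι : Type*} [DecidableEq ι] (q : ι) {T : D × Y → D}
    (hT : Measurable T) :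
    Measurable fun x : (ι → D) × Y => Function.update x.1 q (T (x.1 q, x.2)) := by
  refine measurable_pi_iff.2 fun i => ?_
  by_cases hi : i = q
  · subst hi
    simp only [Function.update_self]
    fun_prop
  · simp only [Function.update_of_ne hi]
    fun_prop

/-- It suffices to test on boxes over a finite index set. If the set contains `q`, the factor of
that coordinate, averaged over the fresh value, has its original measure because `R` preserves ρ;
otherwise the box does not see the change. -/
theorem IsSlot.infinitePi {ι : Type*} [DecidableEq ι] {ρ : Measure D} {ν : Measure Y}
    [IsProbabilityMeasure ρ] [IsProbabilityMeasure ν] {s : D → Y} {R : D × Y → D}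
    (h : IsSlot ρ ν s R) (q : ι) :
    IsSlot (Measure.infinitePi fun _ : ι => ρ) ν (fun w => s (w q))
      (fun x => Function.update x.1 q (R (x.1 q, x.2))) where
  measurable := h.measurable.comp (measurable_pi_apply q)
  preserving := by
    have hR := h.preserving.measurable
    have hm := measurable_update_coord q hR
    refine ⟨hm, Measure.eq_infinitePi _ fun s t ht => ?_⟩
    rw [Measure.map_apply hm (MeasurableSet.pi s.countable_toSet fun i _ => ht i),
      Measure.prod_apply_symm (hm (MeasurableSet.pi s.countable_toSet fun i _ => ht i))]
    by_cases hq : q ∈ s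
    · have hset : ∀ y, ((fun x => (x, y)) ⁻¹' ((fun x : (ι → D) × Y =>
          Function.update x.1 q (R (x.1 q, x.2))) ⁻¹' (Set.pi s t)))
          = Set.pi s (Function.update t q ((fun x => R (x, y)) ⁻¹' t q)) := by
        intro y
        ext w
        simp only [Set.mem_preimage, Set.mem_pi]
        refine forall_congr' fun i => forall_congr' fun _ => ?_
        by_cases hi : i = q
        · subst hi; simp
        · simp [Function.update_of_ne hi]
      have hmeas : ∀ y, ∀ i, MeasurableSet
          (Function.update t q ((fun x => R (x, y)) ⁻¹' t q) i) := by
        intro y i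
        by_cases hi : i = q
        · subst hi
          simp only [Function.update_self]
          exact (hR.comp (measurable_id.prodMk measurable_const)) (ht _)
        · simp only [Function.update_of_ne hi]
          exact ht i
      simp only [hset]
      have hval : ∀ y, (Measure.infinitePi fun _ : ι => ρ)
          (Set.pi s (Function.update t q ((fun x => R (x, y)) ⁻¹' t q)))
          = ρ ((fun x => R (x, y)) ⁻¹' t q) * ∏ i ∈ s.erase q, ρ (t i) := by
        intro y
        rw [Measure.infinitePi_pi _ (fun i _ => hmeas y i), ← Finset.mul_prod_erase s _ hq,
          Function.update_self]
        congr 1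
        exact Finset.prod_congr rfl fun i hi => by
          rw [Function.update_of_ne (Finset.ne_of_mem_erase hi)]
      simp only [hval]
      rw [lintegral_mul_const' _ _ (ENNReal.prod_ne_top fun i _ => measure_ne_top _ _),
        ← Finset.mul_prod_erase s _ hq]
      congr 1
      have hpq : ρ (t q) = (ρ.prod ν) (R ⁻¹' t q) :=
        (h.preserving.measure_preimage (ht q).nullMeasurableSet).symm
      rw [hpq, Measure.prod_apply_symm (hR (ht q))]
      rfl
    · have hset : ∀ y, ((fun x => (x, y)) ⁻¹' ((fun x : (ι → D) × Y =>
          Function.update x.1 q (R (x.1 q, x.2))) ⁻¹' (Set.pi s t))) = Set.pi s t := by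
        intro y
        ext w
        simp only [Set.mem_preimage, Set.mem_pi]
        refine forall_congr' fun i => forall_congr' fun hi => ?_
        rw [Function.update_of_ne (ne_of_mem_of_not_mem hi hq)]
      simp only [hset, lintegral_const, measure_univ, mul_one]
      exact Measure.infinitePi_pi _ fun i _ => ht i
  slot x := by simp [h.slot]

theorem isSlot_eval {ι : Type*} [DecidableEq ι] (ν : Measure Y) [IsProbabilityMeasure ν] (q : ι) :
    IsSlot (Measure.infinitePi fun _ : ι => ν) ν (fun w => w q)
      (fun x => Function.update x.1 q x.2) :=
  IsSlot.infinitePi (s := id) (R := Prod.snd) ⟨measurable_id, measurePreserving_snd, fun _ => rfl⟩ q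

end Resampling

/-! ### Limits in all `L^p` -/

/-- A sequence with geometrically small increments converges in every `L^p`. -/
theorem LpO.exists_limit {D V : Type*} [MeasurableSpace D] {ρ : Measure D} [IsProbabilityMeasure ρ]
    [NormedAddCommGroup V] [CompleteSpace V] {f : ℕ → D → V} {r : ℕ → ℝ≥0} {q : ℝ≥0}
    (hf : ∀ l, AEStronglyMeasurable (f l) ρ) (hq : q < 1) (hr : ∀ l, r (l + 1) ≤ q * r l)
    (h : LpO ρ (fun l x => f (l + 1) x - f l x) (fun l => r (l + 1))) :
    ∃ g : D → V, StronglyMeasurable g ∧ LpO ρ (fun l x => f l x - g x) (fun l => r (l + 1)) := by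
  have hq1 : (0 : ℝ≥0) < 1 - q := tsub_pos_of_lt hq
  have htail : ∀ p : ℝ≥0, 2 ≤ p → ∃ C : ℝ≥0, ∀ l j,
      eLpNorm (f l - f (l + j)) p ρ ≤ C * r (l + 1) := by
    intro p hp
    obtain ⟨C, hC⟩ := h.bound p hp
    refine ⟨C * (1 - q)⁻¹, fun l j => ?_⟩
    have h1 : ∀ j, eLpNorm (f (l + j) - f l) p ρ
        ≤ ((C * r (l + 1) * ∑ i ∈ Finset.range j, q ^ i : ℝ≥0) : ℝ≥0∞) := by
      intro j
      induction j with
      | zero => simp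
      | succ j ih =>
        have hrj : ∀ j, r (l + j + 1) ≤ q ^ j * r (l + 1) := by
          intro j
          induction j with
          | zero => simp
          | succ j ih2 =>
            calc r (l + (j + 1) + 1) ≤ q * r (l + j + 1) := hr (l + j + 1)
              _ ≤ q * (q ^ j * r (l + 1)) := by gcongr
              _ = _ := by ring
        have e : f (l + (j + 1)) - f l = (f (l + j + 1) - f (l + j)) + (f (l + j) - f l) := by
          rw [← add_assoc]; abel
        rw [e]
        refine (eLpNorm_add_le ((hf _).sub (hf _)) ((hf _).sub (hf _))
          (LpO.one_le_of_two_le hp)).trans ?_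
        have hstep : eLpNorm (f (l + j + 1) - f (l + j)) p ρ
            ≤ ((C * (q ^ j * r (l + 1)) : ℝ≥0) : ℝ≥0∞) := by
          refine (hC (l + j)).trans ?_
          rw [← ENNReal.coe_mul, ENNReal.coe_le_coe]
          exact mul_le_mul_right (hrj j) C
        refine (add_le_add hstep ih).trans (le_of_eq ?_)
        rw [← ENNReal.coe_add, Finset.sum_range_succ]
        congr 1
        ring
    rw [eLpNorm_sub_comm]
    refine (h1 j).trans ?_
    rw [← ENNReal.coe_mul, ENNReal.coe_le_coe]
    have h2 : ∑ i ∈ Finset.range j, q ^ i ≤ (1 - q)⁻¹ := by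
      have hs := NNReal.hasSum_geometric hq
      exact sum_le_hasSum _ (fun _ _ => zero_le) hs
    calc C * r (l + 1) * ∑ i ∈ Finset.range j, q ^ i ≤ C * r (l + 1) * (1 - q)⁻¹ := by gcongr
      _ = _ := by ring
  obtain ⟨C, hC⟩ := htail 2 le_rfl
  have hr0 : ∀ l, r l ≤ q ^ l * r 0 := by
    intro l
    induction l with
    | zero => simp
    | succ l ih =>
      calc r (l + 1) ≤ q * r l := hr l
        _ ≤ q * (q ^ l * r 0) := by gcongr
        _ = _ := by ring
  -- The geometric tail bounds ‖f n - f i‖ and ‖f n - f j‖ give the first summand; the summand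
  -- 2^{-n} only provides the strict inequality that the Cauchy criterion requires.
  set B : ℕ → ℝ≥0 := fun n => q ^ n * (2 * C * r 0) + 2⁻¹ ^ n with hB
  have hBs : Summable B := by
    refine ((NNReal.summable_geometric hq).mul_right _).add (NNReal.summable_geometric ?_)
    exact inv_lt_one_of_one_lt₀ one_lt_two
  have hlim : ∀ᵐ x ∂ρ, ∃ v, Filter.Tendsto (fun n => f n x) Filter.atTop (nhds v) := by
    refine Lp.ae_tendsto_of_cauchy_eLpNorm (B := fun n => (B n : ℝ≥0∞)) hf
      (LpO.one_le_of_two_le le_rfl) (p := ((2 : ℝ≥0) : ℝ≥0∞))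
      (ENNReal.tsum_coe_ne_top_iff_summable.2 hBs) fun n i j hi hj => ?_
    have key : ∀ i, n ≤ i → eLpNorm (f n - f i) ((2 : ℝ≥0) : ℝ≥0∞) ρ
        ≤ ((C * (q ^ n * r 0) : ℝ≥0) : ℝ≥0∞) := fun i hi => by
      obtain ⟨j, rfl⟩ := Nat.exists_eq_add_of_le hi
      refine (hC n j).trans ?_
      rw [← ENNReal.coe_mul, ENNReal.coe_le_coe]
      refine mul_le_mul_right (((hr n).trans ?_).trans (hr0 n)) C
      exact mul_le_of_le_one_left zero_le hq.le
    have e : f i - f j = (f n - f j) - (f n - f i) := by abel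
    rw [e]
    refine (eLpNorm_sub_le ((hf _).sub (hf _)) ((hf _).sub (hf _))
      (LpO.one_le_of_two_le le_rfl)).trans_lt ?_
    refine (add_le_add (key j hj) (key i hi)).trans_lt ?_
    rw [← ENNReal.coe_add, ENNReal.coe_lt_coe, hB]
    refine lt_of_eq_of_lt (b := q ^ n * (2 * C * r 0)) (by ring) (lt_add_of_pos_right _ ?_)
    exact pow_pos (by norm_num) n
  obtain ⟨g, hg, hgl⟩ := exists_stronglyMeasurable_limit_of_tendsto_ae hf hlim
  refine ⟨g, hg, fun l => (hf l).sub hg.aestronglyMeasurable, fun p hp => ?_⟩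
  obtain ⟨C, hC⟩ := htail p hp
  refine ⟨C, fun l => ?_⟩
  -- The limit was found almost everywhere using p = 2; Fatou's lemma carries the tail bounds over
  -- to the same limit for every p.
  have h1 := Lp.eLpNorm_lim_le_liminf_eLpNorm (p := (p : ℝ≥0∞)) (μ := ρ)
    (f := fun n => f l - f (l + n)) (fun n => (hf l).sub (hf _)) (f l - g) (by
      filter_upwards [hgl] with x hx
      have hx' := (Filter.tendsto_add_atTop_iff_nat l).2 hx
      simp only [Pi.sub_apply]
      refine tendsto_const_nhds.sub ?_
      simpa only [add_comm l] using hx')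
  refine h1.trans ?_
  exact Filter.liminf_le_of_frequently_le' (Filter.Frequently.of_forall fun n => hC l n)

end MLEnKF

namespace MLEnKF

/-! ### The action of matrices and the update step -/

section Act

variable {i j d m : ℕ}

theorem act_apply (A : Matrix (Fin i) (Fin j) ℝ) (x : E j) (a : Fin i) :
    act A x a = ∑ b, A a b * x b := rfl

theorem act_sub_left (A B : Matrix (Fin i) (Fin j) ℝ) (x : E j) :
    act (A - B) x = act A x - act B x := by
  ext a; simp [act, Matrix.sub_mulVec]

theorem act_add (A : Matrix (Fin i) (Fin j) ℝ) (x y : E j) : act A (x + y) = act A x + act A y := by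
  ext a; simp [act, Matrix.mulVec_add]

theorem act_sub (A : Matrix (Fin i) (Fin j) ℝ) (x y : E j) : act A (x - y) = act A x - act A y := by
  ext a; simp [act, Matrix.mulVec_sub]

theorem act_act {k : ℕ} (A : Matrix (Fin i) (Fin j) ℝ) (B : Matrix (Fin j) (Fin k) ℝ) (x : E k) :
    act A (act B x) = act (A * B) x := by
  ext a; simp [act, Matrix.mulVec_mulVec]

theorem act_one (x : E j) : act 1 x = x := by ext a; simp [act]

theorem norm_act_le (A : Matrix (Fin i) (Fin j) ℝ) (x : E j) : ‖act A x‖ ≤ absSum A * ‖x‖ := by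
  refine (LpO.norm_le_sum_abs _).trans ?_
  rw [absSum, Finset.sum_mul]
  refine Finset.sum_le_sum fun a _ => ?_
  rw [act_apply, Finset.sum_mul]
  refine (Finset.abs_sum_le_sum_abs _ _).trans (Finset.sum_le_sum fun b _ => ?_)
  rw [abs_mul]
  exact mul_le_mul_of_nonneg_left (PiLp.norm_apply_le x b) (abs_nonneg _)

theorem continuous_act (A : Matrix (Fin i) (Fin j) ℝ) : Continuous (act A) := by
  unfold act
  fun_prop

@[fun_prop]
theorem measurable_act (A : Matrix (Fin i) (Fin j) ℝ) : Measurable (act A) :=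
  (continuous_act A).measurable

theorem measurable_act_of_entries {Ω : Type*} [MeasurableSpace Ω]
    {A : Ω → Matrix (Fin i) (Fin j) ℝ} (hA : ∀ a b, Measurable fun w => A w a b) {u : Ω → E j}
    (hu : Measurable u) : Measurable fun w => act (A w) (u w) := by
  have h : Measurable fun w => (A w).mulVec (u w).ofLp := by
    refine measurable_pi_iff.2 fun a => ?_
    simp only [Matrix.mulVec, dotProduct]
    exact Finset.measurable_sum _ fun b _ => (hA a b).mul (by fun_prop)
  exact (PiLp.continuous_toLp 2 _).measurable.comp h

theorem LpO.act {T Ω : Type*} [MeasurableSpace Ω] {μ : Measure Ω} {u : T → Ω → E j}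
    {δ : T → ℝ≥0} (h : LpO μ u δ) (A : Matrix (Fin i) (Fin j) ℝ) :
    LpO μ (fun t x => MLEnKF.act A (u t x)) δ :=
  h.of_norm_le (fun t => (continuous_act A).comp_aestronglyMeasurable (h.aesm t))
    ⟨absSum A, absSum_nonneg A⟩ fun _ _ => norm_act_le A _

end Act

variable {d m : ℕ} {Ξ : Type*} [MeasurableSpace Ξ]

/-- Split so that the difference of the states meets only the gain `K'`, later the deterministic
one, while the random gain enters only through `K - K'`. -/
theorem Model.update_sub (S : Model d m Ξ) (K K' : Matrix (Fin d) (Fin m) ℝ) (y : E m)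
    (x x' : E d) (η : E m) :
    S.update K y x η - S.update K' y x' η
      = act (1 - K' * S.H) (x - x') + act (K - K') (y + η - act S.H x) := by
  simp only [Model.update, act_sub_left, act_sub, act_add, act_act, act_one, Matrix.sub_mul]
  abel

theorem Model.measurable_update (S : Model d m Ξ) (K : Matrix (Fin d) (Fin m) ℝ) (y : E m) :
    Measurable fun z : E d × E m => S.update K y z.1 z.2 := by
  unfold Model.update
  exact ((measurable_act _).comp measurable_fst).add
    ((measurable_act _).comp (measurable_const.add measurable_snd))

/-! ### The mean-field particles -/

/-- The gain of the mean-field filter in the step from `n` to `n + 1`. -/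
noncomputable def Model.meanGain (S : Model d m Ξ) (n : ℕ) : Matrix (Fin d) (Fin m) ℝ :=
  S.gain (covMatrix (S.predictLaw ⊤ (S.meanFieldLaw n)))
    (covMatrix (S.predictLaw ⊤ (S.meanFieldLaw n)))

/-- The updated particle of level `l` of the mean-field filter, as a function of its randomness. -/
noncomputable def Model.path (S : Model d m Ξ) (l : ℕ∞) : ℕ → Draw d m Ξ → E d
  | 0, z => z.1
  | n + 1, z => S.update (S.meanGain n) (S.obs (n + 1)) (S.Psi l (S.path l n z) (z.2.1 n))
      (z.2.2 (n + 1))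

/-- The predicted particle of level `l` of the mean-field filter. -/
noncomputable def Model.pred (S : Model d m Ξ) (l : ℕ∞) (n : ℕ) (z : Draw d m Ξ) : E d :=
  S.Psi l (S.path l n z) (z.2.1 n)

theorem Model.path_succ (S : Model d m Ξ) (l : ℕ∞) (n : ℕ) (z : Draw d m Ξ) :
    S.path l (n + 1) z = S.update (S.meanGain n) (S.obs (n + 1)) (S.pred l n z) (z.2.2 (n + 1)) :=
  rfl

/-- The law of the updated particle of level `l` of the mean-field filter. -/
noncomputable def Model.levelLaw (S : Model d m Ξ) (l : ℕ∞) : ℕ → Measure (E d)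
  | 0 => S.init
  | n + 1 => S.updateLaw (S.meanGain n) (S.obs (n + 1)) (S.predictLaw l (S.levelLaw l n))

theorem Model.levelLaw_top (S : Model d m Ξ) (n : ℕ) : S.levelLaw ⊤ n = S.meanFieldLaw n := by
  induction n with
  | zero => rfl
  | succ n ih => simp only [Model.levelLaw, Model.meanFieldLaw, ih, Model.meanGain]

instance (S : Model d m Ξ) : IsProbabilityMeasure S.drawLaw := by
  unfold Model.drawLaw; infer_instance

theorem Model.measurable_pred_of (S : Model d m Ξ) {Ω : Type*} [MeasurableSpace Ω] (l : ℕ∞)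
    {u : Ω → E d} {s : Ω → Ξ} (hu : Measurable u) (hs : Measurable s) :
    Measurable fun w => S.Psi l (u w) (s w) :=
  (S.measurable_Psi l).comp (hu.prodMk hs)

theorem Model.measurable_path (S : Model d m Ξ) (l : ℕ∞) (n : ℕ) : Measurable (S.path l n) := by
  induction n with
  | zero => exact measurable_fst
  | succ n ih =>
    exact (S.measurable_update _ _).comp ((S.measurable_pred_of l ih (by fun_prop)).prodMk
      (by fun_prop))

theorem Model.measurable_pred (S : Model d m Ξ) (l : ℕ∞) (n : ℕ) : Measurable (S.pred l n) :=
  S.measurable_pred_of l (S.measurable_path l n) (by fun_prop)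

/-- Replace the noise that drives the solver over the `n`-th time interval. -/
def setNoise (n : ℕ) (x : Draw d m Ξ × Ξ) : Draw d m Ξ :=
  (x.1.1, Function.update x.1.2.1 n x.2, x.1.2.2)

/-- Replace the perturbation of the `n`-th observation. -/
def setObs (n : ℕ) (x : Draw d m Ξ × E m) : Draw d m Ξ :=
  (x.1.1, x.1.2.1, Function.update x.1.2.2 n x.2)

theorem Model.isSlot_noise (S : Model d m Ξ) (n : ℕ) :
    IsSlot S.drawLaw S.noise (fun z => z.2.1 n) (setNoise n) :=
  ((isSlot_eval S.noise n).prodLeft).prodRight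

theorem Model.isSlot_obs (S : Model d m Ξ) (n : ℕ) :
    IsSlot S.drawLaw (multivariateGaussian 0 S.Γ) (fun z => z.2.2 n) (setObs n) :=
  ((isSlot_eval (multivariateGaussian 0 S.Γ) n).prodRight).prodRight

theorem Model.path_setNoise (S : Model d m Ξ) (l : ℕ∞) {k n : ℕ} (hk : k ≤ n)
    (x : Draw d m Ξ × Ξ) : S.path l k (setNoise n x) = S.path l k x.1 := by
  induction k with
  | zero => rfl
  | succ k ih =>
    simp only [Model.path, ih (by omega)]
    simp only [setNoise, Function.update_of_ne (show k ≠ n by omega)]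

theorem Model.path_setObs (S : Model d m Ξ) (l : ℕ∞) {k n : ℕ} (hk : k ≤ n)
    (x : Draw d m Ξ × E m) : S.path l k (setObs (n + 1) x) = S.path l k x.1 := by
  induction k with
  | zero => rfl
  | succ k ih =>
    simp only [Model.path, ih (by omega)]
    simp only [setObs, Function.update_of_ne (show k + 1 ≠ n + 1 by omega)]

/-- The state at time `n` does not use the noise of the interval starting at `n`, so the joint law
of the two is a product. The law of the state is a hypothesis here because the lemma is used inside
the induction of `Model.map_path`. -/
theorem Model.map_path_pred (S : Model d m Ξ) (l : ℕ∞) (n : ℕ)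
    (h : S.drawLaw.map (S.path l n) = S.levelLaw l n) :
    S.drawLaw.map (S.pred l n) = S.predictLaw l (S.levelLaw l n) := by
  have hs := S.isSlot_noise n
  have h1 := hs.map_prodMk (S.measurable_path l n) (S.path_setNoise l le_rfl)
  rw [Model.predictLaw, ← h, ← h1, Measure.map_map (S.measurable_Psi l)
    ((S.measurable_path l n).prodMk hs.measurable)]
  rfl

theorem Model.map_path (S : Model d m Ξ) (l : ℕ∞) (n : ℕ) :
    S.drawLaw.map (S.path l n) = S.levelLaw l n := by
  induction n with
  | zero => exact (measurePreserving_fst).map_eq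
  | succ n ih =>
    have hs := S.isSlot_obs (n + 1)
    have h1 := hs.map_prodMk (f := S.pred l n) (S.measurable_pred l n) (fun x => by
      simp only [Model.pred, S.path_setObs l le_rfl]; rfl)
    rw [Model.levelLaw, Model.updateLaw, ← S.map_path_pred l n ih, ← h1,
      Measure.map_map (S.measurable_update _ _) ((S.measurable_pred l n).prodMk hs.measurable)]
    rfl

theorem Model.map_pred (S : Model d m Ξ) (l : ℕ∞) (n : ℕ) :
    S.drawLaw.map (S.pred l n) = S.predictLaw l (S.levelLaw l n) :=
  S.map_path_pred l n (S.map_path l n)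

instance (S : Model d m Ξ) (l : ℕ∞) (n : ℕ) : IsProbabilityMeasure (S.levelLaw l n) := by
  rw [← S.map_path l n]
  exact Measure.isProbabilityMeasure_map (S.measurable_path l n).aemeasurable

instance (S : Model d m Ξ) (n : ℕ) : IsProbabilityMeasure (S.meanFieldLaw n) := by
  rw [← S.levelLaw_top]; infer_instance

instance (S : Model d m Ξ) (l : ℕ∞) (ρ : Measure (E d)) [IsProbabilityMeasure ρ] :
    IsProbabilityMeasure (S.predictLaw l ρ) :=
  Measure.isProbabilityMeasure_map (S.measurable_Psi l).aemeasurable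

/-! ### The solution operators acting on families of random variables -/

section Psi

variable {T D : Type*} [MeasurableSpace D] {ρ : Measure D} [IsProbabilityMeasure ρ]
  {S : Model d m Ξ} {s : T → D → Ξ} {R : T → D × Ξ → D}

/-- The assumption speaks of a product of a joint law with the noise. Invariance of `u` and `v`
under resampling of the slot says exactly that the triple of `u`, `v` and noise has such a law. -/
theorem LpO.psi_sub (hS : LipschitzMoment S) {u v : T → D → E d} {δ : T → ℝ≥0}
    (h : LpO ρ (fun t z => u t z - v t z) δ) (l : T → ℕ∞)
    (hslot : ∀ t, IsSlot ρ S.noise (s t) (R t))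
    (hu : ∀ t, Measurable (u t)) (hv : ∀ t, Measurable (v t))
    (hu' : ∀ t x, u t (R t x) = u t x.1) (hv' : ∀ t x, v t (R t x) = v t x.1) :
    LpO ρ (fun t z => S.Psi (l t) (u t z) (s t z) - S.Psi (l t) (v t z) (s t z)) δ := by
  refine ⟨fun t => ((S.measurable_pred_of _ (hu t) (hslot t).measurable).sub
    (S.measurable_pred_of _ (hv t) (hslot t).measurable)).aestronglyMeasurable, fun p hp => ?_⟩
  obtain ⟨c, -, hc⟩ := hS.lipschitz p hp
  obtain ⟨C, hC⟩ := h.bound p hp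
  refine ⟨c * C, fun t => ?_⟩
  have huv : Measurable fun z => (u t z, v t z) := (hu t).prodMk (hv t)
  have hmap := (hslot t).map_prodMk huv (fun x => by rw [hu', hv'])
  have := Measure.isProbabilityMeasure_map (μ := ρ) huv.aemeasurable
  have h1 := hc (l t) (ρ.map fun z => (u t z, v t z)) this
  have hm : Measurable fun z : (E d × E d) × Ξ =>
      S.Psi (l t) z.1.1 z.2 - S.Psi (l t) z.1.2 z.2 :=
    (S.measurable_pred_of _ (by fun_prop) (by fun_prop)).sub
      (S.measurable_pred_of _ (by fun_prop) (by fun_prop))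
  rw [← hmap, eLpNorm_map_measure hm.aestronglyMeasurable
    (huv.prodMk (hslot t).measurable).aemeasurable, eLpNorm_map_measure
    (by fun_prop) huv.aemeasurable] at h1
  refine h1.trans ?_
  rw [ENNReal.coe_mul, mul_assoc]
  gcongr
  exact hC t

theorem LpO.psi (hS : LipschitzMoment S) {u : T → D → E d}
    (h : LpO ρ u fun _ => 1) (l : T → ℕ∞)
    (hslot : ∀ t, IsSlot ρ S.noise (s t) (R t))
    (hu : ∀ t, Measurable (u t)) (hu' : ∀ t x, u t (R t x) = u t x.1) :
    LpO ρ (fun t z => S.Psi (l t) (u t z) (s t z)) fun _ => 1 := by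
  refine ⟨fun t => (S.measurable_pred_of _ (hu t) (hslot t).measurable).aestronglyMeasurable,
    fun p hp => ?_⟩
  obtain ⟨c, -, hc⟩ := hS.moment p hp
  obtain ⟨C, hC⟩ := h.bound p hp
  have hp0 : (0 : ℝ) < p := by exact_mod_cast zero_lt_two.trans_le hp
  -- The moment condition bounds p-th powers of norms, hence the p-th root.
  refine ⟨(c * (1 + C ^ (p : ℝ))) ^ (p : ℝ)⁻¹, fun t => ?_⟩
  have hmap := (hslot t).map_prodMk (hu t) (hu' t)
  have := Measure.isProbabilityMeasure_map (μ := ρ) (hu t).aemeasurable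
  have h1 := hc (l t) (ρ.map (u t)) this
  rw [← hmap, eLpNorm_map_measure (S.measurable_Psi _).aestronglyMeasurable
    ((hu t).prodMk (hslot t).measurable).aemeasurable, eLpNorm_map_measure
    (by fun_prop) (hu t).aemeasurable] at h1
  have h2 : eLpNorm (fun z => S.Psi (l t) (u t z) (s t z)) p ρ ^ (p : ℝ)
      ≤ c * (1 + (C : ℝ≥0∞) ^ (p : ℝ)) := by
    refine h1.trans ?_
    have := hC t
    simp only [ENNReal.coe_one, mul_one] at this
    gcongr
    exact this
  rw [ENNReal.coe_one, mul_one, ENNReal.coe_rpow_of_nonneg _ (inv_nonneg.2 hp0.le),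
    ENNReal.le_rpow_inv_iff hp0]
  refine h2.trans (le_of_eq ?_)
  rw [ENNReal.coe_mul, ENNReal.coe_add, ENNReal.coe_rpow_of_nonneg _ hp0.le, ENNReal.coe_one]

end Psi

/-! ### Moments of the mean-field particles -/

theorem Model.lpO_obs (S : Model d m Ξ) {T : Type*} (n : ℕ) :
    LpO S.drawLaw (fun (_ : T) (z : Draw d m Ξ) => z.2.2 n) fun _ => 1 := by
  have h : LpO (multivariateGaussian 0 S.Γ) (fun (_ : T) (x : E m) => x) fun _ => 1 :=
    LpO.of_memLp fun p => IsGaussian.memLp_id _ p ENNReal.coe_ne_top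
  refine h.comp (e := fun _ (z : Draw d m Ξ) => z.2.2 n) fun _ => ?_
  exact (measurePreserving_eval_infinitePi (fun _ : ℕ => multivariateGaussian 0 S.Γ) n).comp
    (measurePreserving_snd.comp measurePreserving_snd)

theorem Model.lpO_update (S : Model d m Ξ) {T Ω : Type*} [MeasurableSpace Ω] {μ : Measure Ω}
    [IsProbabilityMeasure μ] (K : Matrix (Fin d) (Fin m) ℝ) (y : E m) {u : T → Ω → E d}
    {η : T → Ω → E m} (hu : LpO μ u fun _ => 1) (hη : LpO μ η fun _ => 1) :
    LpO μ (fun t x => S.update K y (u t x) (η t x)) fun _ => 1 :=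
  (hu.act _).add_same (((LpO.const y).add_same hη).act K)

theorem Model.lpO_path (S : Model d m Ξ) (hS : LipschitzMoment S) (n : ℕ) :
    LpO S.drawLaw (fun l : ℕ∞ => S.path l n) fun _ => 1 := by
  induction n with
  | zero =>
    have h : LpO S.init (fun (_ : ℕ∞) (x : E d) => x) fun _ => 1 := LpO.of_memLp S.init_moments
    exact h.comp (e := fun _ (z : Draw d m Ξ) => z.1) fun _ => measurePreserving_fst
  | succ n ih =>
    exact S.lpO_update _ _ (ih.psi hS id (fun _ => S.isSlot_noise n)
      (fun l => S.measurable_path l n) fun l => S.path_setNoise l le_rfl) (S.lpO_obs (n + 1))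

theorem Model.lpO_pred (S : Model d m Ξ) (hS : LipschitzMoment S) (n : ℕ) :
    LpO S.drawLaw (fun l : ℕ∞ => S.pred l n) fun _ => 1 :=
  (S.lpO_path hS n).psi hS id (fun _ => S.isSlot_noise n)
      (fun l => S.measurable_path l n) fun l => S.path_setNoise l le_rfl

theorem uniformMoments_map {D : Type*} [MeasurableSpace D] {ρ : Measure D}
    [IsProbabilityMeasure ρ] {u : ℕ → D → E d} (h : LpO ρ u fun _ => 1)
    (hu : ∀ l, Measurable (u l)) : UniformMoments fun l => ρ.map (u l) := by
  intro p
  obtain ⟨C, hC⟩ := h.bound (max p 2) (le_max_right _ _)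
  refine ⟨C, fun l => ?_⟩
  rw [eLpNorm_map_measure (by fun_prop) (hu l).aemeasurable]
  refine (eLpNorm_le_eLpNorm_of_exponent_le (q := ((max p 2 : ℝ≥0) : ℝ≥0∞))
    (by exact_mod_cast le_max_left p 2) (h.aesm l)).trans ?_
  simpa using hC l

theorem hasAllMoments_map {T D : Type*} [MeasurableSpace D] {ρ : Measure D}
    [IsProbabilityMeasure ρ] {u : T → D → E d} (h : LpO ρ u fun _ => 1) (t : T)
    (hu : Measurable (u t)) : HasAllMoments (ρ.map (u t)) := by
  intro p
  rw [memLp_map_measure_iff (by fun_prop) hu.aemeasurable]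
  exact h.memLp' p t

/-! ### Weak rates of the mean-field particles -/

variable {F : Set (E d → ℝ)} {N : ℕ → ℕ} {cost : ℕ → ℝ≥0} {α β γ : ℝ}

theorem Model.weakRate_predict_of (S : Model d m Ξ) (hS : LipschitzMoment S)
    (hF : MultilevelRates S F N cost α β γ) (n : ℕ)
    (h : WeakRate F (fun l => (N l : ℝ) ^ (-α)) (fun l => S.levelLaw l n) (S.levelLaw ⊤ n)) :
    WeakRate F (fun l => (N l : ℝ) ^ (-α)) (fun l => S.predictLaw l (S.levelLaw l n))
      (S.predictLaw ⊤ (S.levelLaw ⊤ n)) := by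
  refine hF.weak_predict _ _ (fun l => inferInstance) inferInstance ?_ ?_ h
  · simp only [← S.map_path]
    exact uniformMoments_map ((S.lpO_path hS n).reindex fun l : ℕ => (l : ℕ∞))
      fun l => S.measurable_path l n
  · rw [← S.map_path]
    exact hasAllMoments_map (S.lpO_path hS n) ⊤ (S.measurable_path ⊤ n)

/-- At time 0 all levels have the same law. Afterwards all levels are updated with one deterministic
gain, so the two stability assumptions apply alternately. -/
theorem Model.weakRate_path (S : Model d m Ξ) (hS : LipschitzMoment S)
    (hF : MultilevelRates S F N cost α β γ) (n : ℕ) :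
    WeakRate F (fun l => (N l : ℝ) ^ (-α)) (fun l => S.levelLaw l n) (S.levelLaw ⊤ n) := by
  induction n with
  | zero => exact fun φ _ => ⟨0, fun l => by simp [Model.levelLaw]⟩
  | succ n ih =>
    refine hF.weak_update _ _ (fun l => inferInstance) inferInstance ?_ ?_
      (S.weakRate_predict_of hS hF n ih) _ _
    · simp only [← S.map_pred]
      exact uniformMoments_map ((S.lpO_pred hS n).reindex fun l : ℕ => (l : ℕ∞))
        fun l => S.measurable_pred l n
    · rw [← S.map_pred]
      exact hasAllMoments_map (S.lpO_pred hS n) ⊤ (S.measurable_pred ⊤ n)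

theorem Model.weakRate_pred (S : Model d m Ξ) (hS : LipschitzMoment S)
    (hF : MultilevelRates S F N cost α β γ) (n : ℕ) :
    WeakRate F (fun l => (N l : ℝ) ^ (-α)) (fun l => S.predictLaw l (S.levelLaw l n))
      (S.predictLaw ⊤ (S.levelLaw ⊤ n)) :=
  S.weakRate_predict_of hS hF n (S.weakRate_path hS hF n)

/-! ### Strong rates of the mean-field particles -/

/-- The strong rate `N_l^{-β/2}`. -/
noncomputable def strongRate (N : ℕ → ℕ) (β : ℝ) (l : ℕ) : ℝ≥0 := (N l : ℝ≥0) ^ (-β / 2)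

theorem MultilevelRates.strongRate_succ_le {S : Model d m Ξ}
    (hF : MultilevelRates S F N cost α β γ) :
    ∃ q : ℝ≥0, q < 1 ∧ ∀ l, strongRate N β (l + 1) ≤ q * strongRate N β l := by
  obtain ⟨b, hb, h⟩ := hF.N_growth
  have hβ := hF.β_pos
  have hb0 : 0 < b := zero_lt_one.trans hb
  refine ⟨b.toNNReal ^ (-β / 2), NNReal.rpow_lt_one_of_one_lt_of_neg ?_ (by linarith),
    fun l => ?_⟩
  · rwa [← Real.toNNReal_one, Real.toNNReal_lt_toNNReal_iff hb0]
  · have hN : (0 : ℝ) < N l := by exact_mod_cast hF.N_pos l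
    rw [strongRate, strongRate, ← NNReal.mul_rpow, ← NNReal.coe_le_coe]
    push_cast
    rw [Real.coe_toNNReal b hb0.le]
    exact Real.rpow_le_rpow_of_nonpos (by positivity) (h l) (by linarith)

/-- Closeness of consecutive solvers is assumed for observables in `F`; the coordinate functions
belong to `F`, and together they control the vector. -/
theorem Model.lpO_psi_level (S : Model d m Ξ) (hF : MultilevelRates S F N cost α β γ)
    {g : Draw d m Ξ → E d} (hg : Measurable g) (hg' : HasAllMoments (S.drawLaw.map g)) :
    LpO (S.drawLaw.prod S.noise) (fun (l : ℕ) x =>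
      S.Psi ((l + 1 : ℕ) : ℕ∞) (g x.1) x.2 - S.Psi (l : ℕ∞) (g x.1) x.2)
      fun l => strongRate N β (l + 1) := by
  have hm : ∀ l : ℕ∞, Measurable fun x : Draw d m Ξ × Ξ => S.Psi l (g x.1) x.2 := fun l =>
    S.measurable_pred_of l (hg.comp measurable_fst) measurable_snd
  refine LpO.of_coord (fun l => ((hm _).sub (hm _)).aestronglyMeasurable) fun j => ?_
  refine ⟨fun l => (((hm _).sub (hm _)).aestronglyMeasurable |>
    (EuclideanSpace.proj (𝕜 := ℝ) j).continuous.comp_aestronglyMeasurable), fun p hp => ?_⟩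
  have hpr := Measure.isProbabilityMeasure_map (μ := S.drawLaw) hg.aemeasurable
  obtain ⟨c, hc⟩ := hF.strong _ (hF.coord_mem j) (S.drawLaw.map g) hpr hg' p hp
  refine ⟨c.toNNReal, fun l => ?_⟩
  have h1 := hc l
  have hmap : (S.drawLaw.map g).prod S.noise
      = (S.drawLaw.prod S.noise).map (Prod.map g id) := by
    rw [← Measure.map_prod_map _ _ hg measurable_id, Measure.map_id]
  have hm2 : Measurable fun z : E d × Ξ =>
      S.Psi ((l + 1 : ℕ) : ℕ∞) z.1 z.2 j - S.Psi (l : ℕ∞) z.1 z.2 j :=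
    ((EuclideanSpace.proj (𝕜 := ℝ) j).continuous.measurable.comp (S.measurable_Psi _)).sub
      ((EuclideanSpace.proj (𝕜 := ℝ) j).continuous.measurable.comp (S.measurable_Psi _))
  rw [hmap, eLpNorm_map_measure hm2.aestronglyMeasurable (by fun_prop)] at h1
  refine h1.trans ?_
  rw [ENNReal.ofReal_mul' (by positivity)]
  refine mul_le_mul_right (le_of_eq ?_) _
  rw [strongRate, ENNReal.ofReal, Real.toNNReal_rpow_of_nonneg (by positivity),
    Real.toNNReal_natCast]

/-- The strong rate is assumed only for a fixed argument, whereas the mean-field states change with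
the level. The remedy is a pivot independent of the level: the L^p limit g of the states. Then
Ψ^{l+1}(u_{l+1}) - Ψ^l(u_l) is compared via Ψ^{l+1}(g) and Ψ^l(g), using the Lipschitz condition
twice and the strong rate once. -/
theorem Model.lpO_pred_sub_of (S : Model d m Ξ) (hS : LipschitzMoment S)
    (hF : MultilevelRates S F N cost α β γ) (n : ℕ)
    (h : LpO S.drawLaw (fun (l : ℕ) z => S.path ((l + 1 : ℕ) : ℕ∞) n z - S.path l n z)
      fun l => strongRate N β (l + 1)) :
    LpO S.drawLaw (fun (l : ℕ) z => S.pred ((l + 1 : ℕ) : ℕ∞) n z - S.pred l n z)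
      fun l => strongRate N β (l + 1) := by
  obtain ⟨q, hq, hr⟩ := hF.strongRate_succ_le
  -- The limit exists because the strong rates decay geometrically, and its distance to level l is
  -- of the order of the increment from l to l + 1.
  obtain ⟨g, hg, hfg⟩ := LpO.exists_limit (f := fun l : ℕ => S.path l n)
    (fun l => (S.measurable_path l n).aestronglyMeasurable) hq hr h
  -- The limit g is a function of the whole draw, and its independence of the n-th noise is not
  -- available. The estimate is therefore made with a fresh noise on a product space.
  have hslot : ∀ _ : ℕ, IsSlot (S.drawLaw.prod S.noise) S.noise Prod.snd
    (fun x : (Draw d m Ξ × Ξ) × Ξ => (x.1.1, x.2)) := fun _ => IsSlot.snd _ _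
  have hgm : Measurable g := hg.measurable
  have hg1 : LpO S.drawLaw (fun (_ : ℕ) => g) fun _ => 1 := by
    have h1 := ((S.lpO_path hS n).reindex fun _ : ℕ => ((0 : ℕ) : ℕ∞)).sub_same
      ((hfg.reindex fun _ : ℕ => 0).mono_rate (δ' := fun _ => 1) (C := strongRate N β (0 + 1))
        fun _ => by simp)
    exact h1.congr fun t x => by simp
  have hgM : HasAllMoments (S.drawLaw.map g) := hasAllMoments_map hg1 0 hgm
  have hfst : ∀ _ : ℕ, MeasurePreserving (fun x : Draw d m Ξ × Ξ => x.1)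
    (S.drawLaw.prod S.noise) S.drawLaw := fun _ => measurePreserving_fst
  have hpm : ∀ l : ℕ, Measurable fun x : Draw d m Ξ × Ξ => S.path l n x.1 := fun l =>
    (S.measurable_path l n).comp measurable_fst
  have hgm' : Measurable fun x : Draw d m Ξ × Ξ => g x.1 := hgm.comp measurable_fst
  have a1 : LpO (S.drawLaw.prod S.noise) (fun (l : ℕ) x =>
      S.Psi ((l + 1 : ℕ) : ℕ∞) (S.path ((l + 1 : ℕ) : ℕ∞) n x.1) x.2
        - S.Psi ((l + 1 : ℕ) : ℕ∞) (g x.1) x.2) fun l => strongRate N β (l + 1) :=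
    (((hfg.reindex fun l => l + 1).mono_rate (δ' := fun l => strongRate N β (l + 1)) (C := q)
      fun l => hr (l + 1)).comp hfst).psi_sub hS (fun l => ((l + 1 : ℕ) : ℕ∞)) hslot
      (fun l => hpm (l + 1)) (fun _ => hgm') (fun _ _ => rfl) (fun _ _ => rfl)
  have a2 := S.lpO_psi_level hF hgm hgM
  have a3 : LpO (S.drawLaw.prod S.noise) (fun (l : ℕ) x =>
      S.Psi (l : ℕ∞) (S.path (l : ℕ∞) n x.1) x.2
        - S.Psi (l : ℕ∞) (g x.1) x.2) fun l => strongRate N β (l + 1) :=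
    (hfg.comp hfst).psi_sub hS (fun l => (l : ℕ∞)) hslot
      hpm (fun _ => hgm') (fun _ _ => rfl) (fun _ _ => rfl)
  have a4 := ((a1.add_same a2).sub_same a3).congr (f' := fun (l : ℕ) x =>
      S.Psi ((l + 1 : ℕ) : ℕ∞) (S.path ((l + 1 : ℕ) : ℕ∞) n x.1) x.2
        - S.Psi (l : ℕ∞) (S.path (l : ℕ∞) n x.1) x.2) fun l x => by abel
  have hs := S.isSlot_noise n
  have hm : ∀ l : ℕ, AEStronglyMeasurable (fun z => S.pred ((l + 1 : ℕ) : ℕ∞) n z - S.pred l n z)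
      S.drawLaw := fun l =>
    ((S.measurable_pred _ n).sub (S.measurable_pred _ n)).aestronglyMeasurable
  refine ⟨hm, fun p hp => (a4.bound p hp).imp fun C hC l => ?_⟩
  refine le_trans (le_of_eq ?_) (hC l)
  -- Back to the original noise: the states ignore the n-th noise, so replacing it by the fresh one
  -- changes only the argument of the solvers, and the replacement preserves the law.
  rw [← eLpNorm_comp_measurePreserving (hm l) hs.preserving]
  congr 1
  ext1 x
  simp only [Function.comp, Model.pred, S.path_setNoise _ le_rfl]
  simp [setNoise]

theorem Model.lpO_path_sub (S : Model d m Ξ) (hS : LipschitzMoment S)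
    (hF : MultilevelRates S F N cost α β γ) (n : ℕ) :
    LpO S.drawLaw (fun (l : ℕ) z => S.path ((l + 1 : ℕ) : ℕ∞) n z - S.path l n z)
      fun l => strongRate N β (l + 1) := by
  induction n with
  | zero => simpa [Model.path] using LpO.zero
  | succ n ih =>
    -- Gain and perturbation are common to both levels, so only the linear part acts on the
    -- difference.
    refine ((S.lpO_pred_sub_of hS hF n ih).act (1 - S.meanGain n * S.H)).congr fun l z => ?_
    rw [S.path_succ, S.path_succ, S.update_sub, sub_self]
    ext j
    simp [MLEnKF.act]

theorem Model.lpO_pred_sub (S : Model d m Ξ) (hS : LipschitzMoment S)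
    (hF : MultilevelRates S F N cost α β γ) (n : ℕ) :
    LpO S.drawLaw (fun (l : ℕ) z => S.pred ((l + 1 : ℕ) : ℕ∞) n z - S.pred l n z)
      fun l => strongRate N β (l + 1) :=
  S.lpO_pred_sub_of hS hF n (S.lpO_path_sub hS hF n)

end MLEnKF

namespace MLEnKF

/-! ### Sample covariances -/

theorem LpO.mul_sub_mul {T Ω : Type*} [MeasurableSpace Ω] {μ : Measure Ω} {a a' b b' : T → Ω → ℝ}
    {δ : T → ℝ≥0} (ha : LpO μ (fun t x => a t x - a' t x) δ)
    (hb : LpO μ (fun t x => b t x - b' t x) δ) (ha' : LpO μ a' fun _ => 1)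
    (hb' : LpO μ b fun _ => 1) : LpO μ (fun t x => a t x * b t x - a' t x * b' t x) δ := by
  have h1 := (ha.mul hb').mono_rate (δ' := δ) (C := 1) fun t => by simp
  have h2 := (ha'.mul hb).mono_rate (δ' := δ) (C := 1) fun t => by simp
  exact (h1.add_same h2).congr fun t x => by ring

theorem sampleMean_apply {d : ℕ} (M : ℕ) (u : ℕ → E d) (j : Fin d) :
    sampleMean M u j = (M : ℝ)⁻¹ * ∑ i ∈ Finset.range M, u i j := by
  simp [sampleMean]

theorem sampleCov_apply {d : ℕ} (M : ℕ) (u : ℕ → E d) (j k : Fin d) :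
    sampleCov M u j k = (M : ℝ)⁻¹ * ∑ i ∈ Finset.range M, u i j * u i k
      - ((M : ℝ)⁻¹ * ∑ i ∈ Finset.range M, u i j) * ((M : ℝ)⁻¹ * ∑ i ∈ Finset.range M, u i k) := by
  simp only [sampleCov, Matrix.of_apply, sampleMean_apply]

/-- The sample covariance depends continuously on the sample. -/
theorem LpO.sampleCov_sub {T Ω : Type*} [MeasurableSpace Ω] {μ : Measure Ω}
    {d : ℕ} {u v : T → ℕ → Ω → E d} {δ : T → ℝ≥0}
    (huv : LpO μ (fun (a : T × ℕ) x => u a.1 a.2 x - v a.1 a.2 x) fun a => δ a.1)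
    (hu : LpO μ (fun (a : T × ℕ) x => u a.1 a.2 x) fun _ => 1)
    (hv : LpO μ (fun (a : T × ℕ) x => v a.1 a.2 x) fun _ => 1) (M : T → ℕ) (j k : Fin d) :
    LpO μ (fun t x => sampleCov (M t) (fun i => u t i x) j k
      - sampleCov (M t) (fun i => v t i x) j k) δ := by
  have hsub : ∀ j, LpO μ (fun (a : T × ℕ) x => u a.1 a.2 x j - v a.1 a.2 x j) fun a => δ a.1 :=
    fun j => (huv.coord j).congr fun t x => by simp
  have h1 := (LpO.mul_sub_mul (hsub j) (hsub k) (hv.coord j) (hu.coord k)).average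
    (f := fun t i x => u t i x j * u t i x k - v t i x j * v t i x k) M
  have hav : ∀ j, LpO μ (fun t x => (M t : ℝ)⁻¹ * ∑ i ∈ Finset.range (M t), u t i x j
      - (M t : ℝ)⁻¹ * ∑ i ∈ Finset.range (M t), v t i x j) δ := fun j =>
    ((hsub j).average (f := fun t i x => u t i x j - v t i x j) M).congr fun t x => by
      rw [Finset.sum_sub_distrib, mul_sub]
  have h2 := LpO.mul_sub_mul (hav j) (hav k)
    ((hv.coord j).average (f := fun t i x => v t i x j) (δ := fun _ => 1) M)
    ((hu.coord k).average (f := fun t i x => u t i x k) (δ := fun _ => 1) M)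
  refine (h1.sub_same h2).congr fun t x => ?_
  rw [sampleCov_apply, sampleCov_apply, Finset.sum_sub_distrib, mul_sub]
  ring

/-- The covariance of a random vector, in terms of its moments. -/
noncomputable def momentCov {D : Type*} [MeasurableSpace D] {d : ℕ} (ρ : Measure D) (f : D → E d)
    (j k : Fin d) : ℝ :=
  ∫ z, f z j * f z k ∂ρ - (∫ z, f z j ∂ρ) * ∫ z, f z k ∂ρ

/-- The difference of the sample covariances of a pair of independent samples that are coupled
pairwise. -/
theorem LpO.sampleCov_pair {T D ι : Type*} [MeasurableSpace D] {ρ : Measure D}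
    [IsProbabilityMeasure ρ] {d : ℕ} {f g : T → D → E d} {δ : T → ℝ≥0} (hδ : ∀ t, δ t ≤ 1)
    (hf : LpO ρ f fun _ => 1) (hg : LpO ρ g fun _ => 1)
    (hfg : LpO ρ (fun t z => f t z - g t z) δ) (hfm : ∀ t, Measurable (f t))
    (hgm : ∀ t, Measurable (g t)) (M : T → ℕ)
    (hM : ∀ t, 0 < M t) (e : T → ℕ → ι) (he : ∀ t, Function.Injective (e t)) (j k : Fin d) :
    LpO (Measure.infinitePi fun _ : ι => ρ)
      (fun t w => sampleCov (M t) (fun i => f t (w (e t i))) j k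
        - sampleCov (M t) (fun i => g t (w (e t i))) j k
        - (momentCov ρ (f t) j k - momentCov ρ (g t) j k))
      (fun t => δ t * (M t : ℝ≥0) ^ (-(1 / 2) : ℝ)) := by
  set Pm := Measure.infinitePi fun _ : ι => ρ
  have hcm : ∀ (u : T → D → E d), (∀ t, Measurable (u t)) → ∀ j t, Measurable fun z => u t z j :=
    fun u hu j t => (EuclideanSpace.proj (𝕜 := ℝ) j).continuous.measurable.comp (hu t)
  have hmp : ∀ a : T × ℕ, MeasurePreserving (fun w : ι → D => w (e a.1 a.2)) Pm ρ := fun a =>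
    measurePreserving_eval_infinitePi (fun _ => ρ) _
  have hr : ∀ t, δ t * (M t : ℝ≥0) ^ (-(1 / 2) : ℝ) ≤ 1 * (1 * (M t : ℝ≥0) ^ (-(1 / 2) : ℝ)) :=
    fun t => by rw [one_mul]; gcongr; exact hδ t
  have hsub : ∀ j, LpO ρ (fun t z => f t z j - g t z j) δ := fun j =>
    (hfg.coord j).congr fun t z => by simp
  have hprod : LpO ρ (fun t z => f t z j * f t z k - g t z j * g t z k) δ :=
    LpO.mul_sub_mul (hsub j) (hsub k) (hg.coord j) (hf.coord k)
  -- second moments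
  have h1 := hprod.iidAverage (fun t => ((hcm f hfm j t).mul (hcm f hfm k t)).sub
    ((hcm g hgm j t).mul (hcm g hgm k t))) M hM e he
  -- differences of first moments
  have h2 : ∀ j, _ := fun j => (hsub j).iidAverage
    (fun t => (hcm f hfm j t).sub (hcm g hgm j t)) M hM e he
  have hf2 := (hf.coord k).iidAverage (hcm f hfm k) M hM e he
  have hg2 := (hg.coord j).iidAverage (hcm g hgm j) M hM e he
  have hbar : LpO Pm (fun t (w : ι → D) =>
      (M t : ℝ)⁻¹ * ∑ i ∈ Finset.range (M t), f t (w (e t i)) k)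
      fun _ => 1 :=
    (((hf.coord k).reindex (fun a : T × ℕ => a.1)).comp hmp).average
      (f := fun t i (w : ι → D) => f t (w (e t i)) k) (δ := fun _ => 1) M
  have hbarsub : LpO Pm (fun t (w : ι → D) => (M t : ℝ)⁻¹ * ∑ i ∈ Finset.range (M t),
      (f t (w (e t i)) k - g t (w (e t i)) k)) δ :=
    (((hsub k).reindex (fun a : T × ℕ => a.1)).comp hmp).average
      (f := fun t i (w : ι → D) => f t (w (e t i)) k - g t (w (e t i)) k) M
  -- With bars for sample means and D = f - g, the product of means splits as D̄_j f̄_k + ḡ_j D̄_k.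
  -- Centring both products leaves four terms `k1`, …, `k4`; in each, a difference contributes δ and
  -- a centred mean contributes M^{-1/2}, so their product is gained throughout.
  have k1 := ((h2 j).mul hbar).mono_rate (δ' := fun t => δ t * (M t : ℝ≥0) ^ (-(1 / 2) : ℝ))
    (C := 1) fun t => by simp
  have k2 := ((hsub j).integral (ν := Pm)).mul hf2 |>.mono_rate
    (δ' := fun t => δ t * (M t : ℝ≥0) ^ (-(1 / 2) : ℝ)) (C := 1) fun t => by simp
  have k3 := (hg2.mul hbarsub).mono_rate (δ' := fun t => δ t * (M t : ℝ≥0) ^ (-(1 / 2) : ℝ))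
    (C := 1) fun t => le_of_eq (by ring)
  have k4 := (((hg.coord j).integral (ν := Pm)).mul (h2 k)).mono_rate
    (δ' := fun t => δ t * (M t : ℝ≥0) ^ (-(1 / 2) : ℝ)) (C := 1) fun t => by simp
  refine (h1.sub_same ((k1.add_same k2).add_same (k3.add_same k4))).congr fun t w => ?_
  have i1 : ∀ j, Integrable (fun z => f t z j) ρ := fun j => (hf.coord j).integrable t
  have i2 : ∀ j, Integrable (fun z => g t z j) ρ := fun j => (hg.coord j).integrable t
  have i3 : Integrable (fun z => f t z j * f t z k) ρ := by
    have := ((hf.coord j).mul (hf.coord k)).integrable t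
    exact this
  have i4 : Integrable (fun z => g t z j * g t z k) ρ := by
    have := ((hg.coord j).mul (hg.coord k)).integrable t
    exact this
  rw [sampleCov_apply, sampleCov_apply, momentCov, momentCov, integral_sub i3 i4,
    integral_sub (i1 j) (i2 j), integral_sub (i1 k) (i2 k)]
  simp only [Finset.sum_sub_distrib, mul_sub]
  ring

theorem measurable_sampleCov {Ω : Type*} [MeasurableSpace Ω] {d : ℕ} {u : ℕ → Ω → E d}
    (hu : ∀ i, Measurable (u i)) (M : ℕ) (j k : Fin d) :
    Measurable fun x => sampleCov M (fun i => u i x) j k := by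
  have hc : ∀ i j, Measurable fun x => u i x j := fun i j =>
    (EuclideanSpace.proj (𝕜 := ℝ) j).continuous.measurable.comp (hu i)
  simp only [sampleCov_apply]
  exact ((Finset.measurable_sum _ fun i _ => (hc i j).mul (hc i k)).const_mul _).sub
    (((Finset.measurable_sum _ fun i _ => hc i j).const_mul _).mul
      ((Finset.measurable_sum _ fun i _ => hc i k).const_mul _))

theorem multilevelCov_apply {d : ℕ} (L : ℕ) (M : ℕ → ℕ) (u : Ensemble d) (j k : Fin d) :
    multilevelCov L M u j k = ∑ l ∈ Finset.range (L + 1),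
      (sampleCov (M l) (fun i => (u l i).1) j k - sampleCov (M l) (fun i => (u l i).2) j k) := by
  simp [multilevelCov, Matrix.sum_apply]

/-! ### The ensemble as a function of independent draws -/

variable {d m : ℕ} {Ξ : Type*} [MeasurableSpace Ξ]

/-- The law of the randomness of all particles. -/
noncomputable def Model.sampleLaw (S : Model d m Ξ) : Measure (ℕ × ℕ → Draw d m Ξ) :=
  Measure.infinitePi fun _ => S.drawLaw

instance (S : Model d m Ξ) : IsProbabilityMeasure S.sampleLaw := by
  unfold Model.sampleLaw; infer_instance

/-- The updated ensemble as a function of the randomness of all particles. -/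
noncomputable def Model.updated (S : Model d m Ξ) (L : ℕ) (M : ℕ → ℕ) (n : ℕ)
    (w : ℕ × ℕ → Draw d m Ξ) : Ensemble d :=
  S.ensemble L M (fun l i => w (l, i)) n

/-- The predicted ensemble as a function of the randomness of all particles. -/
noncomputable def Model.predicted (S : Model d m Ξ) (L : ℕ) (M : ℕ → ℕ) (n : ℕ)
    (w : ℕ × ℕ → Draw d m Ξ) : Ensemble d :=
  S.predictEnsemble (fun l i => w (l, i)) n (S.updated L M n w)

section Measurability

variable (S : Model d m Ξ) (L : ℕ) (M : ℕ → ℕ)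

theorem Model.measurable_predicted_of (n : ℕ)
    (h : ∀ l i, Measurable fun w => S.updated L M n w l i) (l i : ℕ) :
    Measurable fun w => S.predicted L M n w l i := by
  cases l with
  | zero =>
    exact (S.measurable_pred_of 0 (h 0 i).fst (by fun_prop)).prodMk measurable_const
  | succ k =>
    exact (S.measurable_pred_of _ (h (k + 1) i).fst (by fun_prop)).prodMk
      (S.measurable_pred_of _ (h (k + 1) i).snd (by fun_prop))

theorem Model.measurable_multilevelGain {Ω : Type*} [MeasurableSpace Ω] {v : Ω → Ensemble d}
    (h : ∀ l i, Measurable fun w => v w l i) (a : Fin d) (b : Fin m) :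
    Measurable fun w => S.multilevelGain L M (v w) a b := by
  have hc : ∀ j k, Measurable fun w => multilevelCov L M (v w) j k := fun j k => by
    simp only [multilevelCov_apply]
    exact Finset.measurable_sum _ fun l _ =>
      (measurable_sampleCov (u := fun i w => (v w l i).1) (fun i => (h l i).fst) _ j k).sub
      (measurable_sampleCov (u := fun i w => (v w l i).2) (fun i => (h l i).snd) _ j k)
  exact S.measurable_gain hc (measurable_truncate (fun w => multilevelCov_isHermitian _ _ _) hc) a b

theorem Model.measurable_update_of {Ω : Type*} [MeasurableSpace Ω]
    {K : Ω → Matrix (Fin d) (Fin m) ℝ} (hK : ∀ a b, Measurable fun w => K w a b) (y : E m)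
    {u : Ω → E d} {η : Ω → E m} (hu : Measurable u) (hη : Measurable η) :
    Measurable fun w => S.update (K w) y (u w) (η w) := by
  have h1 : ∀ a b, Measurable fun w => (1 - K w * S.H : Matrix (Fin d) (Fin d) ℝ) a b :=
      fun a b => by
    have := measurable_matrix_mul (A := K) (B := fun _ => S.H) hK (fun _ _ => measurable_const) a b
    exact this.const_sub ((1 : Matrix (Fin d) (Fin d) ℝ) a b)
  exact (measurable_act_of_entries h1 hu).add
    (measurable_act_of_entries hK (measurable_const.add hη))

theorem Model.updated_succ (n : ℕ) (w : ℕ × ℕ → Draw d m Ξ) (l i : ℕ) :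
    S.updated L M (n + 1) w l i =
      (S.update (S.multilevelGain L M (S.predicted L M n w)) (S.obs (n + 1))
          (S.predicted L M n w l i).1 ((w (l, i)).2.2 (n + 1)),
        if l = 0 then 0 else S.update (S.multilevelGain L M (S.predicted L M n w)) (S.obs (n + 1))
          (S.predicted L M n w l i).2 ((w (l, i)).2.2 (n + 1))) := rfl

theorem Model.measurable_updated (n l i : ℕ) :
    Measurable fun w => S.updated L M n w l i := by
  induction n generalizing l i with
  | zero =>
    refine Measurable.prodMk (measurable_fst.comp (measurable_pi_apply (l, i))) ?_
    by_cases hl : l = 0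
    · simp [hl]
    · simp only [hl, if_false]
      fun_prop
  | succ n ih =>
    have hp := S.measurable_predicted_of L M n ih
    have hK := S.measurable_multilevelGain L M hp
    simp only [Model.updated_succ]
    refine (S.measurable_update_of hK _ (hp l i).fst (by fun_prop)).prodMk ?_
    by_cases hl : l = 0
    · simp [hl]
    · simp only [hl, if_false]
      exact S.measurable_update_of hK _ (hp l i).snd (by fun_prop)

theorem Model.measurable_predicted (n l i : ℕ) :
    Measurable fun w => S.predicted L M n w l i :=
  S.measurable_predicted_of L M n (S.measurable_updated L M n) l i

theorem Model.updated_congr {n : ℕ} {w w' : ℕ × ℕ → Draw d m Ξ} (h1 : ∀ q, (w q).1 = (w' q).1)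
    (h2 : ∀ q, ∀ k < n, (w q).2.1 k = (w' q).2.1 k) (h3 : ∀ q, (w q).2.2 = (w' q).2.2) :
    S.updated L M n w = S.updated L M n w' := by
  induction n with
  | zero => ext1 l; ext1 i; simp only [Model.updated, Model.ensemble, h1]
  | succ n ih =>
    have hu := ih fun q k hk => h2 q k (by omega)
    have hp : S.predicted L M n w = S.predicted L M n w' := by
      ext1 l; ext1 i
      cases l <;> simp only [Model.predicted, Model.predictEnsemble, hu,
        h2 _ n (Nat.lt_succ_self n)]
    ext1 l; ext1 i
    simp only [Model.updated_succ, hp, h3]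

/-- The gain couples all particles, but up to time `n` only the noises of earlier intervals have
been used. So the whole ensemble, and in particular particle `q`, is independent of the next noise
of `q`. -/
theorem Model.updated_setNoise (n : ℕ) (q : ℕ × ℕ) (x : (ℕ × ℕ → Draw d m Ξ) × Ξ) :
    S.updated L M n (Function.update x.1 q (setNoise n (x.1 q, x.2))) = S.updated L M n x.1 := by
  refine S.updated_congr L M (fun p => ?_) (fun p k hk => ?_) (fun p => ?_) <;>
  · by_cases hp : p = q
    · subst hp
      simp only [Function.update_self, setNoise]
      try rw [Function.update_of_ne (by omega)]
    · rw [Function.update_of_ne hp]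

theorem Model.updated_zero_snd (n : ℕ) (w : ℕ × ℕ → Draw d m Ξ) (i : ℕ) :
    (S.updated L M n w 0 i).2 = 0 := by
  cases n <;> simp [Model.updated, Model.ensemble]

end Measurability

theorem Model.isSlot_sample (S : Model d m Ξ) (n : ℕ) (q : ℕ × ℕ) :
    IsSlot S.sampleLaw S.noise (fun w => (w q).2.1 n)
      (fun x => Function.update x.1 q (setNoise n (x.1 q, x.2))) :=
  (S.isSlot_noise n).infinitePi q

theorem Model.measurePreserving_draw (S : Model d m Ξ) (q : ℕ × ℕ) :
    MeasurePreserving (fun w : ℕ × ℕ → Draw d m Ξ => w q) S.sampleLaw S.drawLaw :=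
  measurePreserving_eval_infinitePi (fun _ => S.drawLaw) q

end MLEnKF

namespace MLEnKF

variable {d m : ℕ} {Ξ : Type*} [MeasurableSpace Ξ]
  {F : Set (E d → ℝ)} {N : ℕ → ℕ} {cost : ℕ → ℝ≥0} {α β γ : ℝ}

/-! ### The distance between the multilevel and the mean-field ensembles -/

/-- The second components of the pairs: level `l - 1`, or `0` if `l = 0`. -/
def prevLevel {D V : Type*} [Zero V] (f : ℕ → D → V) : ℕ → D → V
  | 0, _ => 0
  | k + 1, z => f k z

theorem measurable_prevLevel {D : Type*} [MeasurableSpace D] {f : ℕ → D → E d}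
    (hf : ∀ l, Measurable (f l)) (l : ℕ) : Measurable (prevLevel f l) := by
  cases l
  · exact measurable_const
  · exact hf _

/-- A sequence of level particles, measurable, bounded in `L^p`, and with the strong rate. -/
structure StrongLevels {D : Type*} [MeasurableSpace D] (ρ : Measure D) (N : ℕ → ℕ) (β : ℝ)
    (f : ℕ → D → E d) : Prop where
  measurable : ∀ l, Measurable (f l)
  bounded : LpO ρ f fun _ => 1
  sub : LpO ρ (fun l z => f l z - prevLevel f l z) (strongRate N β)
  prev : LpO ρ (prevLevel f) fun _ => 1

theorem MultilevelRates.strongRate_le_one {S : Model d m Ξ}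
    (hF : MultilevelRates S F N cost α β γ) (l : ℕ) : strongRate N β l ≤ 1 := by
  have := hF.β_pos
  exact NNReal.rpow_le_one_of_one_le_of_nonpos (by exact_mod_cast hF.N_pos l) (by linarith)

theorem MultilevelRates.strongLevels {S : Model d m Ξ} (hF : MultilevelRates S F N cost α β γ)
    {f : ℕ → Draw d m Ξ → E d} (hm : ∀ l, Measurable (f l)) (h1 : LpO S.drawLaw f fun _ => 1)
    (h2 : LpO S.drawLaw (fun l z => f (l + 1) z - f l z) fun l => strongRate N β (l + 1)) :
    StrongLevels S.drawLaw N β f := by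
  -- On level 0 the difference is the particle itself, which is merely bounded; the rate N_0^{-β/2}
  -- is a positive number, so the constant absorbs it.
  have hpos : strongRate N β 0 ≠ 0 := by
    rw [strongRate]
    exact (NNReal.rpow_pos (by exact_mod_cast hF.N_pos 0)).ne'
  have hsub : LpO S.drawLaw (fun (a : Unit × ℕ) z => f a.2 z - prevLevel f a.2 z)
      (fun a => strongRate N β a.2) :=
    LpO.of_level (T := Unit) (f := fun _ l z => f l z - prevLevel f l z)
      (δ := fun _ l => strongRate N β l)
      (((h1.reindex fun _ => 0).mono_rate (C := (strongRate N β 0)⁻¹) fun _ => by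
        rw [inv_mul_cancel₀ hpos]).congr fun t z => by simp [prevLevel])
      (h2.reindex fun a : Unit × ℕ => a.2)
  have hsub' := hsub.reindex fun l : ℕ => ((), l)
  refine ⟨hm, h1, hsub', ?_⟩
  refine (h1.sub_same (hsub'.mono_rate (δ' := fun _ => 1) (C := 1) fun l => ?_)).congr
    fun l z => by simp
  simpa using hF.strongRate_le_one l

theorem Model.strongLevels_path (S : Model d m Ξ) (hS : LipschitzMoment S)
    (hF : MultilevelRates S F N cost α β γ) (n : ℕ) :
    StrongLevels S.drawLaw N β (fun l : ℕ => S.path l n) :=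
  hF.strongLevels (fun l => S.measurable_path l n) ((S.lpO_path hS n).reindex fun l : ℕ => (l : ℕ∞))
    (S.lpO_path_sub hS hF n)

theorem Model.strongLevels_pred (S : Model d m Ξ) (hS : LipschitzMoment S)
    (hF : MultilevelRates S F N cost α β γ) (n : ℕ) :
    StrongLevels S.drawLaw N β (fun l : ℕ => S.pred l n) :=
  hF.strongLevels (fun l => S.measurable_pred l n) ((S.lpO_pred hS n).reindex fun l : ℕ => (l : ℕ∞))
    (S.lpO_pred_sub hS hF n)

/-- The ensembles `u t` differ from independent copies of the pairs of mean-field particles `f` by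
`O(r)`. -/
structure CloseTo {T : Type*} (S : Model d m Ξ) (u : T → (ℕ × ℕ → Draw d m Ξ) → Ensemble d)
    (f : ℕ → Draw d m Ξ → E d) (r : T → ℝ≥0) : Prop where
  fst : LpO S.sampleLaw (fun (a : (T × ℕ) × ℕ) w =>
    (u a.1.1 w a.1.2 a.2).1 - f a.1.2 (w (a.1.2, a.2))) fun a => r a.1.1
  snd : LpO S.sampleLaw (fun (a : (T × ℕ) × ℕ) w =>
    (u a.1.1 w a.1.2 a.2).2 - prevLevel f a.1.2 (w (a.1.2, a.2))) fun a => r a.1.1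

variable {T : Type*} {S : Model d m Ξ}

/-- Copies of the first components of the mean-field pairs. -/
theorem StrongLevels.lpO_fst {f : ℕ → Draw d m Ξ → E d} (hf : StrongLevels S.drawLaw N β f) :
    LpO S.sampleLaw (fun (a : (T × ℕ) × ℕ) (w : ℕ × ℕ → Draw d m Ξ) =>
      f a.1.2 (w (a.1.2, a.2))) fun _ => 1 :=
  (hf.bounded.reindex fun a : (T × ℕ) × ℕ => a.1.2).comp
    (e := fun (a : (T × ℕ) × ℕ) (w : ℕ × ℕ → Draw d m Ξ) => w (a.1.2, a.2))
      fun _ => S.measurePreserving_draw _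

theorem StrongLevels.lpO_snd {f : ℕ → Draw d m Ξ → E d} (hf : StrongLevels S.drawLaw N β f) :
    LpO S.sampleLaw (fun (a : (T × ℕ) × ℕ) (w : ℕ × ℕ → Draw d m Ξ) =>
      prevLevel f a.1.2 (w (a.1.2, a.2)))
      fun _ => 1 :=
  (hf.prev.reindex fun a : (T × ℕ) × ℕ => a.1.2).comp
    (e := fun (a : (T × ℕ) × ℕ) (w : ℕ × ℕ → Draw d m Ξ) => w (a.1.2, a.2))
      fun _ => S.measurePreserving_draw _

theorem CloseTo.lpO_fst {u : T → (ℕ × ℕ → Draw d m Ξ) → Ensemble d} {f : ℕ → Draw d m Ξ → E d}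
    {r : T → ℝ≥0} (h : CloseTo S u f r) (hf : StrongLevels S.drawLaw N β f) {C : ℝ≥0}
    (hr : ∀ t, r t ≤ C) :
    LpO S.sampleLaw (fun (a : (T × ℕ) × ℕ) w => (u a.1.1 w a.1.2 a.2).1) fun _ => 1 :=
  ((h.fst.mono_rate (δ' := fun _ => 1) (C := C) fun a => by simpa using hr a.1.1).add_same
    hf.lpO_fst).congr fun a w => by simp

theorem CloseTo.lpO_snd {u : T → (ℕ × ℕ → Draw d m Ξ) → Ensemble d} {f : ℕ → Draw d m Ξ → E d}
    {r : T → ℝ≥0} (h : CloseTo S u f r) (hf : StrongLevels S.drawLaw N β f) {C : ℝ≥0}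
    (hr : ∀ t, r t ≤ C) :
    LpO S.sampleLaw (fun (a : (T × ℕ) × ℕ) w => (u a.1.1 w a.1.2 a.2).2) fun _ => 1 :=
  ((h.snd.mono_rate (δ' := fun _ => 1) (C := C) fun a => by simpa using hr a.1.1).add_same
    hf.lpO_snd).congr fun a w => by simp

/-- Prediction. -/
theorem CloseTo.predict (hS : LipschitzMoment S) {L : T → ℕ} {M : T → ℕ → ℕ} {n : ℕ}
    {r : T → ℝ≥0}
    (h : CloseTo S (fun t => S.updated (L t) (M t) n) (fun l => S.path l n) r) :
    CloseTo S (fun t => S.predicted (L t) (M t) n) (fun l => S.pred l n) r := by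
  constructor
  · refine h.fst.psi_sub hS (fun a => (a.1.2 : ℕ∞)) (s := fun a w => (w (a.1.2, a.2)).2.1 n)
      (fun a => S.isSlot_sample n (a.1.2, a.2))
      (fun a => (S.measurable_updated _ _ n _ _).fst)
      (fun a => (S.measurable_path _ n).comp (measurable_pi_apply _)) (fun a x => ?_)
        fun a x => ?_
    · rw [S.updated_setNoise]
    · rw [Function.update_self, S.path_setNoise _ le_rfl]
  · have h0 : LpO S.sampleLaw (fun (a : T × ℕ) w => (S.predicted (L a.1) (M a.1) n w 0 a.2).2
        - prevLevel (fun l : ℕ => S.pred l n) 0 (w (0, a.2))) fun a => r a.1 :=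
      LpO.zero.congr fun a w => by simp [Model.predicted, Model.predictEnsemble, prevLevel]
    have h1 : LpO S.sampleLaw (fun (a : (T × ℕ) × ℕ) w =>
        (S.predicted (L a.1.1) (M a.1.1) n w (a.2 + 1) a.1.2).2
        - prevLevel (fun l : ℕ => S.pred l n) (a.2 + 1) (w (a.2 + 1, a.1.2)))
        fun a => r a.1.1 := by
      refine (h.snd.reindex fun a : (T × ℕ) × ℕ => ((a.1.1, a.2 + 1), a.1.2)).psi_sub hS
        (fun a => (a.2 : ℕ∞)) (s := fun a w => (w (a.2 + 1, a.1.2)).2.1 n)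
        (fun a => S.isSlot_sample n (a.2 + 1, a.1.2))
        (fun a => (S.measurable_updated _ _ n _ _).snd)
        (fun a => (S.measurable_path _ n).comp (measurable_pi_apply _)) (fun a x => ?_)
        fun a x => ?_
      · rw [S.updated_setNoise]
      · simp only [prevLevel, Function.update_self]
        rw [S.path_setNoise _ le_rfl]
    have h2 := LpO.of_level (T := T × ℕ) (f := fun a l w =>
      (S.predicted (L a.1) (M a.1) n w l a.2).2
        - prevLevel (fun l : ℕ => S.pred l n) l (w (l, a.2))) (δ := fun a _ => r a.1) h0 h1
    exact h2.reindex fun a : (T × ℕ) × ℕ => ((a.1.1, a.2), a.1.2)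

/-- The conditions on the numbers of levels and samples, for the accuracy `δ`. -/
structure SampleRates (N : ℕ → ℕ) (α β : ℝ) (L : T → ℕ) (M : T → ℕ → ℕ) (δ : T → ℝ≥0) : Prop where
  M_pos : ∀ t, ∀ l ≤ L t, 0 < M t l
  sum_le : ∃ C : ℝ≥0, ∀ t, ∑ l ∈ Finset.range (L t + 1),
    strongRate N β l * (M t l : ℝ≥0) ^ (-(1 / 2) : ℝ) ≤ C * δ t
  bias_le : ∃ C : ℝ≥0, ∀ t, ((N (L t) : ℝ)) ^ (-α) ≤ C * δ t
  bounded : ∀ k : ℕ, ∃ C : ℝ≥0, ∀ t, ((L t : ℝ≥0) + 1) ^ k * δ t ≤ C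

theorem sum_range_sub_prevLevel {D : Type*} (g : ℕ → D → ℝ) (L : ℕ) (z : D) :
    ∑ l ∈ Finset.range (L + 1), (g l z - prevLevel g l z) = g L z := by
  induction L with
  | zero => simp [prevLevel]
  | succ L ih => rw [Finset.sum_range_succ, ih]; simp [prevLevel]

theorem momentCov_prevLevel {D : Type*} [MeasurableSpace D] (ρ : Measure D) (f : ℕ → D → E d)
    (j k : Fin d) (l : ℕ) : momentCov ρ (prevLevel f l) j k
      = prevLevel (fun l (_ : Unit) => momentCov ρ (f l) j k) l () := by
  cases l
  · simp [prevLevel, momentCov]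
  · rfl

variable {L : T → ℕ} {M : T → ℕ → ℕ} {δ : T → ℝ≥0}

/-- The multilevel sample covariance of a perturbed ensemble. -/
theorem CloseTo.multilevelCov_sub {f : ℕ → Draw d m Ξ → E d}
    (hf : StrongLevels S.drawLaw N β f) {u : T → (ℕ × ℕ → Draw d m Ξ) → Ensemble d}
    {r : T → ℝ≥0} (h : CloseTo S u f r) {C : ℝ≥0} (hr : ∀ t, r t ≤ C) (j k : Fin d) :
    LpO S.sampleLaw (fun t w => multilevelCov (L t) (M t) (u t w) j k
      - multilevelCov (L t) (M t)
          (fun l i => (f l (w (l, i)), prevLevel f l (w (l, i)))) j k)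
      fun t => ((L t : ℝ≥0) + 1) * r t := by
  have h1 := LpO.sampleCov_sub (T := T × ℕ) (u := fun a i w => (u a.1 w a.2 i).1)
    (v := fun a i (w : ℕ × ℕ → Draw d m Ξ) => f a.2 (w (a.2, i))) (δ := fun a => r a.1)
    h.fst (h.lpO_fst hf hr) hf.lpO_fst (fun a => M a.1 a.2) j k
  have h2 := LpO.sampleCov_sub (T := T × ℕ) (u := fun a i w => (u a.1 w a.2 i).2)
    (v := fun a i (w : ℕ × ℕ → Draw d m Ξ) => prevLevel f a.2 (w (a.2, i))) (δ := fun a => r a.1)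
    h.snd (h.lpO_snd hf hr) hf.lpO_snd (fun a => M a.1 a.2) j k
  -- Each of the L + 1 levels contributes an error of order r. This is the factor of order log(1/ε)
  -- lost in every time step.
  have h3 := ((h1.sub_same h2).reindex fun a : {a : T × ℕ // a.2 ≤ L a.1} => a.1).levelSum
    (δ := fun t _ => r t) (f := fun t l w =>
      (sampleCov (M t l) (fun i => (u t w l i).1) j k - sampleCov (M t l)
        (fun i => f l (w (l, i))) j k) - (sampleCov (M t l) (fun i => (u t w l i).2) j k
        - sampleCov (M t l) (fun i => prevLevel f l (w (l, i))) j k))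
  refine (h3.congr fun t w => ?_).mono_rate (C := 1) fun t => ?_
  · rw [multilevelCov_apply, multilevelCov_apply, ← Finset.sum_sub_distrib]
    exact Finset.sum_congr rfl fun l _ => by ring
  · simp

/-- The multilevel sample covariance of independent copies of the mean-field pairs. -/
theorem StrongLevels.multilevelCov_sub (hF : MultilevelRates S F N cost α β γ)
    {f : ℕ → Draw d m Ξ → E d} (hf : StrongLevels S.drawLaw N β f)
    (hR : SampleRates N α β L M δ) (j k : Fin d) :
    LpO S.sampleLaw (fun t (w : ℕ × ℕ → Draw d m Ξ) =>
          multilevelCov (L t) (M t) (fun l i => (f l (w (l, i)), prevLevel f l (w (l, i)))) j k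
        - momentCov S.drawLaw (f (L t)) j k) δ := by
  obtain ⟨C, hC⟩ := hR.sum_le
  have h1 := LpO.sampleCov_pair (T := {a : T × ℕ // a.2 ≤ L a.1}) (ρ := S.drawLaw)
    (f := fun a => f a.1.2) (g := fun a => prevLevel f a.1.2)
    (δ := fun a => strongRate N β a.1.2) (fun a => hF.strongRate_le_one _)
    (hf.bounded.reindex fun a : {a : T × ℕ // a.2 ≤ L a.1} => a.1.2)
    (hf.prev.reindex fun a : {a : T × ℕ // a.2 ≤ L a.1} => a.1.2)
    (hf.sub.reindex fun a : {a : T × ℕ // a.2 ≤ L a.1} => a.1.2) (fun a => hf.measurable _)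
    (fun a => measurable_prevLevel hf.measurable _) (fun a => M a.1.1 a.1.2)
    (fun a => hR.M_pos _ _ a.2) (fun a i => (a.1.2, i)) (fun a i i' h => (Prod.mk.inj h).2) j k
  have h2 := h1.levelSum (f := fun t l (w : ℕ × ℕ → Draw d m Ξ) =>
        sampleCov (M t l) (fun i => f l (w (l, i))) j k
        - sampleCov (M t l) (fun i => prevLevel f l (w (l, i))) j k
        - (momentCov S.drawLaw (f l) j k - momentCov S.drawLaw (prevLevel f l) j k))
    (δ := fun t l => strongRate N β l * (M t l : ℝ≥0) ^ (-(1 / 2) : ℝ))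
  -- The expectations telescope over the levels, leaving the covariance on the finest level.
  have hsum : ∀ t, momentCov S.drawLaw (f (L t)) j k = ∑ l ∈ Finset.range (L t + 1),
      (momentCov S.drawLaw (f l) j k - momentCov S.drawLaw (prevLevel f l) j k) := fun t => by
    simp only [momentCov_prevLevel]
    exact (sum_range_sub_prevLevel (fun l (_ : Unit) => momentCov S.drawLaw (f l) j k)
      (L t) ()).symm
  refine (h2.mono_rate hC).congr fun t w => ?_
  rw [multilevelCov_apply, hsum, ← Finset.sum_sub_distrib]

theorem momentCov_eq_covMatrix {D : Type*} [MeasurableSpace D] {ρ : Measure D}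
    [IsProbabilityMeasure ρ] {f : D → E d} (hf : Measurable f) (h : MemLp f 2 ρ) (j k : Fin d) :
    covMatrix (ρ.map f) j k = momentCov ρ f j k := by
  have hc : ∀ j, MemLp (fun z => f z j) 2 ρ := fun j =>
    h.of_le ((EuclideanSpace.proj (𝕜 := ℝ) j).continuous.comp_aestronglyMeasurable h.1)
      (Filter.Eventually.of_forall fun z => PiLp.norm_apply_le (f z) j)
  have hm : ∀ j : Fin d, Measurable fun x : E d => x j := fun j => by fun_prop
  rw [covMatrix, Matrix.of_apply, covariance_map (hm j).aestronglyMeasurable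
    (hm k).aestronglyMeasurable hf.aemeasurable]
  exact covariance_eq_sub (hc j) (hc k)

/-- Covariances are polynomials in moments of degree at most two, whose monomials belong to `F`; the
weak rate on level L bounds the error of each moment. -/
theorem Model.lpO_bias (hS : LipschitzMoment S) (hF : MultilevelRates S F N cost α β γ)
    (hR : SampleRates N α β L M δ) (n : ℕ) (j k : Fin d) :
    LpO S.sampleLaw (fun t _ => momentCov S.drawLaw (S.pred (L t) n) j k
      - covMatrix (S.predictLaw ⊤ (S.meanFieldLaw n)) j k) δ := by
  obtain ⟨C, hC⟩ := hR.bias_le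
  have hw := S.weakRate_pred hS hF n
  simp only [← S.map_pred] at hw
  have key : ∀ φ ∈ F, Continuous φ → LpO S.sampleLaw (fun t _ =>
      ∫ z, φ (S.pred (L t) n z) ∂S.drawLaw - ∫ z, φ (S.pred ⊤ n z) ∂S.drawLaw) δ := by
    intro φ hφ hφc
    obtain ⟨c, hc⟩ := hw φ hφ
    refine LpO.of_const (C := |c| * C) fun t => ?_
    have h1 := hc (L t)
    rw [integral_map (S.measurable_pred _ n).aemeasurable hφc.aestronglyMeasurable,
      integral_map (S.measurable_pred _ n).aemeasurable hφc.aestronglyMeasurable] at h1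
    rw [Real.norm_eq_abs]
    calc _ ≤ _ := h1
      _ ≤ |c| * (N (L t) : ℝ) ^ (-α) := by gcongr; exact le_abs_self c
      _ ≤ |c| * (C * δ t) := by gcongr; exact hC t
      _ = _ := by ring
  have k1 := key _ (hF.coord_mul_mem j k) (by fun_prop)
  have k2 := key _ (hF.coord_mem j) (by fun_prop)
  have k3 := key _ (hF.coord_mem k) (by fun_prop)
  have b1 : LpO S.sampleLaw (fun (t : T) _ => ∫ z, S.pred (L t) n z k ∂S.drawLaw) fun _ => 1 :=
    (((S.lpO_pred hS n).coord k).reindex fun t => (L t : ℕ∞)).integral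
  have b2 : LpO S.sampleLaw (fun (t : T) _ => ∫ z, S.pred ⊤ n z j ∂S.drawLaw) fun _ => 1 :=
    LpO.const _
  refine (k1.sub_same (LpO.mul_sub_mul k2 k3 b2 b1)).congr fun t w => ?_
  rw [← S.levelLaw_top, ← S.map_pred, momentCov_eq_covMatrix (S.measurable_pred _ n)
    ((S.lpO_pred hS n).memLp (p := 2) le_rfl ⊤)]
  simp only [momentCov]
  ring

theorem covMatrix_posSemidef {ρ : Measure (E d)} [IsProbabilityMeasure ρ] (h : HasAllMoments ρ) :
    (covMatrix ρ).PosSemidef := by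
  have hc : ∀ j, MemLp (fun x : E d => x j) 2 ρ := fun j => by
    have h2 : MemLp (fun x : E d => x) 2 ρ := h 2
    exact h2.of_le (by fun_prop) (Filter.Eventually.of_forall fun z => PiLp.norm_apply_le z j)
  refine Matrix.PosSemidef.of_dotProduct_mulVec_nonneg ?_ fun x => ?_
  · ext j k
    simp [covMatrix, covariance_comm]
  · have h1 : star x ⬝ᵥ (covMatrix ρ).mulVec x
        = covariance (fun z : E d => ∑ j, x j * z j) (fun z => ∑ j, x j * z j) ρ := by
      rw [covariance_fun_sum_fun_sum (fun j => (hc j).const_mul _) (fun j => (hc j).const_mul _)]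
      simp only [covariance_const_mul_left, covariance_const_mul_right, dotProduct, Matrix.mulVec,
        covMatrix, Matrix.of_apply, Finset.mul_sum, star_trivial]
      exact Finset.sum_congr rfl fun i _ => Finset.sum_congr rfl fun j _ => by ring
    rw [h1]
    have hm : Measurable fun z : E d => ∑ j, x j * z j :=
      Finset.measurable_sum _ fun j _ => Measurable.const_mul (by fun_prop) _
    rw [covariance_self hm.aemeasurable]
    exact variance_nonneg _ _

theorem Model.hasAllMoments_predictLaw (hS : LipschitzMoment S) (n : ℕ) :
    HasAllMoments (S.predictLaw ⊤ (S.meanFieldLaw n)) := by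
  rw [← S.levelLaw_top, ← S.map_pred]
  exact hasAllMoments_map (S.lpO_pred hS n) ⊤ (S.measurable_pred ⊤ n)

/-- The error of the multilevel gain. -/
theorem CloseTo.gain_sub (hS : LipschitzMoment S) (hF : MultilevelRates S F N cost α β γ)
    (hR : SampleRates N α β L M δ) {n : ℕ} {r r' : T → ℝ≥0}
    (h : CloseTo S (fun t => S.predicted (L t) (M t) n) (fun l => S.pred l n) r) {C : ℝ≥0}
    (hr : ∀ t, r t ≤ C) (hrr' : ∀ t, ((L t : ℝ≥0) + 1) * r t ≤ r' t) (hδr' : ∀ t, δ t ≤ r' t) :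
    LpO S.sampleLaw (fun t w => absSum
      (S.multilevelGain (L t) (M t) (S.predicted (L t) (M t) n w) - S.meanGain n)) r' := by
  have hf := S.strongLevels_pred hS hF n
  set B := covMatrix (S.predictLaw ⊤ (S.meanFieldLaw n)) with hB
  have hBp : B.PosSemidef := covMatrix_posSemidef (S.hasAllMoments_predictLaw hS n)
  have hentry : ∀ j k, LpO S.sampleLaw (fun t w =>
      multilevelCov (L t) (M t) (S.predicted (L t) (M t) n w) j k - B j k) r' := fun j k => by
    -- Three errors: interacting against mean-field particles, sampling of the mean-field particles,
    -- and bias of the finest level.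
    have h1 := (h.multilevelCov_sub (L := L) (M := M) hf hr j k).mono_rate (δ' := r') (C := 1)
      fun t => by simpa using hrr' t
    have h2 := (hf.multilevelCov_sub hF hR j k).mono_rate (δ' := r') (C := 1)
      fun t => by simpa using hδr' t
    have h3 := (S.lpO_bias hS hF hR n j k).mono_rate (δ' := r') (C := 1)
      fun t => by simpa using hδr' t
    exact ((h1.add_same h2).add_same h3).congr fun t w => by ring
  obtain ⟨c, hc⟩ := S.exists_gain_sub_le hBp
  have hsum : LpO S.sampleLaw (fun t w => absSum
      (multilevelCov (L t) (M t) (S.predicted (L t) (M t) n w) - B)) r' := by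
    unfold absSum
    exact LpO.finsetSum _ fun j _ => LpO.finsetSum _ fun k _ => (hentry j k).norm
  refine hsum.of_norm_le (fun t => ?_) c fun t w => ?_
  · have hm := S.measurable_multilevelGain (L t) (M t)
      (fun l i => S.measurable_predicted (L t) (M t) n l i)
    unfold absSum
    refine (Finset.measurable_sum _ fun a _ =>
      Finset.measurable_sum _ fun b _ => ?_).aestronglyMeasurable
    exact measurable_norm.comp ((hm a b).sub_const (S.meanGain n a b))
  · rw [Real.norm_of_nonneg (absSum_nonneg _), Real.norm_of_nonneg (absSum_nonneg _)]
    exact hc _ (multilevelCov_isHermitian _ _ _)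

/-- The update of a particle with a perturbed gain. -/
theorem LpO.update_sub {A : Type*} {Ω : Type*} [MeasurableSpace Ω] {μ : Measure Ω}
    [IsProbabilityMeasure μ] {u v : A → Ω → E d} {η : A → Ω → E m}
    {K : A → Ω → Matrix (Fin d) (Fin m) ℝ} {K' : Matrix (Fin d) (Fin m) ℝ} {r : A → ℝ≥0} (y : E m)
    (hu : LpO μ u fun _ => 1) (huv : LpO μ (fun a w => u a w - v a w) r)
    (hη : LpO μ η fun _ => 1) (hK : LpO μ (fun a w => absSum (K a w - K')) r)
    (hm : ∀ a, AEStronglyMeasurable (fun w =>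
      S.update (K a w) y (u a w) (η a w) - S.update K' y (v a w) (η a w)) μ) :
    LpO μ (fun a w => S.update (K a w) y (u a w) (η a w) - S.update K' y (v a w) (η a w)) r := by
  have h1 := (huv.act (1 - K' * S.H)).norm
  have h2 := ((LpO.const (μ := μ) (T := A) y).add_same hη).sub_same (hu.act S.H)
  have h3 := (hK.mul h2.norm).mono_rate (δ' := r) (C := 1) fun a => by simp
  refine (h1.add_same h3).of_norm_le hm 1 fun a w => ?_
  rw [S.update_sub, Real.norm_of_nonneg (by have := absSum_nonneg (K a w - K'); positivity),
    NNReal.coe_one, one_mul]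
  exact (norm_add_le _ _).trans (by gcongr; exact norm_act_le _ _)

/-- One step of the multilevel filter. -/
theorem CloseTo.step (hS : LipschitzMoment S) (hF : MultilevelRates S F N cost α β γ)
    (hR : SampleRates N α β L M δ) {n : ℕ} {r r' : T → ℝ≥0}
    (h : CloseTo S (fun t => S.updated (L t) (M t) n) (fun l => S.path l n) r) {C : ℝ≥0}
    (hr : ∀ t, r t ≤ C) (hrr' : ∀ t, ((L t : ℝ≥0) + 1) * r t ≤ r' t) (hδr' : ∀ t, δ t ≤ r' t) :
    CloseTo S (fun t => S.updated (L t) (M t) (n + 1)) (fun l => S.path l (n + 1)) r' := by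
  have hp := h.predict hS
  have hf := S.strongLevels_pred hS hF n
  have hK := (hp.gain_sub hS hF hR hr hrr' hδr')
  have hle : ∀ t, r t ≤ 1 * r' t := fun t => by
    rw [one_mul]
    refine le_trans ?_ (hrr' t)
    exact le_mul_of_one_le_left zero_le (le_add_of_nonneg_left zero_le)
  have hobs : LpO S.sampleLaw (fun (a : (T × ℕ) × ℕ) (w : ℕ × ℕ → Draw d m Ξ) =>
      (w (a.1.2, a.2)).2.2 (n + 1)) fun _ => 1 :=
    (S.lpO_obs (n + 1)).comp (e := fun (a : (T × ℕ) × ℕ) (w : ℕ × ℕ → Draw d m Ξ) => w (a.1.2, a.2))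
      fun _ => S.measurePreserving_draw _
  have hKm := fun t => S.measurable_multilevelGain (L t) (M t)
      (fun l i => S.measurable_predicted (L t) (M t) n l i)
  constructor
  · refine (LpO.update_sub (S := S) (S.obs (n + 1)) (hp.lpO_fst hf hr) (hp.fst.mono_rate
      fun a => hle a.1.1) hobs (hK.reindex fun a : (T × ℕ) × ℕ => a.1.1) fun a => ?_)
    exact ((S.measurable_update_of (hKm a.1.1) _ (S.measurable_predicted _ _ _ _ _).fst
      (by fun_prop)).sub ((S.measurable_update _ _).comp (((S.measurable_pred _ n).comp
      (measurable_pi_apply _)).prodMk (by fun_prop)))).aestronglyMeasurable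
  · have h0 : LpO S.sampleLaw (fun (a : T × ℕ) w => (S.updated (L a.1) (M a.1) (n + 1) w 0 a.2).2
        - prevLevel (fun l : ℕ => S.path l (n + 1)) 0 (w (0, a.2))) fun a => r' a.1 :=
      LpO.zero.congr fun a w => by simp [S.updated_zero_snd, prevLevel]
    have h1 : LpO S.sampleLaw (fun (a : (T × ℕ) × ℕ) w =>
        (S.updated (L a.1.1) (M a.1.1) (n + 1) w (a.2 + 1) a.1.2).2
        - prevLevel (fun l : ℕ => S.path l (n + 1)) (a.2 + 1) (w (a.2 + 1, a.1.2)))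
        fun a => r' a.1.1 := by
      set e : (T × ℕ) × ℕ → (T × ℕ) × ℕ := fun a => ((a.1.1, a.2 + 1), a.1.2)
      refine (LpO.update_sub (S := S) (S.obs (n + 1)) ((hp.lpO_snd hf hr).reindex e)
        ((hp.snd.mono_rate fun a => hle a.1.1).reindex e) (hobs.reindex e)
        (hK.reindex fun a : (T × ℕ) × ℕ => a.1.1) fun a => ?_)
      exact ((S.measurable_update_of (hKm a.1.1) _ (S.measurable_predicted _ _ _ _ _).snd
        (by fun_prop)).sub ((S.measurable_update _ _).comp (((S.measurable_pred _ n).comp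
        (measurable_pi_apply _)).prodMk (by fun_prop)))).aestronglyMeasurable
    have h2 := LpO.of_level (T := T × ℕ) (f := fun a l w =>
      (S.updated (L a.1) (M a.1) (n + 1) w l a.2).2
        - prevLevel (fun l : ℕ => S.path l (n + 1)) l (w (l, a.2))) (δ := fun a _ => r' a.1) h0 h1
    exact h2.reindex fun a : (T × ℕ) × ℕ => ((a.1.1, a.2), a.1.2)

/-- The error of the particles after `n` steps. -/
theorem SampleRates.closeTo (hS : LipschitzMoment S) (hF : MultilevelRates S F N cost α β γ)
    (hR : SampleRates N α β L M δ) (n : ℕ) :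
    CloseTo S (fun t => S.updated (L t) (M t) n) (fun l => S.path l n)
      fun t => ((L t : ℝ≥0) + 1)⁻¹ * (((L t : ℝ≥0) + 1) ^ n * δ t) := by
  have hL : ∀ t, (L t : ℝ≥0) + 1 ≠ 0 := fun t => by positivity
  have hL1 : ∀ t, (1 : ℝ≥0) ≤ (L t : ℝ≥0) + 1 := fun t => le_add_of_nonneg_left zero_le
  -- At time 0 the ensembles coincide, so the factor (L+1)⁻¹ in the rate costs nothing there; it is
  -- used up when the estimator sums over the levels.
  induction n with
  | zero =>
    constructor
    · exact LpO.zero.congr fun a w => by simp [Model.updated, Model.ensemble, Model.path]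
    · refine LpO.zero.congr fun a w => ?_
      rcases a with ⟨⟨t, _ | l⟩, i⟩ <;>
        simp [Model.updated, Model.ensemble, Model.path, prevLevel]
  | succ n ih =>
    obtain ⟨C, hC⟩ := hR.bounded n
    refine ih.step hS hF hR (C := C) (fun t => ?_) (fun t => ?_) (fun t => ?_)
    · exact (mul_le_of_le_one_left zero_le (inv_le_one_of_one_le₀ (hL1 t))).trans (hC t)
    · rw [← mul_assoc, mul_inv_cancel₀ (hL t), pow_succ', mul_assoc, ← mul_assoc _ _ (_ * δ t),
        inv_mul_cancel₀ (hL t)]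
    · rw [pow_succ', mul_assoc, ← mul_assoc, inv_mul_cancel₀ (hL t), one_mul]
      exact le_mul_of_one_le_left zero_le (one_le_pow₀ (hL1 t))

/-! ### The error of the multilevel estimator -/

/-- The multilevel estimator as a sum of differences. -/
theorem empiricalIntegral_eq (L : ℕ) (M : ℕ → ℕ) (u : Ensemble d) (φ : E d → ℝ) :
    empiricalIntegral L M u φ = ∑ l ∈ Finset.range (L + 1), (M l : ℝ)⁻¹ *
      ∑ i ∈ Finset.range (M l), (φ (u l i).1 - if l = 0 then 0 else φ (u l i).2) := rfl

/-- Level 0 is treated apart because the estimator subtracts 0 there, not φ(0). -/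
theorem lpO_increment {φ : E d → ℝ} (hφ : LocallyLipschitzPoly φ)
    {D : Type*} [MeasurableSpace D] {ρ : Measure D} [IsProbabilityMeasure ρ]
    {f : ℕ → D → E d} (hf : StrongLevels ρ N β f) (hN : strongRate N β 0 ≠ 0) :
    LpO ρ (fun l z => φ (f l z) - if l = 0 then 0 else φ (prevLevel f l z)) (strongRate N β) := by
  have h0 : LpO ρ (fun (_ : Unit) z => φ (f 0 z)) fun _ => strongRate N β 0 :=
    (hφ.lpO (hf.bounded.reindex fun _ => 0)).mono_rate (C := (strongRate N β 0)⁻¹) fun _ => by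
      rw [inv_mul_cancel₀ hN]
  have h1 := (hφ.lpO_sub hf.bounded hf.prev hf.sub).reindex fun a : Unit × ℕ => a.2 + 1
  have h2 := LpO.of_level (T := Unit) (f := fun _ l z =>
    φ (f l z) - if l = 0 then 0 else φ (prevLevel f l z)) (δ := fun _ l => strongRate N β l)
    (h0.congr fun t z => by simp) (h1.congr fun t z => by simp)
  exact h2.reindex fun l => ((), l)

/-- The particles are within (L+1)^{n-1} δ of the mean-field ones, and the L + 1 levels raise the
power to n. Sampling error and bias are only of order δ. -/
theorem SampleRates.lpO_empiricalIntegral (hS : LipschitzMoment S)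
    (hF : MultilevelRates S F N cost α β γ) (hR : SampleRates N α β L M δ) (n : ℕ)
    {φ : E d → ℝ} (hφF : φ ∈ F) (hφ : LocallyLipschitzPoly φ) :
    LpO S.sampleLaw (fun t w => empiricalIntegral (L t) (M t) (S.updated (L t) (M t) n w) φ
      - ∫ x, φ x ∂(S.meanFieldLaw n)) fun t => ((L t : ℝ≥0) + 1) ^ n * δ t := by
  have hL1 : ∀ t, (1 : ℝ≥0) ≤ (L t : ℝ≥0) + 1 := fun t => le_add_of_nonneg_left zero_le
  have hδ : ∀ t, δ t ≤ 1 * (((L t : ℝ≥0) + 1) ^ n * δ t) := fun t => by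
    rw [one_mul]
    exact le_mul_of_one_le_left zero_le (one_le_pow₀ (hL1 t))
  have hclose := hR.closeTo hS hF n
  have hf := S.strongLevels_path hS hF n
  set f : ℕ → Draw d m Ξ → E d := fun l => S.path l n with hfdef
  set Φ : ℕ → Draw d m Ξ → ℝ := fun l z => φ (f l z) - if l = 0 then 0 else φ (prevLevel f l z)
    with hΦ
  have hφc := hφ.continuous
  obtain ⟨C, hC⟩ := hR.bounded n
  have hr : ∀ t, ((L t : ℝ≥0) + 1)⁻¹ * (((L t : ℝ≥0) + 1) ^ n * δ t) ≤ C := fun t =>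
    (mul_le_of_le_one_left zero_le (inv_le_one_of_one_le₀ (hL1 t))).trans (hC t)
  -- the particles against the mean-field particles
  have a1 : LpO S.sampleLaw (fun t w => empiricalIntegral (L t) (M t)
      (S.updated (L t) (M t) n w) φ - ∑ l ∈ Finset.range (L t + 1), (M t l : ℝ)⁻¹ *
        ∑ i ∈ Finset.range (M t l), Φ l (w (l, i))) fun t => ((L t : ℝ≥0) + 1) ^ n * δ t := by
    have g1 := hφ.lpO_sub (hclose.lpO_fst hf hr) hf.lpO_fst hclose.fst
    have g2 := hφ.lpO_sub (hclose.lpO_snd hf hr) hf.lpO_snd hclose.snd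
    have g3 : LpO S.sampleLaw (fun (a : (T × ℕ) × ℕ) w => if a.1.2 = 0 then 0 else
        (φ (S.updated (L a.1.1) (M a.1.1) n w a.1.2 a.2).2 -
          φ (prevLevel f a.1.2 (w (a.1.2, a.2)))))
        fun a => ((L a.1.1 : ℝ≥0) + 1)⁻¹ * (((L a.1.1 : ℝ≥0) + 1) ^ n * δ a.1.1) := by
      refine g2.of_norm_le (fun a => ?_) 1 fun a w => ?_
      · by_cases h0 : a.1.2 = 0
        · simpa [h0] using aestronglyMeasurable_const
        · simpa [h0] using g2.aesm a
      · by_cases h0 : a.1.2 = 0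
        · simp [h0]
        · simp [h0]
    have g4 := (g1.sub_same g3).average (T := T × ℕ) (f := fun a i w =>
      (φ (S.updated (L a.1) (M a.1) n w a.2 i).1 - φ (f a.2 (w (a.2, i)))) -
        if a.2 = 0 then 0 else (φ (S.updated (L a.1) (M a.1) n w a.2 i).2 -
          φ (prevLevel f a.2 (w (a.2, i)))))
      (δ := fun a => ((L a.1 : ℝ≥0) + 1)⁻¹ * (((L a.1 : ℝ≥0) + 1) ^ n * δ a.1))
      (fun a => M a.1 a.2)
    have g5 := (g4.reindex fun a : {a : T × ℕ // a.2 ≤ L a.1} => a.1).levelSum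
      (f := fun t l w => (M t l : ℝ)⁻¹ * ∑ i ∈ Finset.range (M t l),
        ((φ (S.updated (L t) (M t) n w l i).1 - φ (f l (w (l, i)))) -
        if l = 0 then 0 else (φ (S.updated (L t) (M t) n w l i).2 -
          φ (prevLevel f l (w (l, i))))))
      (δ := fun t _ => ((L t : ℝ≥0) + 1)⁻¹ * (((L t : ℝ≥0) + 1) ^ n * δ t))
    refine (g5.congr fun t w => ?_).mono_rate (C := 1) fun t => ?_
    · rw [empiricalIntegral_eq, ← Finset.sum_sub_distrib]
      refine Finset.sum_congr rfl fun l _ => ?_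
      rw [← mul_sub, ← Finset.sum_sub_distrib]
      congr 1
      refine Finset.sum_congr rfl fun i _ => ?_
      by_cases h0 : l = 0
      · simp [hΦ, h0]
      · simp only [hΦ, h0, if_false]; ring
    · rw [Finset.sum_const, Finset.card_range, nsmul_eq_mul, ← mul_assoc, Nat.cast_add,
        Nat.cast_one, mul_inv_cancel₀ (by positivity), one_mul]
  -- the sampling error of the mean-field particles
  have hpos : strongRate N β 0 ≠ 0 :=
    (NNReal.rpow_pos (by exact_mod_cast hF.N_pos 0)).ne'
  have hΦ1 := lpO_increment hφ hf hpos
  have hΦm : ∀ l, Measurable (Φ l) := fun l => by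
    refine (hφc.measurable.comp (hf.measurable l)).sub ?_
    by_cases h0 : l = 0
    · simp [h0]
    · simp only [h0, if_false]
      exact hφc.measurable.comp (measurable_prevLevel hf.measurable l)
  obtain ⟨C', hC'⟩ := hR.sum_le
  have a2 : LpO S.sampleLaw (fun t (w : ℕ × ℕ → Draw d m Ξ) =>
        ∑ l ∈ Finset.range (L t + 1), (M t l : ℝ)⁻¹ *
        ∑ i ∈ Finset.range (M t l), Φ l (w (l, i)) - ∫ z, φ (f (L t) z) ∂S.drawLaw) δ := by
    have g1 := (hΦ1.reindex fun a : {a : T × ℕ // a.2 ≤ L a.1} => a.1.2).iidAverage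
      (fun a => hΦm _) (fun a => M a.1.1 a.1.2) (fun a => hR.M_pos _ _ a.2)
      (fun a i => (a.1.2, i)) (fun a i i' h => (Prod.mk.inj h).2)
    have g2 := g1.levelSum (f := fun t l (w : ℕ × ℕ → Draw d m Ξ) =>
        (M t l : ℝ)⁻¹ * ∑ i ∈ Finset.range (M t l),
        Φ l (w (l, i)) - ∫ z, Φ l z ∂S.drawLaw)
      (δ := fun t l => strongRate N β l * (M t l : ℝ≥0) ^ (-(1 / 2) : ℝ))
    refine (g2.mono_rate hC').congr fun t w => ?_
    rw [Finset.sum_sub_distrib]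
    congr 1
    have hint : ∀ l, Integrable (fun z => φ (f l z)) S.drawLaw := fun l =>
      (hφ.lpO hf.bounded).integrable l
    have hstep : ∀ l, ∫ z, Φ l z ∂S.drawLaw = ∫ z, φ (f l z) ∂S.drawLaw
        - prevLevel (fun l (_ : Unit) => ∫ z, φ (f l z) ∂S.drawLaw) l () := by
      intro l
      cases l with
      | zero => simp [hΦ, prevLevel]
      | succ l =>
        simp only [hΦ, prevLevel, Nat.add_eq_zero_iff, one_ne_zero, and_false, if_false]
        exact integral_sub (hint _) (hint _)
    simp only [hstep]
    exact (sum_range_sub_prevLevel (fun l (_ : Unit) => ∫ z, φ (f l z) ∂S.drawLaw) (L t) ()).symm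
  -- the bias
  have a3 : LpO S.sampleLaw (fun t _ => ∫ z, φ (f (L t) z) ∂S.drawLaw
      - ∫ x, φ x ∂(S.meanFieldLaw n)) δ := by
    obtain ⟨C, hC⟩ := hR.bias_le
    obtain ⟨c, hc⟩ := S.weakRate_path hS hF n φ hφF
    refine LpO.of_const (C := |c| * C) fun t => ?_
    have h1 : |∫ x, φ x ∂(S.levelLaw (L t) n) - ∫ x, φ x ∂(S.levelLaw ⊤ n)|
        ≤ c * (N (L t) : ℝ) ^ (-α) := hc (L t)
    rw [S.levelLaw_top, ← S.map_path, integral_map (S.measurable_path _ n).aemeasurable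
      hφc.aestronglyMeasurable] at h1
    rw [Real.norm_eq_abs]
    calc _ ≤ _ := h1
      _ ≤ |c| * (N (L t) : ℝ) ^ (-α) := by gcongr; exact le_abs_self c
      _ ≤ |c| * (C * δ t) := by gcongr; exact hC t
      _ = _ := by ring
  refine ((a1.add_same (a2.mono_rate hδ)).add_same (a3.mono_rate hδ)).congr fun t w => ?_
  ring

end MLEnKF

namespace MLEnKF

/-! ### The choice of the parameters -/

theorem sum_range_le_of_mul_le_succ {a : ℕ → ℝ} {r : ℝ} (hr : 1 < r)
    (h : ∀ l, r * a l ≤ a (l + 1)) (h0 : 0 ≤ a 0) (L : ℕ) :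
    ∑ l ∈ Finset.range (L + 1), a l ≤ r / (r - 1) * a L := by
  have hr' : 0 < r - 1 := by linarith
  suffices (r - 1) * ∑ l ∈ Finset.range (L + 1), a l ≤ r * a L by
    rw [div_mul_eq_mul_div, le_div_iff₀ hr']; linarith
  induction L with
  | zero => simp; nlinarith
  | succ L ih => rw [Finset.sum_range_succ, mul_add]; nlinarith [h L]

theorem sum_range_le_of_succ_le_mul {a : ℕ → ℝ} {q : ℝ} (hq0 : 0 ≤ q) (hq : q < 1)
    (h : ∀ l, a (l + 1) ≤ q * a l) (ha : ∀ l, 0 ≤ a l) (L : ℕ) :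
    ∑ l ∈ Finset.range (L + 1), a l ≤ (1 - q)⁻¹ * a 0 := by
  have hq' : 0 < 1 - q := by linarith
  -- The additional term `q * a L` is what makes the induction close.
  have key : (1 - q) * ∑ l ∈ Finset.range (L + 1), a l + q * a L ≤ a 0 := by
    induction L with
    | zero => simp; nlinarith
    | succ L ih => rw [Finset.sum_range_succ, mul_add]; nlinarith [h L]
  rw [inv_mul_eq_div, le_div_iff₀ hq']
  nlinarith [mul_nonneg hq0 (ha L)]

/-- The size of `∑_{l ≤ L} N_l ^ ((γ - β) / 3)`. -/
noncomputable def levelFactor (N : ℕ → ℕ) (β γ : ℝ) (L : ℕ) : ℝ :=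
  if γ < β then 1 else if β = γ then (L : ℝ) else (N L : ℝ) ^ ((γ - β) / 3)

variable {d m : ℕ} {Ξ : Type*} [MeasurableSpace Ξ] {S : Model d m Ξ} {F : Set (E d → ℝ)}
  {N : ℕ → ℕ} {cost : ℕ → ℝ≥0} {α β γ : ℝ} {c₁ c₂ ε₀ ε : ℝ} {L : ℕ} {M : ℕ → ℕ}

theorem levelFactor_pos (hN : ∀ l, 0 < N l) (hL : 0 < L) : 0 < levelFactor N β γ L := by
  have := hN L
  unfold levelFactor
  split_ifs <;> positivity

theorem MultilevelRates.one_le_N (hF : MultilevelRates S F N cost α β γ) (l : ℕ) :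
    (1 : ℝ) ≤ N l := by exact_mod_cast hF.N_pos l

theorem MultilevelRates.sum_rpow_le_of_pos (hF : MultilevelRates S F N cost α β γ) {s : ℝ}
    (hs : 0 < s) : ∃ C : ℝ, 0 < C ∧ ∀ L,
      ∑ l ∈ Finset.range (L + 1), (N l : ℝ) ^ s ≤ C * (N L : ℝ) ^ s := by
  obtain ⟨b, hb, hN⟩ := hF.N_growth
  have hbs : 1 < b ^ s := Real.one_lt_rpow hb hs
  refine ⟨b ^ s / (b ^ s - 1), div_pos (by linarith) (by linarith), fun L =>
    sum_range_le_of_mul_le_succ hbs (fun l => ?_) (by positivity) L⟩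
  rw [← Real.mul_rpow (by linarith) (by positivity)]
  exact Real.rpow_le_rpow (by positivity) (hN l) hs.le

/-- As N_l grows at least geometrically, the sum is dominated by its first term if γ < β and by its
last if γ > β. -/
theorem MultilevelRates.sum_rpow_le_levelFactor (hF : MultilevelRates S F N cost α β γ) :
    ∃ C : ℝ, 0 < C ∧ ∀ L, 0 < L →
      ∑ l ∈ Finset.range (L + 1), (N l : ℝ) ^ ((γ - β) / 3) ≤ C * levelFactor N β γ L := by
  rcases lt_trichotomy γ β with h | h | h
  · obtain ⟨b, hb, hN⟩ := hF.N_growth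
    have hs : (γ - β) / 3 < 0 := by linarith
    have hbs : b ^ ((γ - β) / 3) < 1 := Real.rpow_lt_one_of_one_lt_of_neg hb hs
    have h0 : 0 ≤ b ^ ((γ - β) / 3) := by positivity
    have hN0 : (0 : ℝ) < N 0 := by linarith [hF.one_le_N 0]
    refine ⟨(1 - b ^ ((γ - β) / 3))⁻¹ * (N 0 : ℝ) ^ ((γ - β) / 3),
      mul_pos (inv_pos.2 (by linarith)) (by positivity), fun L _ => ?_⟩
    rw [levelFactor, if_pos h, mul_one]
    refine sum_range_le_of_succ_le_mul (a := fun l => (N l : ℝ) ^ ((γ - β) / 3)) h0 hbs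
      (fun l => ?_) (fun l => by positivity) L
    rw [← Real.mul_rpow (by linarith) (by positivity)]
    have : (0 : ℝ) < N l := by linarith [hF.one_le_N l]
    exact Real.rpow_le_rpow_of_nonpos (by positivity) (hN l) hs.le
  -- All L + 1 terms equal 1, and L + 1 ≤ 2 L because L ≥ 1.
  · refine ⟨2, two_pos, fun L hL => ?_⟩
    subst h
    have : (1 : ℝ) ≤ L := by exact_mod_cast hL
    simp [levelFactor]
    linarith
  · obtain ⟨C, hC, hsum⟩ := hF.sum_rpow_le_of_pos (s := (γ - β) / 3) (by linarith)
    refine ⟨C, hC, fun L _ => ?_⟩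
    rw [levelFactor, if_neg h.not_gt, if_neg h.ne]
    exact hsum L

/-- This form unites the three cases with g = `levelFactor`. The exponent -(β+2γ)/3 makes both
N_l^{-β/2} M_l^{-1/2} and M_l N_l^γ, before rounding, multiples of N_l^{(γ-β)/3}, with factors (g
N_L^α)^{-1} and (g N_L^α)². -/
theorem sampleSize_eq (hN : ∀ l, 0 < N l) (L l : ℕ) : sampleSize N α β γ L l
    = ⌈(N l : ℝ) ^ (-(β + 2 * γ) / 3) * (levelFactor N β γ L * (N L : ℝ) ^ α) ^ 2⌉₊ := by
  have hNL : (0 : ℝ) < N L := by exact_mod_cast hN L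
  have h2 : ((N L : ℝ) ^ α) ^ 2 = (N L : ℝ) ^ (2 * α) := by
    rw [← Real.rpow_natCast, ← Real.rpow_mul hNL.le]; congr 1; push_cast; ring
  rw [sampleSize, levelFactor, mul_pow, h2]
  congr 2
  split_ifs
  · simp
  · rfl
  · rw [← Real.rpow_natCast ((N L : ℝ) ^ _), ← Real.rpow_mul hNL.le, ← Real.rpow_add hNL]
    congr 1; push_cast; ring

theorem log_inv_pos_of_le (hε : 0 < ε) (hε₀ : ε ≤ ε₀) (hε₀' : ε₀ < 1) :
    0 < Real.log ε₀⁻¹ ∧ Real.log ε₀⁻¹ ≤ Real.log ε⁻¹ := by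
  have h0 : 0 < ε₀ := hε.trans_le hε₀
  exact ⟨Real.log_pos ((one_lt_inv₀ h0).2 hε₀'),
    Real.log_le_log (inv_pos.2 h0) (inv_anti₀ hε hε₀)⟩

theorem abs_log_eq (hε : 0 < ε) (hε' : ε < 1) : |Real.log ε| = Real.log ε⁻¹ := by
  rw [abs_of_neg (Real.log_neg hε hε'), Real.log_inv]

/-! ### Consequences of the relations between ε, L, N_L and M_l. -/

namespace Admissible

theorem L_pos (hA : Admissible N α β γ c₁ c₂ ε L M) (hc₁ : 0 < c₁) (hε : 0 < ε) (hε' : ε < 1) :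
    0 < L := by
  have h := hA.le_L
  have : 0 < c₁ * Real.log ε⁻¹ := mul_pos hc₁ (Real.log_pos ((one_lt_inv₀ hε).2 hε'))
  exact_mod_cast this.trans_le h

theorem le_M_real (hA : Admissible N α β γ c₁ c₂ ε L M) (hN : ∀ l, 0 < N l) (hc₁ : 0 < c₁)
    {l : ℕ} (hl : l ≤ L) :
    c₁ * ((N l : ℝ) ^ (-(β + 2 * γ) / 3) * (levelFactor N β γ L * (N L : ℝ) ^ α) ^ 2) ≤ M l := by
  refine le_trans ?_ (hA.le_M l hl)
  rw [sampleSize_eq hN]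
  exact mul_le_mul_of_nonneg_left (Nat.le_ceil _) hc₁.le

theorem M_le_real (hA : Admissible N α β γ c₁ c₂ ε L M) (hN : ∀ l, 0 < N l) (hc₂ : 0 < c₂)
    {l : ℕ} (hl : l ≤ L) :
    (M l : ℝ) ≤ c₂ * ((N l : ℝ) ^ (-(β + 2 * γ) / 3)
      * (levelFactor N β γ L * (N L : ℝ) ^ α) ^ 2 + 1) := by
  refine (hA.M_le l hl).trans ?_
  rw [sampleSize_eq hN]
  exact mul_le_mul_of_nonneg_left (Nat.ceil_lt_add_one (by positivity)).le hc₂.le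

theorem M_pos (hA : Admissible N α β γ c₁ c₂ ε L M) (hN : ∀ l, 0 < N l) (hc₁ : 0 < c₁)
    (hε : 0 < ε) (hε' : ε < 1) {l : ℕ} (hl : l ≤ L) : 0 < M l := by
  have h := hA.le_M_real hN hc₁ hl
  have h1 := levelFactor_pos (β := β) (γ := γ) hN (hA.L_pos hc₁ hε hε')
  have h2 : (0 : ℝ) < N l := by exact_mod_cast hN l
  have h3 : (0 : ℝ) < N L := by exact_mod_cast hN L
  have : (0 : ℝ) < M l := lt_of_lt_of_le (by positivity) h
  exact_mod_cast this

theorem N_rpow_neg_le (hA : Admissible N α β γ c₁ c₂ ε L M) (hα : 0 < α) (hc₁ : 0 < c₁)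
    (hε : 0 < ε) : (N L : ℝ) ^ (-α) ≤ c₁ ^ (-α) * ε := by
  refine (Real.rpow_le_rpow_of_nonpos (by positivity) hA.le_N (by linarith)).trans_eq ?_
  rw [Real.mul_rpow hc₁.le (by positivity), ← Real.rpow_mul hε.le]
  rw [show -1 / α * -α = 1 by field_simp, Real.rpow_one]

theorem N_rpow_le (hA : Admissible N α β γ c₁ c₂ ε L M) (hc₂ : 0 < c₂) (hε : 0 < ε) {s : ℝ}
    (hs : 0 ≤ s) : (N L : ℝ) ^ s ≤ c₂ ^ s * ε ^ (-(s / α)) := by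
  refine (Real.rpow_le_rpow (by positivity) hA.N_le hs).trans_eq ?_
  rw [Real.mul_rpow hc₂.le (by positivity), ← Real.rpow_mul hε.le]
  congr 2
  ring

theorem strong_le (hA : Admissible N α β γ c₁ c₂ ε L M) (hN : ∀ l, 0 < N l) (hc₁ : 0 < c₁)
    (hε : 0 < ε) (hε' : ε < 1) {l : ℕ} (hl : l ≤ L) :
    (N l : ℝ) ^ (-β / 2) * (M l : ℝ) ^ (-(1 / 2) : ℝ)
      ≤ c₁ ^ (-(1 / 2) : ℝ) * (N l : ℝ) ^ ((γ - β) / 3)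
        * ((levelFactor N β γ L)⁻¹ * (N L : ℝ) ^ (-α)) := by
  have h := hA.le_M_real hN hc₁ hl
  have h1 := levelFactor_pos (β := β) (γ := γ) hN (hA.L_pos hc₁ hε hε')
  have h2 : (0 : ℝ) < N l := by exact_mod_cast hN l
  have h3 : (0 : ℝ) < N L := by exact_mod_cast hN L
  have hM := Real.rpow_le_rpow_of_nonpos (z := -(1 / 2)) (by positivity) h (by norm_num)
  have e : (c₁ * ((N l : ℝ) ^ (-(β + 2 * γ) / 3)
      * (levelFactor N β γ L * (N L : ℝ) ^ α) ^ 2)) ^ (-(1 / 2) : ℝ)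
      = c₁ ^ (-(1 / 2) : ℝ) * ((N l : ℝ) ^ ((β + 2 * γ) / 6)
        * ((levelFactor N β γ L)⁻¹ * (N L : ℝ) ^ (-α))) := by
    rw [Real.mul_rpow hc₁.le (by positivity), Real.mul_rpow (by positivity) (by positivity),
      ← Real.rpow_mul h2.le, ← Real.rpow_natCast (levelFactor N β γ L * _) 2,
      ← Real.rpow_mul (by positivity), show ((2 : ℕ) : ℝ) * -(1 / 2) = -1 by norm_num,
      Real.rpow_neg_one, mul_inv, ← Real.rpow_neg h3.le]
    congr 3
    ring
  rw [e] at hM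
  have e2 : (N l : ℝ) ^ ((γ - β) / 3) = (N l : ℝ) ^ (-β / 2) * (N l : ℝ) ^ ((β + 2 * γ) / 6) := by
    rw [← Real.rpow_add h2]; congr 1; ring
  calc _ ≤ (N l : ℝ) ^ (-β / 2) * _ := mul_le_mul_of_nonneg_left hM (by positivity)
    _ = _ := by rw [e2]; ring

end Admissible

/-- Powers of logarithms are beaten by ε: with ε = e^{-u} and x ≤ c u one has x + 1 ≤ (1 + c)(1 +
u), while (1 + u)^k ≤ k! e^{1+u}. -/
theorem exists_add_one_pow_le {c : ℝ} (hc : 0 < c) (k : ℕ) : ∃ C : ℝ, 0 < C ∧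
    ∀ ε : ℝ, 0 < ε → ε < 1 → ∀ x : ℝ, 0 ≤ x → x ≤ c * Real.log ε⁻¹ → (x + 1) ^ k * ε ≤ C := by
  refine ⟨(1 + c) ^ k * (k.factorial * Real.exp 1), by positivity, fun ε hε hε' x hx hxc => ?_⟩
  set u := Real.log ε⁻¹ with hu
  have hu0 : 0 < u := Real.log_pos ((one_lt_inv₀ hε).2 hε')
  have hεu : ε = Real.exp (-u) := by rw [hu, Real.log_inv, neg_neg, Real.exp_log hε]
  have h1 : (x + 1) ^ k ≤ ((1 + c) * (1 + u)) ^ k := pow_le_pow_left₀ (by linarith) (by nlinarith) k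
  have h2 := Real.pow_div_factorial_le_exp (1 + u) (by linarith) k
  rw [div_le_iff₀ (by positivity)] at h2
  calc (x + 1) ^ k * ε ≤ ((1 + c) ^ k * (Real.exp (1 + u) * k.factorial)) * Real.exp (-u) := by
        rw [hεu]
        refine mul_le_mul_of_nonneg_right (h1.trans ?_) (Real.exp_pos _).le
        rw [mul_pow]
        exact mul_le_mul_of_nonneg_left h2 (by positivity)
    _ = _ := by
        rw [Real.exp_add, Real.exp_neg]
        field_simp

/-- The parameters that are admissible for an accuracy at most `ε₀`. -/
abbrev Parameters (N : ℕ → ℕ) (α β γ c₁ c₂ ε₀ : ℝ) : Type :=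
  {t : ℝ × ℕ × (ℕ → ℕ) // 0 < t.1 ∧ t.1 ≤ ε₀ ∧ Admissible N α β γ c₁ c₂ t.1 t.2.1 t.2.2}

/-- Admissible parameters balance the sampling error and the bias. -/
theorem MultilevelRates.sampleRates (hF : MultilevelRates S F N cost α β γ) (hc₁ : 0 < c₁)
    (hc₂ : 0 < c₂) (hε₀' : ε₀ < 1) :
    SampleRates (T := Parameters N α β γ c₁ c₂ ε₀) N α β (fun t => t.1.2.1) (fun t => t.1.2.2)
      (fun t => t.1.1.toNNReal) := by
  refine ⟨?_, ?_, ?_, fun k => ?_⟩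
  · rintro ⟨⟨ε, L, M⟩, hε, hε₀, hA⟩ l hl
    exact hA.M_pos hF.N_pos hc₁ hε (hε₀.trans_lt hε₀') hl
  · obtain ⟨C, hC, hsum⟩ := hF.sum_rpow_le_levelFactor
    refine ⟨(c₁ ^ (-(1 / 2) : ℝ) * C * c₁ ^ (-α)).toNNReal, ?_⟩
    rintro ⟨⟨ε, L, M⟩, hε, hε₀, hA⟩
    simp only at hε hε₀ hA ⊢
    rw [← NNReal.coe_le_coe]
    push_cast
    rw [Real.coe_toNNReal _ (by positivity), Real.coe_toNNReal _ hε.le]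
    have hL := hA.L_pos hc₁ hε (hε₀.trans_lt hε₀')
    have hg := levelFactor_pos (β := β) (γ := γ) hF.N_pos hL
    calc _ ≤ ∑ l ∈ Finset.range (L + 1), c₁ ^ (-(1 / 2) : ℝ) * (N l : ℝ) ^ ((γ - β) / 3)
          * ((levelFactor N β γ L)⁻¹ * (N L : ℝ) ^ (-α)) := Finset.sum_le_sum fun l hl => by
            rw [strongRate]
            push_cast
            exact hA.strong_le hF.N_pos hc₁ hε (hε₀.trans_lt hε₀')
              (Nat.lt_succ_iff.1 (Finset.mem_range.1 hl))
      _ = c₁ ^ (-(1 / 2) : ℝ) * (∑ l ∈ Finset.range (L + 1), (N l : ℝ) ^ ((γ - β) / 3))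
          * ((levelFactor N β γ L)⁻¹ * (N L : ℝ) ^ (-α)) := by
            rw [Finset.mul_sum, Finset.sum_mul]
      _ ≤ c₁ ^ (-(1 / 2) : ℝ) * (C * levelFactor N β γ L)
          * ((levelFactor N β γ L)⁻¹ * (c₁ ^ (-α) * ε)) := by
            gcongr
            · exact hsum L hL
            · exact hA.N_rpow_neg_le hF.α_pos hc₁ hε
      _ = _ := by field_simp
  · refine ⟨(c₁ ^ (-α)).toNNReal, ?_⟩
    rintro ⟨⟨ε, L, M⟩, hε, hε₀, hA⟩
    simp only at hε hε₀ hA ⊢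
    rw [Real.coe_toNNReal _ (by positivity), Real.coe_toNNReal _ hε.le]
    exact hA.N_rpow_neg_le hF.α_pos hc₁ hε
  · obtain ⟨C, hC, h⟩ := exists_add_one_pow_le hc₂ k
    refine ⟨C.toNNReal, ?_⟩
    rintro ⟨⟨ε, L, M⟩, hε, hε₀, hA⟩
    simp only at hε hε₀ hA ⊢
    rw [← NNReal.coe_le_coe]
    push_cast
    rw [Real.coe_toNNReal _ hC.le, Real.coe_toNNReal _ hε.le]
    exact h ε hε (hε₀.trans_lt hε₀') L (by positivity) hA.L_le

/-- A number of levels of order `|log ε|` contributes powers of `|log ε|` to the error. -/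
theorem exists_levels_pow_le (hc₂ : 0 < c₂) (h0 : 0 < ε₀) (hε₀' : ε₀ < 1) (n : ℕ) :
    ∃ C : ℝ, 0 < C ∧ ∀ (ε : ℝ) (L : ℕ) (M : ℕ → ℕ), 0 < ε → ε ≤ ε₀ →
      Admissible N α β γ c₁ c₂ ε L M → ((L : ℝ) + 1) ^ n ≤ C * |Real.log ε| ^ n := by
  have hu0 : 0 < Real.log ε₀⁻¹ := Real.log_pos ((one_lt_inv₀ h0).2 hε₀')
  -- The second summand absorbs the 1 in L + 1, since log(1/ε) ≥ log(1/ε₀) > 0. Here ε₀ < 1 is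
  -- essential.
  refine ⟨(c₂ + (Real.log ε₀⁻¹)⁻¹) ^ n, by positivity, fun ε L M hε hε₀ hA => ?_⟩
  rw [abs_log_eq hε (hε₀.trans_lt hε₀'), ← mul_pow]
  have h1 := (log_inv_pos_of_le hε hε₀ hε₀').2
  refine pow_le_pow_left₀ (by positivity) ?_ n
  rw [add_mul]
  refine add_le_add hA.L_le ?_
  rw [← div_eq_inv_mul, le_div_iff₀ hu0, one_mul]
  exact h1

/-! ### The cost -/

theorem costRate_nonneg (hε : 0 < ε) : 0 ≤ costRate α β γ ε := by
  unfold costRate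
  split_ifs <;> positivity

/-- The cost of the particles, up to rounding of the sample sizes. -/
theorem MultilevelRates.levelFactor_le_costRate (hF : MultilevelRates S F N cost α β γ)
    (hc₂ : 0 < c₂) (hε₀' : ε₀ < 1) : ∃ C : ℝ, 0 < C ∧
    ∀ (ε : ℝ) (L : ℕ) (M : ℕ → ℕ), 0 < ε → ε ≤ ε₀ → Admissible N α β γ c₁ c₂ ε L M →
      levelFactor N β γ L ^ 3 * (N L : ℝ) ^ (2 * α) ≤ C * costRate α β γ ε := by
  have hα := hF.α_pos
  have hN2 : ∀ (ε : ℝ) (L : ℕ) (M : ℕ → ℕ), 0 < ε → Admissible N α β γ c₁ c₂ ε L M →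
      (N L : ℝ) ^ (2 * α) ≤ c₂ ^ (2 * α) * ε ^ (-2 : ℝ) := fun ε L M hε hA => by
    refine (hA.N_rpow_le hc₂ hε (s := 2 * α) (by positivity)).trans_eq ?_
    rw [mul_div_cancel_right₀ _ hα.ne']
  rcases lt_trichotomy γ β with h | h | h
  · refine ⟨c₂ ^ (2 * α), by positivity, fun ε L M hε hε₀ hA => ?_⟩
    simpa [levelFactor, costRate, h] using hN2 ε L M hε hA
  · refine ⟨c₂ ^ 3 * c₂ ^ (2 * α), by positivity, fun ε L M hε hε₀ hA => ?_⟩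
    have h1 : levelFactor N β γ L = L := by simp [levelFactor, h]
    have h2 : costRate α β γ ε = ε ^ (-2 : ℝ) * Real.log ε⁻¹ ^ 3 := by
      simp [costRate, h, abs_log_eq hε (hε₀.trans_lt hε₀')]
    rw [h1, h2]
    calc (L : ℝ) ^ 3 * (N L : ℝ) ^ (2 * α)
        ≤ (c₂ * Real.log ε⁻¹) ^ 3 * (c₂ ^ (2 * α) * ε ^ (-2 : ℝ)) := by
          refine mul_le_mul (pow_le_pow_left₀ (by positivity) hA.L_le 3) (hN2 ε L M hε hA)
            (by positivity) ?_
          exact pow_nonneg ((Nat.cast_nonneg L).trans hA.L_le) 3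
      _ = _ := by ring
  · refine ⟨c₂ ^ (γ - β) * c₂ ^ (2 * α), by positivity, fun ε L M hε hε₀ hA => ?_⟩
    have h1 : levelFactor N β γ L ^ 3 = (N L : ℝ) ^ (γ - β) := by
      rw [levelFactor, if_neg h.not_gt, if_neg h.ne, ← Real.rpow_natCast,
        ← Real.rpow_mul (by positivity)]
      congr 1; push_cast; ring
    have h2 : costRate α β γ ε = ε ^ (-((γ - β) / α)) * ε ^ (-2 : ℝ) := by
      rw [costRate, if_neg h.not_gt, if_neg h.ne, ← Real.rpow_add hε]
      congr 1; ring
    rw [h1, h2]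
    calc _ ≤ (c₂ ^ (γ - β) * ε ^ (-((γ - β) / α))) * (c₂ ^ (2 * α) * ε ^ (-2 : ℝ)) := by
          gcongr
          · exact hA.N_rpow_le hc₂ hε (by linarith)
          · exact hN2 ε L M hε hA
      _ = _ := by ring

/-- The cost of one particle on the finest level. -/
theorem MultilevelRates.N_rpow_le_costRate (hF : MultilevelRates S F N cost α β γ)
    (hc₂ : 0 < c₂) (h0 : 0 < ε₀) (hε₀' : ε₀ < 1) : ∃ C : ℝ, 0 < C ∧
    ∀ (ε : ℝ) (L : ℕ) (M : ℕ → ℕ), 0 < ε → ε ≤ ε₀ → Admissible N α β γ c₁ c₂ ε L M →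
      (N L : ℝ) ^ γ ≤ C * costRate α β γ ε := by
  have hα := hF.α_pos
  -- This is where α ≥ min(β,γ)/2 enters: for γ ≤ β it gives γ/α ≤ 2, and for γ > β it gives γ/α ≤ 2
  -- + (γ-β)/α.
  have hmin := hF.min_le
  have key : ∀ ε L M, 0 < ε → Admissible N α β γ c₁ c₂ ε L M →
      (N L : ℝ) ^ γ ≤ c₂ ^ γ * ε ^ (-(γ / α)) := fun ε L M hε hA =>
    hA.N_rpow_le hc₂ hε hF.γ_pos.le
  rcases lt_trichotomy γ β with h | h | h
  · refine ⟨c₂ ^ γ, by positivity, fun ε L M hε hε₀ hA => (key ε L M hε hA).trans ?_⟩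
    rw [costRate, if_pos h]
    rw [min_eq_right h.le] at hmin
    refine mul_le_mul_of_nonneg_left
      (Real.rpow_le_rpow_of_exponent_ge hε (hε₀.trans hε₀'.le) ?_) (by positivity)
    rw [neg_le_neg_iff, div_le_iff₀ hα]; linarith
  · have hu0 : 0 < Real.log ε₀⁻¹ := Real.log_pos ((one_lt_inv₀ h0).2 hε₀')
    refine ⟨c₂ ^ γ * (Real.log ε₀⁻¹ ^ 3)⁻¹, by positivity,
      fun ε L M hε hε₀ hA => (key ε L M hε hA).trans ?_⟩
    rw [costRate, if_neg h.not_lt, if_pos h.symm, abs_log_eq hε (hε₀.trans_lt hε₀')]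
    rw [min_eq_right h.le] at hmin
    have h1 : ε ^ (-(γ / α)) ≤ ε ^ (-2 : ℝ) := by
      refine Real.rpow_le_rpow_of_exponent_ge hε (hε₀.trans hε₀'.le) ?_
      rw [neg_le_neg_iff, div_le_iff₀ hα]; linarith
    have h2 : 1 ≤ (Real.log ε₀⁻¹ ^ 3)⁻¹ * Real.log ε⁻¹ ^ 3 := by
      rw [← div_eq_inv_mul, one_le_div (by positivity)]
      exact pow_le_pow_left₀ hu0.le (log_inv_pos_of_le hε hε₀ hε₀').2 3
    calc c₂ ^ γ * ε ^ (-(γ / α)) ≤ c₂ ^ γ * ε ^ (-2 : ℝ) * 1 := by rw [mul_one]; gcongr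
      _ ≤ c₂ ^ γ * ε ^ (-2 : ℝ) * ((Real.log ε₀⁻¹ ^ 3)⁻¹ * Real.log ε⁻¹ ^ 3) := by gcongr
      _ = _ := by ring
  · refine ⟨c₂ ^ γ, by positivity, fun ε L M hε hε₀ hA => (key ε L M hε hA).trans ?_⟩
    rw [costRate, if_neg h.not_gt, if_neg h.ne]
    rw [min_eq_left h.le] at hmin
    refine mul_le_mul_of_nonneg_left
      (Real.rpow_le_rpow_of_exponent_ge hε (hε₀.trans hε₀'.le) ?_) (by positivity)
    rw [neg_le_neg_iff, ← sub_nonneg, show 2 + (γ - β) / α - γ / α = (2 * α - β) / α by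
      field_simp; ring]
    exact div_nonneg (by linarith) hα.le

/-- Rounding adds at most one to the prescribed size, before the constant `c₂`. The unrounded part
costs a multiple of g · (g N_L^α)² = g³ N_L^{2α}; the rounding costs a multiple of ∑ N_l^γ, a
geometric sum of order N_L^γ. -/
theorem MultilevelRates.sum_cost_le (hF : MultilevelRates S F N cost α β γ)
    (hc₁ : 0 < c₁) (hc₂ : 0 < c₂) (h0 : 0 < ε₀) (hε₀' : ε₀ < 1) : ∃ C : ℝ, 0 < C ∧
    ∀ (ε : ℝ) (L : ℕ) (M : ℕ → ℕ), 0 < ε → ε ≤ ε₀ → Admissible N α β γ c₁ c₂ ε L M →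
      ∑ l ∈ Finset.range (L + 1), (M l : ℝ) * (N l : ℝ) ^ γ ≤ C * costRate α β γ ε := by
  obtain ⟨C₁, hC₁, h1⟩ := hF.sum_rpow_le_levelFactor
  obtain ⟨C₂, hC₂, h2⟩ := hF.sum_rpow_le_of_pos hF.γ_pos
  obtain ⟨C₃, hC₃, h3⟩ := hF.levelFactor_le_costRate (c₁ := c₁) hc₂ hε₀'
  obtain ⟨C₄, hC₄, h4⟩ := hF.N_rpow_le_costRate (c₁ := c₁) hc₂ h0 hε₀'
  refine ⟨c₂ * (C₁ * C₃ + C₂ * C₄), by positivity, fun ε L M hε hε₀ hA => ?_⟩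
  have hL := hA.L_pos hc₁ hε (hε₀.trans_lt hε₀')
  have hNL : (0 : ℝ) < N L := by linarith [hF.one_le_N L]
  have hg := levelFactor_pos (β := β) (γ := γ) hF.N_pos hL
  set g := levelFactor N β γ L
  have e2 : ((N L : ℝ) ^ α) ^ 2 = (N L : ℝ) ^ (2 * α) := by
    rw [← Real.rpow_natCast, ← Real.rpow_mul hNL.le]; congr 1; push_cast; ring
  calc ∑ l ∈ Finset.range (L + 1), (M l : ℝ) * (N l : ℝ) ^ γ
      ≤ ∑ l ∈ Finset.range (L + 1), c₂ * (((g * (N L : ℝ) ^ α) ^ 2) * (N l : ℝ) ^ ((γ - β) / 3)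
        + (N l : ℝ) ^ γ) := Finset.sum_le_sum fun l hl => by
        have hNl : (0 : ℝ) < N l := by linarith [hF.one_le_N l]
        have e : (N l : ℝ) ^ ((γ - β) / 3) = (N l : ℝ) ^ (-(β + 2 * γ) / 3) * (N l : ℝ) ^ γ := by
          rw [← Real.rpow_add hNl]; congr 1; ring
        refine (mul_le_mul_of_nonneg_right (hA.M_le_real hF.N_pos hc₂
          (Nat.lt_succ_iff.1 (Finset.mem_range.1 hl))) (by positivity)).trans_eq ?_
        rw [e]; ring
    _ = c₂ * ((g * (N L : ℝ) ^ α) ^ 2 * ∑ l ∈ Finset.range (L + 1), (N l : ℝ) ^ ((γ - β) / 3)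
        + ∑ l ∈ Finset.range (L + 1), (N l : ℝ) ^ γ) := by
        rw [← Finset.mul_sum, Finset.sum_add_distrib, ← Finset.mul_sum]
    _ ≤ c₂ * ((g * (N L : ℝ) ^ α) ^ 2 * (C₁ * g) + C₂ * (N L : ℝ) ^ γ) := by
        gcongr
        · exact h1 L hL
        · exact h2 L
    _ = c₂ * (C₁ * (g ^ 3 * (N L : ℝ) ^ (2 * α)) + C₂ * (N L : ℝ) ^ γ) := by rw [← e2]; ring
    _ ≤ c₂ * (C₁ * (C₃ * costRate α β γ ε) + C₂ * (C₄ * costRate α β γ ε)) := by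
        have h5 := h3 ε L M hε hε₀ hA
        have h6 := h4 ε L M hε hε₀ hA
        exact mul_le_mul_of_nonneg_left (add_le_add (mul_le_mul_of_nonneg_left h5 hC₁.le)
          (mul_le_mul_of_nonneg_left h6 hC₂.le)) hc₂.le
    _ = _ := by ring

theorem MultilevelRates.totalCost_le (hF : MultilevelRates S F N cost α β γ)
    (hc₁ : 0 < c₁) (hc₂ : 0 < c₂) (h0 : 0 < ε₀) (hε₀' : ε₀ < 1) (pairCost gainCost : ℝ≥0)
    (n : ℕ) : ∃ C : ℝ, 0 < C ∧
    ∀ (ε : ℝ) (L : ℕ) (M : ℕ → ℕ), 0 < ε → ε ≤ ε₀ → Admissible N α β γ c₁ c₂ ε L M →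
      (totalCost cost pairCost gainCost n L M : ℝ) ≤ C * costRate α β γ ε := by
  obtain ⟨c, hc⟩ := hF.cost_le
  obtain ⟨C₁, hC₁, h1⟩ := hF.sum_cost_le (c₁ := c₁) hc₁ hc₂ h0 hε₀'
  obtain ⟨C₂, hC₂, h2⟩ := hF.N_rpow_le_costRate (c₁ := c₁) hc₂ h0 hε₀'
  have hcost : ∀ l, (cost l : ℝ) ≤ |c| * (N l : ℝ) ^ γ := fun l =>
    (hc l).trans (mul_le_mul_of_nonneg_right (le_abs_self c) (by positivity))
  have hmono : Monotone N := monotone_nat_of_le_succ fun l => by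
    obtain ⟨b, hb, hN⟩ := hF.N_growth
    have h3 := hN l
    have h4 := hF.one_le_N l
    have : (N l : ℝ) ≤ N (l + 1) := by nlinarith
    exact_mod_cast this
  have hprev : ∀ l, ((if l = 0 then 0 else cost (l - 1) : ℝ≥0) : ℝ) ≤ |c| * (N l : ℝ) ^ γ := by
    intro l
    split_ifs
    · simp; positivity
    · refine (hcost (l - 1)).trans ?_
      gcongr
      · exact hF.γ_pos.le
      · exact hmono (Nat.sub_le l 1)
  have hone : ∀ l, 1 ≤ (N l : ℝ) ^ γ := fun l => Real.one_le_rpow (hF.one_le_N l) hF.γ_pos.le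
  -- Since N_l^γ ≥ 1, the fixed costs are absorbed into the solver costs; n + 1 in place of n and
  -- the summand 1 keep the constant positive.
  refine ⟨(n + 1) * ((2 * |c| + pairCost + 1) * C₁ + gainCost * C₂), by positivity,
    fun ε L M hε hε₀ hA => ?_⟩
  have hR := costRate_nonneg (α := α) (β := β) (γ := γ) hε
  have hsum : ∑ l ∈ Finset.range (L + 1), (M l : ℝ)
      * (cost l + ((if l = 0 then 0 else cost (l - 1) : ℝ≥0) : ℝ) + pairCost)
      ≤ (2 * |c| + pairCost + 1) * (C₁ * costRate α β γ ε) := by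
    refine le_trans (Finset.sum_le_sum fun l _ => ?_) ((Finset.mul_sum _ _ _).symm.le.trans
      (mul_le_mul_of_nonneg_left (h1 ε L M hε hε₀ hA) (by positivity)))
    have h5 : (pairCost : ℝ) ≤ pairCost * (N l : ℝ) ^ γ :=
      le_mul_of_one_le_right pairCost.2 (hone l)
    have h6 : cost l + ((if l = 0 then 0 else cost (l - 1) : ℝ≥0) : ℝ) + pairCost
        ≤ (2 * |c| + pairCost + 1) * (N l : ℝ) ^ γ := by
      linarith [hcost l, hprev l, hone l]
    calc _ ≤ (M l : ℝ) * ((2 * |c| + pairCost + 1) * (N l : ℝ) ^ γ) := by gcongr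
      _ = _ := by ring
  have hgain : (gainCost : ℝ) ≤ gainCost * (C₂ * costRate α β γ ε) :=
    le_mul_of_one_le_right gainCost.2 ((hone L).trans (h2 ε L M hε hε₀ hA))
  rw [totalCost, Finset.sum_const, Finset.card_range, nsmul_eq_mul]
  push_cast
  have h7 := add_le_add hsum hgain
  calc _ ≤ (n : ℝ) * ((2 * |c| + pairCost + 1) * (C₁ * costRate α β γ ε)
        + gainCost * (C₂ * costRate α β γ ε)) := by gcongr
    _ ≤ ((n : ℝ) + 1) * ((2 * |c| + pairCost + 1) * (C₁ * costRate α β γ ε)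
        + gainCost * (C₂ * costRate α β γ ε)) := by
        refine mul_le_mul_of_nonneg_right (by linarith) (by positivity)
    _ = _ := by ring

end MLEnKF

namespace MLEnKF

/-! ### Gaussian laws -/

section Gaussian

variable {d k : ℕ}

theorem inner_act (B : Matrix (Fin k) (Fin d) ℝ) (x : E d) (t : E k) :
    inner ℝ (act B x) t = inner ℝ x (act B.transpose t) := by
  simp only [act, EuclideanSpace.inner_eq_star_dotProduct, star_trivial]
  rw [Matrix.dotProduct_mulVec, Matrix.mulVec_transpose]

theorem act_add_left (A B : Matrix (Fin k) (Fin d) ℝ) (x : E d) :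
    act (A + B) x = act A x + act B x := by
  ext a; simp [act, Matrix.add_mulVec]

theorem act_smul (A : Matrix (Fin k) (Fin d) ℝ) (c : ℝ) (x : E d) :
    act A (c • x) = c • act A x := by
  ext a; simp [act, Matrix.mulVec_smul]

theorem charFun_gaussian {C : Matrix (Fin d) (Fin d) ℝ} (hC : C.PosSemidef) (a t : E d) :
    charFun (multivariateGaussian a C) t
      = Complex.exp ((inner ℝ t a : ℝ) * Complex.I - (inner ℝ t (act C t) : ℝ) / 2) := by
  rw [charFun_multivariateGaussian hC]
  congr 3
  simp only [act, EuclideanSpace.inner_eq_star_dotProduct, star_trivial]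
  rw [dotProduct_comm]

theorem charFun_map_act (ρ : Measure (E d)) (B : Matrix (Fin k) (Fin d) ℝ) (t : E k) :
    charFun (ρ.map (act B)) t = charFun ρ (act B.transpose t) := by
  rw [charFun_apply, integral_map (by fun_prop) (by fun_prop), charFun_apply]
  simp only [inner_act]

/-- Characteristic functions are used instead of densities, so that singular covariances and
non-square `B` are covered. -/
theorem map_act_gaussian {C : Matrix (Fin d) (Fin d) ℝ} (hC : C.PosSemidef) (a : E d)
    (B : Matrix (Fin k) (Fin d) ℝ) (c : E k) :
    (multivariateGaussian a C).map (fun x => act B x + c)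
      = multivariateGaussian (act B a + c) (B * C * B.transpose) := by
  have h : (B * C * B.transpose).PosSemidef := by
    simpa using hC.mul_mul_conjTranspose_same B
  have hm : Measurable (fun x : E k => x + c) := by fun_prop
  have : IsProbabilityMeasure ((multivariateGaussian a C).map (act B)) :=
    Measure.isProbabilityMeasure_map (by fun_prop)
  have e : (multivariateGaussian a C).map (fun x => act B x + c)
      = ((multivariateGaussian a C).map (act B)).map (fun x => x + c) := by
    rw [Measure.map_map hm (measurable_act B)]; rfl
  have : IsProbabilityMeasure (((multivariateGaussian a C).map (act B)).map (fun x => x + c)) :=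
    Measure.isProbabilityMeasure_map (by fun_prop)
  rw [e]
  refine Measure.ext_of_charFun (funext fun t => ?_)
  rw [charFun_map_add_const, charFun_map_act, charFun_gaussian hC, charFun_gaussian h,
    ← Complex.exp_add]
  congr 1
  have h1 : ∀ (u : E k) (v : E d), inner ℝ (act B.transpose u) v = inner ℝ u (act B v) :=
    fun u v => by rw [inner_act, Matrix.transpose_transpose]
  rw [← act_act, ← act_act, h1, h1, inner_add_right, real_inner_comm t c]
  push_cast
  ring

theorem map_add_gaussian {C R : Matrix (Fin d) (Fin d) ℝ} (hC : C.PosSemidef) (hR : R.PosSemidef)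
    (a b : E d) :
    ((multivariateGaussian a C).prod (multivariateGaussian b R)).map (fun z => z.1 + z.2)
      = multivariateGaussian (a + b) (C + R) := by
  change (multivariateGaussian a C) ∗ (multivariateGaussian b R) = _
  refine Measure.ext_of_charFun (funext fun t => ?_)
  rw [charFun_conv, charFun_gaussian hC, charFun_gaussian hR, charFun_gaussian (hC.add hR),
    ← Complex.exp_add, act_add_left, inner_add_right, inner_add_right]
  congr 1
  push_cast
  ring

/-! ### Gaussian densities -/

/-- Tilting normalizes its result. This and the next two lemmas let Gaussian densities and Bayes'
formula be handled without any normalizing constant. -/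
theorem smul_tilted {X : Type*} [MeasurableSpace X] (μ : Measure X) {c : ℝ≥0∞} (hc : c ≠ 0)
    (hc' : c ≠ ⊤) (f : X → ℝ) : (c • μ).tilted f = μ.tilted f := by
  rw [Measure.tilted, Measure.tilted, integral_smul_measure, withDensity_smul_measure,
    ← withDensity_smul' _ _ hc']
  congr 1
  ext x
  have h : 0 < c.toReal := ENNReal.toReal_pos hc hc'
  rw [Pi.smul_apply, smul_eq_mul, smul_eq_mul, ← ENNReal.ofReal_toReal hc',
    ← ENNReal.ofReal_mul h.le, ENNReal.ofReal_toReal hc']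
  congr 1
  field_simp

theorem map_tilted {X Y : Type*} [MeasurableSpace X] [MeasurableSpace Y] (μ : Measure X)
    (e : X ≃ᵐ Y) (f : X → ℝ) : (μ.tilted f).map e = (μ.map e).tilted (f ∘ e.symm) := by
  ext s hs
  rw [Measure.map_apply e.measurable hs, tilted_apply' _ _ (e.measurable hs), tilted_apply' _ _ hs,
    e.restrict_map, lintegral_map_equiv, integral_map_equiv]
  simp

theorem tilted_add_const {X : Type*} [MeasurableSpace X] (μ : Measure X) (f : X → ℝ) (c : ℝ) :
    μ.tilted (fun x => f x + c) = μ.tilted f := by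
  rw [Measure.tilted, Measure.tilted]
  congr 1
  ext x
  congr 1
  simp only [Real.exp_add, integral_mul_const]
  field_simp

/-- Both laws have the same characteristic function: that of the tilted measure is the quotient of
two Gaussian Fourier integrals, in which the common prefactor cancels. -/
theorem stdGaussian_eq_tilted :
    stdGaussian (E d) = (volume : Measure (E d)).tilted (fun x => -(1 / 2) * ‖x‖ ^ 2) := by
  have hint : Integrable (fun x : E d => Real.exp (-(1 / 2) * ‖x‖ ^ 2)) := by
    by_contra h
    have h1 := GaussianFourier.integral_rexp_neg_mul_sq_norm (V := E d) (b := 1 / 2) (by norm_num)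
    rw [integral_undef h] at h1
    exact (Real.rpow_pos_of_pos (by positivity) _).ne h1
  have := isProbabilityMeasure_tilted hint
  refine Measure.ext_of_charFun (funext fun t => ?_)
  set Z := ∫ x : E d, Real.exp (-(1 / 2) * ‖x‖ ^ 2) with hZ
  have hZpos : 0 < Z := integral_exp_pos hint
  have hb : 0 < (1 / 2 : ℂ).re := by norm_num
  have h0 := GaussianFourier.integral_cexp_neg_mul_sq_norm_add (V := E d) hb 0 0
  have h1 := GaussianFourier.integral_cexp_neg_mul_sq_norm_add (V := E d) hb Complex.I t
  have hZ' : (Z : ℂ) = ∫ x : E d,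
      Complex.exp (-(1 / 2) * ‖x‖ ^ 2 + 0 * (inner ℝ (0 : E d) x : ℝ)) := by
    rw [hZ, ← integral_complex_ofReal]
    congr 1
    ext x
    push_cast
    simp
  rw [← hZ'] at h0
  rw [charFun_stdGaussian, charFun_apply, integral_tilted]
  have h2 : ∀ x : E d, (Real.exp (-(1 / 2) * ‖x‖ ^ 2) / Z)
        • Complex.exp ((inner ℝ x t : ℝ) * Complex.I)
      = (Z : ℂ)⁻¹ * Complex.exp (-(1 / 2) * ‖x‖ ^ 2 + Complex.I * (inner ℝ t x : ℝ)) := fun x => by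
    rw [Complex.exp_add, Complex.real_smul, real_inner_comm]
    push_cast
    ring_nf
  simp only [← hZ, h2, integral_const_mul]
  rw [h1]
  have hZ0 : (Z : ℂ) ≠ 0 := by exact_mod_cast hZpos.ne'
  have h3 : Complex.exp (0 ^ 2 * (‖(0 : E d)‖ : ℂ) ^ 2 / (4 * (1 / 2))) = 1 := by simp
  rw [h3, mul_one] at h0
  rw [← h0, inv_mul_cancel_left₀ hZ0]
  congr 1
  rw [Complex.I_sq]
  ring

/-- The measurable equivalence `x ↦ R x + a` for an invertible matrix `R`. -/
noncomputable def affineEquiv (R : Matrix (Fin d) (Fin d) ℝ) (hR : IsUnit R.det) (a : E d) :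
    E d ≃ᵐ E d where
  toFun x := act R x + a
  invFun x := act R⁻¹ (x - a)
  left_inv x := by simp [act_act, Matrix.nonsing_inv_mul R hR, act_one]
  right_inv x := by simp [act_act, Matrix.mul_nonsing_inv R hR, act_one]
  measurable_toFun := by
    change Measurable fun x => act R x + a
    fun_prop
  measurable_invFun := by
    change Measurable fun x => act R⁻¹ (x - a)
    exact (measurable_act _).comp (measurable_id.sub_const a)

theorem exists_map_affineEquiv (R : Matrix (Fin d) (Fin d) ℝ) (hR : IsUnit R.det) (a : E d) :
    ∃ c : ℝ≥0∞, c ≠ 0 ∧ c ≠ ⊤ ∧ (volume : Measure (E d)).map (affineEquiv R hR a) = c • volume := by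
  let f : E d ≃ₗ[ℝ] E d :=
    { toFun := act R
      invFun := act R⁻¹
      map_add' := act_add R
      map_smul' := act_smul R
      left_inv := fun x => by simp [act_act, Matrix.nonsing_inv_mul R hR, act_one]
      right_inv := fun x => by simp [act_act, Matrix.mul_nonsing_inv R hR, act_one] }
  have hf : LinearMap.det (f : E d →ₗ[ℝ] E d) ≠ 0 := f.isUnit_det'.ne_zero
  have h1 := Measure.map_linearMap_addHaar_eq_smul_addHaar (volume : Measure (E d)) hf
  refine ⟨ENNReal.ofReal |(LinearMap.det (f : E d →ₗ[ℝ] E d))⁻¹|, ?_, ENNReal.ofReal_ne_top, ?_⟩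
  · simpa using hf
  · have e : (affineEquiv R hR a : E d → E d) = (fun x => x + a) ∘ (f : E d →ₗ[ℝ] E d) := rfl
    have hfm : Measurable (f : E d →ₗ[ℝ] E d) := measurable_act R
    rw [e, ← Measure.map_map (measurable_add_const a) hfm, h1, Measure.map_smul,
      map_add_right_eq_self]

open scoped MatrixOrder in
theorem gaussian_eq_tilted {C : Matrix (Fin d) (Fin d) ℝ} (hC : C.PosDef) (a : E d) :
    multivariateGaussian a C = (volume : Measure (E d)).tilted
      (fun x => -(1 / 2) * inner ℝ (x - a) (act C⁻¹ (x - a))) := by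
  -- Factor C = BᵀB with B invertible. The law is then the image of the standard Gaussian under x ↦
  -- Bᵀx + a, and the constant Jacobian disappears in the tilting.
  obtain ⟨B, hB⟩ := CStarAlgebra.nonneg_iff_eq_star_mul_self.1 hC.posSemidef.nonneg
  rw [Matrix.star_eq_conjTranspose, Matrix.conjTranspose_eq_transpose_of_trivial] at hB
  have hdet : IsUnit B.transpose.det := by
    rw [Matrix.det_transpose, isUnit_iff_ne_zero]
    intro h
    have := hC.det_pos
    rw [hB, Matrix.det_mul, h, mul_zero] at this
    exact this.false
  have h1 := map_act_gaussian (Matrix.PosSemidef.one (n := Fin d) (R := ℝ)) 0 B.transpose a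
  have h0 : act B.transpose 0 = 0 := by simpa using act_smul B.transpose 0 0
  rw [h0, zero_add, mul_one, Matrix.transpose_transpose, ← hB, multivariateGaussian_zero_one,
    stdGaussian_eq_tilted] at h1
  obtain ⟨c, hc, hc', hcv⟩ := exists_map_affineEquiv B.transpose hdet a
  have h2 := map_tilted volume (affineEquiv B.transpose hdet a) (fun x : E d => -(1 / 2) * ‖x‖ ^ 2)
  rw [hcv, smul_tilted _ hc hc'] at h2
  rw [← h1]
  refine h2.trans ?_
  congr 1
  ext x
  have e : (affineEquiv B.transpose hdet a).symm x = act B.transpose⁻¹ (x - a) := rfl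
  rw [Function.comp_apply, e, ← real_inner_self_eq_norm_sq, inner_act, act_act, hB,
    Matrix.mul_inv_rev, Matrix.transpose_nonsing_inv, Matrix.transpose_transpose]

/-- If the density were not integrable, the tilted measure would be zero by convention, yet it
equals a probability measure. -/
theorem integrable_exp_gaussian {C : Matrix (Fin d) (Fin d) ℝ} (hC : C.PosDef) (a : E d) :
    Integrable fun x : E d => Real.exp (-(1 / 2) * inner ℝ (x - a) (act C⁻¹ (x - a))) := by
  by_contra h
  have h1 := gaussian_eq_tilted hC a
  rw [tilted_of_not_integrable h] at h1
  exact IsProbabilityMeasure.ne_zero _ h1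

end Gaussian

/-! ### The Kalman filter -/

section Kalman

variable {d m : ℕ} {Ξ : Type*} [MeasurableSpace Ξ] {S : Model d m Ξ}

theorem covMatrix_gaussian {C : Matrix (Fin d) (Fin d) ℝ} (hC : C.PosSemidef) (a : E d) :
    covMatrix (multivariateGaussian a C) = C := by
  ext j k
  exact covariance_eval_multivariateGaussian hC j k

/-- Integrating first over the noise, by Fubini, uses only the conditional law of Ψ(x); what remains
is the characteristic function of N(a, C) at Aᵀt times a factor independent of x. -/
theorem Model.predictLaw_gaussian {A Q C : Matrix (Fin d) (Fin d) ℝ} (hQ : Q.PosSemidef)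
    (hC : C.PosSemidef)
    (hPsi : ∀ x, S.noise.map (S.Psi ⊤ x) = multivariateGaussian (act A x) Q) (a : E d) :
    S.predictLaw ⊤ (multivariateGaussian a C)
      = multivariateGaussian (act A a) (A * C * A.transpose + Q) := by
  have hACA : (A * C * A.transpose).PosSemidef := by
    simpa using hC.mul_mul_conjTranspose_same A
  have hm := S.measurable_Psi ⊤
  refine Measure.ext_of_charFun (funext fun t => ?_)
  have hint : Integrable (fun z : E d × Ξ => Complex.exp ((inner ℝ (S.Psi ⊤ z.1 z.2) t : ℝ)
      * Complex.I)) ((multivariateGaussian a C).prod S.noise) := by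
    refine Integrable.of_bound (C := 1) (Measurable.aestronglyMeasurable ?_)
      (Filter.Eventually.of_forall fun z => (Complex.norm_exp_ofReal_mul_I _).le)
    have : Measurable fun z : E d × Ξ => inner ℝ (S.Psi ⊤ z.1 z.2) t := hm.inner_const
    fun_prop
  have h1 : ∀ x, ∫ ξ, Complex.exp ((inner ℝ (S.Psi ⊤ x ξ) t : ℝ) * Complex.I) ∂S.noise
      = Complex.exp ((inner ℝ x (act A.transpose t) : ℝ) * Complex.I)
        * Complex.exp (-((inner ℝ t (act Q t) : ℝ) / 2)) := fun x => by
    have hx : Measurable (S.Psi ⊤ x) := hm.comp measurable_prodMk_left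
    rw [← inner_act, ← Complex.exp_add, real_inner_comm, ← sub_eq_add_neg, ← charFun_gaussian hQ,
      ← hPsi x, charFun_apply, integral_map hx.aemeasurable (by fun_prop)]
  rw [Model.predictLaw, charFun_apply, integral_map hm.aemeasurable (by fun_prop),
    integral_prod _ hint]
  simp only [h1, integral_mul_const]
  rw [← charFun_apply, charFun_gaussian hC, charFun_gaussian (hACA.add hQ), ← Complex.exp_add,
    act_add_left, inner_add_right, inner_act, Matrix.transpose_transpose, ← act_act, ← act_act,
    inner_act A.transpose, Matrix.transpose_transpose]
  push_cast
  congr 1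
  ring

theorem Model.updateLaw_gaussian (S : Model d m Ξ) {C : Matrix (Fin d) (Fin d) ℝ}
    (hC : C.PosSemidef) (K : Matrix (Fin d) (Fin m) ℝ) (y : E m) (a : E d) :
    S.updateLaw K y (multivariateGaussian a C)
      = multivariateGaussian (act (1 - K * S.H) a + act K y)
        ((1 - K * S.H) * C * (1 - K * S.H).transpose + K * S.Γ * K.transpose) := by
  have hΓ := S.posDef_Γ.posSemidef
  have e : (fun z : E d × E m => S.update K y z.1 z.2) = (fun z : E d × E d => z.1 + z.2) ∘
      Prod.map (fun x => act (1 - K * S.H) x + 0) (fun η => act K η + act K y) := by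
    ext1 z
    simp [Model.update, act_add, add_comm]
  have h0 : act K (0 : E m) = 0 := by simpa using act_smul K 0 0
  rw [Model.updateLaw, e, ← Measure.map_map (by fun_prop) (by fun_prop),
    ← Measure.map_prod_map _ _ (by fun_prop) (by fun_prop), map_act_gaussian hC,
    map_act_gaussian hΓ, map_add_gaussian, h0, zero_add, add_zero]
  · have h := hC.mul_mul_conjTranspose_same (1 - K * S.H)
    rwa [Matrix.conjTranspose_eq_transpose_of_trivial] at h
  · simpa using hΓ.mul_mul_conjTranspose_same K

theorem Model.gain_mul_innovation (S : Model d m Ξ) {C : Matrix (Fin d) (Fin d) ℝ}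
    (hC : C.PosSemidef) :
    S.gain C C * (S.H * C * S.H.transpose + S.Γ) = C * S.H.transpose := by
  rw [Model.gain, Matrix.mul_assoc, Matrix.nonsing_inv_mul _
    (isUnit_iff_ne_zero.2 (S.innovation_posDef hC).det_pos.ne'), Matrix.mul_one]

/-- Joseph's form of the updated covariance. -/
theorem Model.joseph_eq (S : Model d m Ξ) {C : Matrix (Fin d) (Fin d) ℝ} (hC : C.PosSemidef) :
    (1 - S.gain C C * S.H) * C * (1 - S.gain C C * S.H).transpose
      + S.gain C C * S.Γ * (S.gain C C).transpose = (1 - S.gain C C * S.H) * C := by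
  have h := S.gain_mul_innovation hC
  set K := S.gain C C
  -- The defining relation K(HCHᵀ + Γ) = CHᵀ, rearranged; it cancels the quadratic terms in K.
  have h1 : (1 - K * S.H) * C * S.H.transpose = K * S.Γ := by
    rw [Matrix.mul_add] at h
    have h2 : (1 - K * S.H) * C * S.H.transpose
        = C * S.H.transpose - K * (S.H * C * S.H.transpose) := by
      simp only [Matrix.sub_mul, Matrix.one_mul, Matrix.mul_assoc]
    rw [h2, sub_eq_iff_eq_add', h]
  rw [Matrix.transpose_sub, Matrix.transpose_one, Matrix.transpose_mul, Matrix.mul_sub,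
    Matrix.mul_one, ← Matrix.mul_assoc, h1]
  abel

theorem Model.updatedCov_posSemidef (S : Model d m Ξ) {C : Matrix (Fin d) (Fin d) ℝ}
    (hC : C.PosSemidef) : ((1 - S.gain C C * S.H) * C).PosSemidef := by
  rw [← S.joseph_eq hC]
  refine Matrix.PosSemidef.add ?_ ?_
  · have h := hC.mul_mul_conjTranspose_same (1 - S.gain C C * S.H)
    rwa [Matrix.conjTranspose_eq_transpose_of_trivial] at h
  · simpa using S.posDef_Γ.posSemidef.mul_mul_conjTranspose_same (S.gain C C)

/-- With J = C⁻¹ + HᵀΓ⁻¹H one has J C Hᵀ = HᵀΓ⁻¹(HCHᵀ + Γ); multiply by the inverse of the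
innovation covariance. It links the gain form of the update with its precision form, in which Bayes'
formula is immediate. -/
theorem Model.precision_mul_gain (S : Model d m Ξ) {C : Matrix (Fin d) (Fin d) ℝ} (hC : C.PosDef) :
    (C⁻¹ + S.H.transpose * S.Γ⁻¹ * S.H) * S.gain C C = S.H.transpose * S.Γ⁻¹ := by
  have hS : IsUnit (S.H * C * S.H.transpose + S.Γ).det :=
    isUnit_iff_ne_zero.2 (S.innovation_posDef hC.posSemidef).det_pos.ne'
  have hCu : IsUnit C.det := isUnit_iff_ne_zero.2 hC.det_pos.ne'
  have hΓ : IsUnit S.Γ.det := isUnit_iff_ne_zero.2 S.posDef_Γ.det_pos.ne'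
  have h : (C⁻¹ + S.H.transpose * S.Γ⁻¹ * S.H) * (C * S.H.transpose)
      = S.H.transpose * S.Γ⁻¹ * (S.H * C * S.H.transpose + S.Γ) := by
    rw [Matrix.add_mul, ← Matrix.mul_assoc C⁻¹, Matrix.nonsing_inv_mul _ hCu, Matrix.one_mul,
      Matrix.mul_add, Matrix.mul_assoc _ S.Γ⁻¹ S.Γ, Matrix.nonsing_inv_mul _ hΓ, Matrix.mul_one,
      add_comm]
    simp only [Matrix.mul_assoc]
  rw [Model.gain, ← Matrix.mul_assoc, h, Matrix.mul_assoc, Matrix.mul_nonsing_inv _ hS,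
    Matrix.mul_one]

theorem Model.precision_mul_one_sub (S : Model d m Ξ) {C : Matrix (Fin d) (Fin d) ℝ}
    (hC : C.PosDef) :
    (C⁻¹ + S.H.transpose * S.Γ⁻¹ * S.H) * (1 - S.gain C C * S.H) = C⁻¹ := by
  rw [Matrix.mul_sub, ← Matrix.mul_assoc, S.precision_mul_gain hC, Matrix.mul_one,
    add_sub_cancel_right]

theorem Model.precision_posDef (S : Model d m Ξ) {C : Matrix (Fin d) (Fin d) ℝ} (hC : C.PosDef) :
    (C⁻¹ + S.H.transpose * S.Γ⁻¹ * S.H).PosDef := by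
  refine hC.inv.add_posSemidef ?_
  simpa using S.posDef_Γ.inv.posSemidef.conjTranspose_mul_mul_same S.H

theorem Model.updatedCov_eq_inv (S : Model d m Ξ) {C : Matrix (Fin d) (Fin d) ℝ} (hC : C.PosDef) :
    (1 - S.gain C C * S.H) * C = (C⁻¹ + S.H.transpose * S.Γ⁻¹ * S.H)⁻¹ := by
  refine (Matrix.inv_eq_right_inv ?_).symm
  rw [← Matrix.mul_assoc, S.precision_mul_one_sub hC,
    Matrix.nonsing_inv_mul _ (isUnit_iff_ne_zero.2 hC.det_pos.ne')]

theorem inner_sub_act_sub {W : Matrix (Fin d) (Fin d) ℝ} (hW : W.transpose = W) (x a : E d) :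
    inner ℝ (x - a) (act W (x - a))
      = inner ℝ x (act W x) - 2 * inner ℝ x (act W a) + inner ℝ a (act W a) := by
  have h : inner ℝ a (act W x) = inner ℝ x (act W a) := by
    rw [real_inner_comm, inner_act, hW]
  rw [act_sub, inner_sub_left, inner_sub_right, inner_sub_right, h]
  ring

theorem transpose_inv_of_posDef {k : ℕ} {W : Matrix (Fin k) (Fin k) ℝ} (hW : W.PosDef) :
    W.transpose = W := by
  simpa using hW.isHermitian.eq

/-- Bayes' formula for a Gaussian prior and a linear observation with Gaussian noise. -/
theorem Model.gaussian_tilted (S : Model d m Ξ) {C : Matrix (Fin d) (Fin d) ℝ} (hC : C.PosDef)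
    (a : E d) (y : E m) :
    (multivariateGaussian a C).tilted
        (fun x => -(1 / 2) * inner ℝ (y - act S.H x) (act S.Γ⁻¹ (y - act S.H x)))
      = multivariateGaussian (act (1 - S.gain C C * S.H) a + act (S.gain C C) y)
        ((1 - S.gain C C * S.H) * C) := by
  set b := act (1 - S.gain C C * S.H) a + act (S.gain C C) y with hb
  have hJ := S.precision_posDef hC
  -- The linear terms of the two quadratic exponents combine to J b, so b is the centre of the
  -- completed square.
  have hJb : act (C⁻¹ + S.H.transpose * S.Γ⁻¹ * S.H) b
      = act C⁻¹ a + act (S.H.transpose * S.Γ⁻¹) y := by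
    rw [hb, act_add, act_act, act_act, S.precision_mul_one_sub hC, S.precision_mul_gain hC]
  have hJx : ∀ x : E d, act (C⁻¹ + S.H.transpose * S.Γ⁻¹ * S.H) x
      = act C⁻¹ x + act (S.H.transpose * S.Γ⁻¹ * S.H) x := fun x => act_add_left _ _ x
  rw [S.updatedCov_eq_inv hC, gaussian_eq_tilted hC,
    tilted_tilted (integrable_exp_gaussian hC a), gaussian_eq_tilted hJ.inv,
    Matrix.nonsing_inv_nonsing_inv _ (isUnit_iff_ne_zero.2 hJ.det_pos.ne')]
  -- The constant left over from completing the square is removed by normalization.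
  refine Eq.trans ?_ (tilted_add_const _ _ (-(1 / 2) * (inner ℝ a (act C⁻¹ a)
    + inner ℝ y (act S.Γ⁻¹ y) - inner ℝ b (act (C⁻¹ + S.H.transpose * S.Γ⁻¹ * S.H) b))))
  congr 1
  ext x
  have h1 : inner ℝ (act S.H x) (act S.Γ⁻¹ (act S.H x))
      = inner ℝ x (act (S.H.transpose * S.Γ⁻¹ * S.H) x) := by
    rw [inner_act, act_act, act_act]
  have h2 : inner ℝ y (act S.Γ⁻¹ (act S.H x)) = inner ℝ x (act (S.H.transpose * S.Γ⁻¹) y) := by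
    rw [real_inner_comm, inner_act, inner_act, transpose_inv_of_posDef S.posDef_Γ.inv, act_act]
  rw [Pi.add_apply, inner_sub_act_sub (transpose_inv_of_posDef hC.inv),
    inner_sub_act_sub (transpose_inv_of_posDef S.posDef_Γ.inv),
    inner_sub_act_sub (transpose_inv_of_posDef hJ), hJb, hJx, h1, h2]
  simp only [inner_add_right]
  ring

theorem Model.kalman_posSemidef (S : Model d m Ξ) {A Q C₀ : Matrix (Fin d) (Fin d) ℝ}
    (hQ : Q.PosSemidef) (hC₀ : C₀.PosSemidef) (m₀ : E d) (n : ℕ) :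
    (S.kalman A Q m₀ C₀ n).2.PosSemidef := by
  induction n with
  | zero => exact hC₀
  | succ n ih =>
    refine S.updatedCov_posSemidef (Matrix.PosSemidef.add ?_ hQ)
    simpa using ih.mul_mul_conjTranspose_same A

/-- In the linear Gaussian case, the mean-field filter is the Kalman filter. -/
theorem Model.meanFieldLaw_eq_kalman {A Q C₀ : Matrix (Fin d) (Fin d) ℝ} {m₀ : E d}
    (hQ : Q.PosSemidef) (hC₀ : C₀.PosSemidef) (hinit : S.init = multivariateGaussian m₀ C₀)
    (hPsi : ∀ x, S.noise.map (S.Psi ⊤ x) = multivariateGaussian (act A x) Q) (n : ℕ) :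
    S.meanFieldLaw n
      = multivariateGaussian (S.kalman A Q m₀ C₀ n).1 (S.kalman A Q m₀ C₀ n).2 := by
  induction n with
  | zero => exact hinit
  | succ n ih =>
    have hC := S.kalman_posSemidef (A := A) hQ hC₀ m₀ n
    have hP : (A * (S.kalman A Q m₀ C₀ n).2 * A.transpose + Q).PosSemidef :=
      Matrix.PosSemidef.add (by simpa using hC.mul_mul_conjTranspose_same A) hQ
    rw [Model.meanFieldLaw, ih, Model.predictLaw_gaussian hQ hC hPsi, covMatrix_gaussian hP,
      S.updateLaw_gaussian hP, S.joseph_eq hP]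
    rfl

/-- In the linear Gaussian case, the filtering distribution is given by the Kalman filter. -/
theorem Model.filteringLaw_eq_kalman {A Q C₀ : Matrix (Fin d) (Fin d) ℝ} {m₀ : E d}
    (hQ : Q.PosDef) (hC₀ : C₀.PosSemidef) (hinit : S.init = multivariateGaussian m₀ C₀)
    (hPsi : ∀ x, S.noise.map (S.Psi ⊤ x) = multivariateGaussian (act A x) Q) (n : ℕ) :
    S.filteringLaw n
      = multivariateGaussian (S.kalman A Q m₀ C₀ n).1 (S.kalman A Q m₀ C₀ n).2 := by
  induction n with
  | zero => exact hinit
  | succ n ih =>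
    have hC := S.kalman_posSemidef (A := A) hQ.posSemidef hC₀ m₀ n
    -- Only the predicted law needs a density, and a positive definite Q provides one even if the
    -- covariance before prediction is singular.
    have hP : (A * (S.kalman A Q m₀ C₀ n).2 * A.transpose + Q).PosDef :=
      Matrix.PosDef.posSemidef_add (by simpa using hC.mul_mul_conjTranspose_same A) hQ
    rw [Model.filteringLaw, ih, Model.predictLaw_gaussian hQ.posSemidef hC hPsi,
      S.gaussian_tilted hP]
    rfl

end Kalman

end MLEnKF

/-! ### Transfer to an arbitrary probability space and the main theorem. -/

namespace MLEnKF

variable {d m : ℕ} {Ξ : Type*} [MeasurableSpace Ξ] {S : Model d m Ξ} {F : Set (E d → ℝ)}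
  {N : ℕ → ℕ} {cost : ℕ → ℝ≥0} {α β γ : ℝ}

/-- The joint law of independent draws of the particles. -/
theorem Model.measurePreserving_sample {Ω : Type*} [MeasurableSpace Ω] {P : Measure Ω}
    {X : ℕ → ℕ → Ω → Draw d m Ξ} (hX : ∀ l i, Measurable (X l i))
    (hlaw : ∀ l i, P.map (X l i) = S.drawLaw)
    (hindep : iIndepFun (fun (q : ℕ × ℕ) ω => X q.1 q.2 ω) P) :
    MeasurePreserving (fun ω (q : ℕ × ℕ) => X q.1 q.2 ω) P S.sampleLaw := by
  refine ⟨measurable_pi_iff.2 fun q => hX q.1 q.2, ?_⟩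
  have h := hindep.map_fun_eq_infinitePi_map fun q : ℕ × ℕ => hX q.1 q.2
  refine h.trans ?_
  simp only [hlaw]
  rfl

theorem Model.measurable_empiricalIntegral (S : Model d m Ξ) (L : ℕ) (M : ℕ → ℕ) (n : ℕ)
    {φ : E d → ℝ} (hφ : Continuous φ) :
    Measurable fun w => empiricalIntegral L M (S.updated L M n w) φ := by
  unfold empiricalIntegral
  refine Finset.measurable_sum _ fun l _ => (Finset.measurable_sum _ fun i _ => ?_).const_mul _
  refine (hφ.measurable.comp (S.measurable_updated L M n l i).fst).sub ?_
  split_ifs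
  · exact measurable_const
  · exact hφ.measurable.comp (S.measurable_updated L M n l i).snd

theorem Model.integrable_meanFieldLaw (hS : LipschitzMoment S) (n : ℕ) {φ : E d → ℝ}
    (hφ : LocallyLipschitzPoly φ) : Integrable φ (S.meanFieldLaw n) := by
  have hφc := hφ.continuous
  rw [← S.levelLaw_top, ← S.map_path, integrable_map_measure hφc.aestronglyMeasurable
    (S.measurable_path ⊤ n).aemeasurable]
  exact (hφ.lpO (S.lpO_path hS n)).integrable ⊤

/-- The error of the multilevel filter, for admissible parameters. -/
theorem MultilevelRates.exists_eLpNorm_le (hF : MultilevelRates S F N cost α β γ)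
    (hS : LipschitzMoment S) {c₁ c₂ ε₀ : ℝ} (hc₁ : 0 < c₁) (hc₂ : 0 < c₂) (h0 : 0 < ε₀)
    (hε₀' : ε₀ < 1) (n : ℕ) {φ : E d → ℝ} (hφF : φ ∈ F) (hφ : LocallyLipschitzPoly φ) {p : ℝ≥0}
    (hp : 2 ≤ p) : ∃ c : ℝ, 0 < c ∧ ∀ ε : ℝ, 0 < ε → ε ≤ ε₀ → ∀ (L : ℕ) (M : ℕ → ℕ),
      Admissible N α β γ c₁ c₂ ε L M →
        eLpNorm (fun w => empiricalIntegral L M (S.updated L M n w) φ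
          - ∫ x, φ x ∂(S.meanFieldLaw n)) p S.sampleLaw
          ≤ ENNReal.ofReal (c * (|Real.log ε| ^ n * ε)) := by
  have hR := hF.sampleRates (c₁ := c₁) (c₂ := c₂) (ε₀ := ε₀) hc₁ hc₂ hε₀'
  obtain ⟨C, hC⟩ := (hR.lpO_empiricalIntegral hS hF n hφF hφ).bound p hp
  obtain ⟨C', hC', h'⟩ := exists_levels_pow_le (N := N) (α := α) (β := β) (γ := γ) (c₁ := c₁)
    hc₂ h0 hε₀' n
  refine ⟨(C + 1) * C', by positivity, fun ε hε hε₀ L M hA => ?_⟩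
  refine (hC ⟨(ε, L, M), hε, hε₀, hA⟩).trans ?_
  rw [← ENNReal.coe_mul, ENNReal.ofReal, ENNReal.coe_le_coe, ← NNReal.coe_le_coe,
    Real.coe_toNNReal _ (by positivity)]
  push_cast
  rw [Real.coe_toNNReal _ hε.le]
  have h1 := h' ε L M hε hε₀ hA
  calc (C : ℝ) * (((L : ℝ) + 1) ^ n * ε) ≤ (C + 1) * ((C' * |Real.log ε| ^ n) * ε) := by
        gcongr
        linarith
    _ = _ := by ring

end MLEnKF
theorem theorem3p1 {d m : ℕ} {Ξ : Type*} [MeasurableSpace Ξ] (S : Model d m Ξ)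
    (F : Set (E d → ℝ)) (N : ℕ → ℕ) (cost : ℕ → ℝ≥0) (pairCost gainCost : ℝ≥0) (α β γ : ℝ)
    (hS : LipschitzMoment S) (hF : MultilevelRates S F N cost α β γ)
    -- the randomness of the particles, independent and identically distributed
    {Ω : Type*} [MeasurableSpace Ω] (P : Measure Ω) [IsProbabilityMeasure P]
    (X : ℕ → ℕ → Ω → Draw d m Ξ) (hX : ∀ l i, Measurable (X l i))
    (hlaw : ∀ l i, P.map (X l i) = S.drawLaw)
    (hindep : iIndepFun (fun (q : ℕ × ℕ) ω => X q.1 q.2 ω) P)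
    -- the constants in the choice of the parameters, and the largest accuracy considered
    (c₁ c₂ ε₀ : ℝ) (hc₁ : 0 < c₁) (hc₂ : 0 < c₂) (hε₀ : 0 < ε₀) (hε₀' : ε₀ < 1) :
    -- accuracy
    (∀ n : ℕ, ∀ φ ∈ F, LocallyLipschitzPoly φ →
      Integrable φ (S.meanFieldLaw n) ∧
      ∀ p : ℝ≥0, 2 ≤ p → ∃ c : ℝ, 0 < c ∧
        ∀ ε : ℝ, 0 < ε → ε ≤ ε₀ → ∀ (L : ℕ) (M : ℕ → ℕ), Admissible N α β γ c₁ c₂ ε L M →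
          AEStronglyMeasurable
            (fun ω => empiricalIntegral L M (S.ensemble L M (fun l i => X l i ω) n) φ) P ∧
          eLpNorm (fun ω => empiricalIntegral L M (S.ensemble L M (fun l i => X l i ω) n) φ
              - ∫ x, φ x ∂(S.meanFieldLaw n)) p P
            ≤ ENNReal.ofReal (c * (|Real.log ε| ^ n * ε))) ∧
    -- cost
    (∀ n : ℕ, ∃ c : ℝ, 0 < c ∧
      ∀ ε : ℝ, 0 < ε → ε ≤ ε₀ → ∀ (L : ℕ) (M : ℕ → ℕ), Admissible N α β γ c₁ c₂ ε L M →
        (totalCost cost pairCost gainCost n L M : ℝ) ≤ c * costRate α β γ ε) ∧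
    -- in the linear Gaussian case, the mean-field law is the filtering distribution, and it is
    -- given by the Kalman filter
    (∀ (A Q C₀ : Matrix (Fin d) (Fin d) ℝ) (m₀ : E d), Q.PosDef → C₀.PosSemidef →
      S.init = multivariateGaussian m₀ C₀ →
      (∀ x, S.noise.map (S.Psi ⊤ x) = multivariateGaussian (act A x) Q) →
      ∀ n : ℕ,
        S.meanFieldLaw n = S.filteringLaw n ∧
        S.meanFieldLaw n
          = multivariateGaussian (S.kalman A Q m₀ C₀ n).1 (S.kalman A Q m₀ C₀ n).2) := by
  have hXP := S.measurePreserving_sample hX hlaw hindep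
  refine ⟨fun n φ hφF hφ => ⟨S.integrable_meanFieldLaw hS n hφ, fun p hp => ?_⟩, fun n => ?_, ?_⟩
  · obtain ⟨c, hc, h⟩ := hF.exists_eLpNorm_le hS hc₁ hc₂ hε₀ hε₀' n hφF hφ hp
    refine ⟨c, hc, fun ε hε hεε₀ L M hA => ?_⟩
    have hm := S.measurable_empiricalIntegral L M n hφ.continuous
    refine ⟨(hm.comp hXP.measurable).aestronglyMeasurable, ?_⟩
    -- The family of draws preserves measure onto the canonical product space, so the L^p norm of
    -- the error is the one already estimated there.
    have hcomp := eLpNorm_comp_measurePreserving (p := p)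
      (hm.sub_const (∫ x, φ x ∂(S.meanFieldLaw n))).aestronglyMeasurable hXP
    simp only [Function.comp_def] at hcomp
    have hle := h ε hε hεε₀ L M hA
    rw [← hcomp] at hle
    exact hle
  · obtain ⟨c, hc, h⟩ := hF.totalCost_le hc₁ hc₂ hε₀ hε₀' pairCost gainCost n
    exact ⟨c, hc, fun ε hε hεε₀ L M hA => h ε L M hε hεε₀ hA⟩
  · intro A Q C₀ m₀ hQ hC₀ hinit hPsi n
    have h := Model.meanFieldLaw_eq_kalman hQ.posSemidef hC₀ hinit hPsi n
    exact ⟨h.trans (Model.filteringLaw_eq_kalman hQ hC₀ hinit hPsi n).symm, h⟩
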